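/- **Theorem 5.1.** Let $K$ be a field of characteristic zero, let $\phi(z)=\sum_{k\ge 0}\phi_k z^k\in K[[z]]$ with $\phi_0=1$, and let $L:K[y]\to K[y]$ be a $K$-linear map, extended to $K[y][[x]]$ by acting on the coefficients of the powers of $x$. For a coproduct $\Delta$ on $K[y]$, call $L$ a Hochschild 1-cocycle if $\Delta\circ L=(\mathrm{id}\otimes L)\circ\Delta+L\otimes 1$. *Chord diagrams.* A chord diagram $C$ of size $|C|=n$ is a perfect matching of $\{1,\dots,2n\}$; a chord is written $(a,b)$ with source $a$ < sink $b$. The chord $(a',b')$ is a right neighbor of $(a,b)$, and $(a,b)$ a left neighbor of $(a',b')$, if $a<a'<b<b'$; the two chords then cross. $C$ is connected if its intersection graph (vertices: chords, edges: crossings) is connected and nonempty; $\mathcal C$ is the set of connected diagrams. The standard order of chords is the order of their sources, and the root of a set of chords is its first chord in this order. The intersection order of a connected diagram is defined recursively: list the root first, remove it, and then list the resulting connected components one after the other, in the standard order of their roots, each recursively. A chord is terminal if it has no right neighbor; $t_1(C)<t_2(C)<\dots<t_k(C)$ are the positions (counted from $1$) of the terminal chords of $C$ in the intersection order. The valency $\mathrm{val}(c)$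 of $c\in C$ is the number of left neighbors of $c$ that cross no chord coming after $c$ in the standard order, plus the number of indecomposable components which immediately follow the source of $c$ once the left neighbors of $c$ are removed; that is, if $a$ is the source of $c$, the number of sinks $q>a$ of remaining chords such that every remaining chord has both or none of its endpoints in $(a,q]$. For $m\ge 3$ the top cycle of size $m$ is the diagram with chords $(2i-1,2i+2)$ for $1\le i\le m-1$ and $(2,2m-1)$; $\mathcal C_{top}$ is the set of connected diagrams no subset of whose chords is, after an order-preserving relabelling of the endpoints, a top cycle. *Weights.* For $F(z)=\sum_{i\ge0}f_iz^i\in K[[z]]$ and a connected diagram $C$ with $k$ terminal chords put $$\phi_C=\prod_{c\in C}\phi_{\mathrm{val}(c)},\qquad f_C=f_0^{|C|-k}\,f_{t_2(C)-t_1(C)}\,f_{t_3(C)-t_2(C)}\cdots f_{t_k(C)-t_{k-1}(C)}.$$ (a) Suppose $L=L_{bin}$ is a Hochschild 1-cocycle for the binomial coproduct $\Delta(y^n)=\sum_{j=0}^n\binom nj y^j\otimes y^{n-j}$. Then there is a unique $F\in K[[z]]$ with $L(y^n)=\int_0^yF\!\left(\frac{d}{dt}\right)t^n\,dt$ for all $n\ge0$,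 and, with the $f_i$ the coefficients of this $F$, the equation $G=xL(\phi(G))$ has exactly one solution $G\in K[y][[x]]$, namely $$G(x,y)=\sum_{C\in\mathcal C}f_C\,\phi_C\,x^{|C|}\,\frac{L(y^{t_1(C)-1})}{(t_1(C)-1)!}.$$ (b) Suppose $L=L_{div}$ is a Hochschild 1-cocycle for the divided power coproduct $\Delta(y^n)=\sum_{j=0}^n y^j\otimes y^{n-j}$. Then there is a unique $F\in K[[z]]$ with $L(y^n)=y\,F\!\left(\frac{\delta}{\delta y}\right)y^n$ for all $n\ge0$, where $\frac{\delta}{\delta y}$ is the linear map with $y^n\mapsto y^{n-1}$ for $n\ge1$ and $1\mapsto 0$, and, with the $f_i$ the coefficients of this $F$, the equation $G=xL(\phi(G))$ has exactly one solution $G\in K[y][[x]]$, namely $$G(x,y)=\sum_{C\in\mathcal C_{top}}f_C\,\phi_C\,x^{|C|}\,L(y^{t_1(C)-1}).$$ -/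

import Mathlib

open scoped Polynomial PowerSeries TensorProduct

noncomputable section

namespace ChordDiagram

/-! ### Chord diagrams and their intersection graphs -/

/-- A chord `(x, y)` with source `x` and sink `y`. -/
abbrev Chord := ℕ × ℕ

/-- `C` is a rooted chord diagram of size `n`: a perfect matching of `{1, ..., 2n}`, every chord
being written as an ordered pair (source, sink) with source `<` sink.  Subdiagrams are subsets of
`C`; they are not relabelled, since all notions below depend only on the relative order of the
endpoints. -/
def IsDiagram (n : ℕ) (C : Finset Chord) : Prop :=
  (∀ c ∈ C, 1 ≤ c.1 ∧ c.1 < c.2 ∧ c.2 ≤ 2 * n) ∧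
    ∀ i, 1 ≤ i → i ≤ 2 * n → ∃! c, c ∈ C ∧ (c.1 = i ∨ c.2 = i)

/-- `d` is a right neighbor of `c` (and `c` is a left neighbor of `d`): the directed edge from `c`
to `d` of the directed intersection graph. -/
def RightNbr (c d : Chord) : Prop := c.1 < d.1 ∧ d.1 < c.2 ∧ c.2 < d.2

/-- The two chords cross. -/
def Crosses (c d : Chord) : Prop := RightNbr c d ∨ RightNbr d c

/-- The undirected intersection graph of a finite set of chords. -/
def intersectionGraph (S : Finset Chord) : SimpleGraph S where
  Adj c d := Crosses c.1 d.1
  symm := ⟨fun _ _ h => Or.symm h⟩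
  loopless := ⟨fun _ h => by
    rcases h with h | h <;> exact lt_irrefl _ h.1⟩

/-- A diagram is connected if its intersection graph is connected (in particular nonempty). -/
def IsConnected (S : Finset Chord) : Prop := (intersectionGraph S).Connected

open Classical in
/-- The set of connected chord diagrams of size `n`. -/
def connectedDiagrams (n : ℕ) : Finset (Finset Chord) :=
  (Finset.Icc 1 (2 * n) ×ˢ Finset.Icc 1 (2 * n)).powerset.filter
    (fun C => IsDiagram n C ∧ IsConnected C)

/-! ### Intersection order and terminal chords -/

/-- The root of a nonempty set of chords: the chord with the leftmost source. -/
def root (S : Finset Chord) (h : S.Nonempty) : Chord := (S.exists_min_image Prod.fst h).choose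

lemma root_mem (S : Finset Chord) (h : S.Nonempty) : root S h ∈ S :=
  (S.exists_min_image Prod.fst h).choose_spec.1

/-- `d` can be reached from `r` in the intersection graph of `S`. -/
def SameComponent (S : Finset Chord) (r d : Chord) : Prop :=
  ∃ (hr : r ∈ S) (hd : d ∈ S), (intersectionGraph S).Reachable ⟨r, hr⟩ ⟨d, hd⟩

open Classical in
/-- The connected component of the chord `r` in the set of chords `S`. -/
def component (S : Finset Chord) (r : Chord) : Finset Chord :=
  S.filter (SameComponent S r)

lemma component_subset (S : Finset Chord) (r : Chord) : component S r ⊆ S := by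
  classical
  exact Finset.filter_subset _ _

lemma mem_component_self {S : Finset Chord} {r : Chord} (h : r ∈ S) : r ∈ component S r := by
  classical
  exact Finset.mem_filter.2 ⟨h, h, h, SimpleGraph.Reachable.refl _⟩

open Classical in
/-- The chords of `S` listed in the intersection order.  The connected components of `S` are listed
one after the other in the standard order of their roots, and inside a component `K` with root `r`
the root comes first and is followed by the list for `K \ {r}`.  In particular, a connected diagram
is listed as its root followed by the components of the rest, in the standard order of their roots,
each of them listed recursively. -/
def intersectionOrder (S : Finset Chord) : List Chord :=
  if h : S.Nonempty then
    root S h :: (intersectionOrder ((component S (root S h)).erase (root S h)) ++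
      intersectionOrder (S \ component S (root S h)))
  else []
termination_by S.card
decreasing_by
  · exact lt_of_lt_of_le (Finset.card_erase_lt_of_mem (mem_component_self (root_mem S h)))
      (Finset.card_le_card (component_subset _ _))
  · exact Finset.card_lt_card (Finset.sdiff_ssubset (component_subset _ _)
      ⟨_, mem_component_self (root_mem S h)⟩)

/-- A chord of `C` is terminal if it has no right neighbor in `C`. -/
def IsTerminal (C : Finset Chord) (c : Chord) : Prop := ∀ d ∈ C, ¬ RightNbr c d

/-- The index (starting at `1`) of the chord `c` in the intersection order of `C`. -/
def index (C : Finset Chord) (c : Chord) : ℕ := (intersectionOrder C).idxOf c + 1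

open Classical in
/-- The set of terminal chords of `C`. -/
def terminalChords (C : Finset Chord) : Finset Chord := C.filter (IsTerminal C)

/-- `t C j` is the index `t_j(C)` in the intersection order of the `j`-th terminal chord of `C`,
for `1 ≤ j ≤` number of terminal chords. -/
def t (C : Finset Chord) (j : ℕ) : ℕ :=
  (((terminalChords C).image (index C)).sort (· ≤ ·)).getD (j - 1) 0

/-! ### Valency and weights -/

open Classical in
/-- The left neighbors of `c` in `C`. -/
def leftNbrs (C : Finset Chord) (c : Chord) : Finset Chord := C.filter (fun b => RightNbr b c)

open Classical in
/-- For a set of chords `S` and a position `p`, the right ends of the indecomposable components of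
`S` that immediately follow `p`: the sinks `q > p` such that the segment `(p, q]` contains both
endpoints or none of every chord of `S`.  If these are `q₁ < ... < q_ℓ`, then the segments
`(p, q₁], (q₁, q₂], ..., (q_{ℓ-1}, q_ℓ]` carry the successive components. -/
def followingComponentEnds (S : Finset Chord) (p : ℕ) : Finset ℕ :=
  (S.image Prod.snd).filter
    (fun q => p < q ∧ ∀ d ∈ S, (p < d.1 ∧ d.1 ≤ q) ↔ (p < d.2 ∧ d.2 ≤ q))

open Classical in
/-- The valency of `c` in `C`: the number of left neighbors of `c` that cross no chord coming after
`c` in the standard order, plus the number of indecomposable components immediately following the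
source of `c` once the left neighbors of `c` are removed. -/
def valency (C : Finset Chord) (c : Chord) : ℕ :=
  ((leftNbrs C c).filter (fun b => ∀ d ∈ C, c.1 < d.1 → ¬ Crosses b d)).card +
    (followingComponentEnds (C \ leftNbrs C c) c.1).card

/-- The weight `φ_C`, the product of `φ_{val c}` over the chords `c` of `C`. -/
def phiWeight {K : Type*} [Field K] (φ : K⟦X⟧) (C : Finset Chord) : K :=
  ∏ c ∈ C, PowerSeries.coeff (valency C c) φ

/-- The weight `f_C = f₀^{|C| - k} f_{t₂ - t₁} ⋯ f_{t_k - t_{k-1}}`, with `k` the number of terminal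
chords of `C`. -/
def fWeight {K : Type*} [Field K] (F : K⟦X⟧) (C : Finset Chord) : K :=
  PowerSeries.coeff 0 F ^ (C.card - (terminalChords C).card) *
    ∏ j ∈ Finset.Ico 1 (terminalChords C).card, PowerSeries.coeff (t C (j + 1) - t C j) F

/-! ### Top cycles -/

/-- The top cycle diagram of size `m ≥ 3`: the nonnesting path of the `m - 1` chords
`(2i - 1, 2i + 2)`, closed to a cycle by the chord `(2, 2m - 1)`. -/
def topCycle (m : ℕ) : Finset Chord :=
  insert (2, 2 * m - 1) ((Finset.Icc 1 (m - 1)).image (fun i => (2 * i - 1, 2 * i + 2)))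

/-- No subdiagram of `C` is, up to an order preserving relabelling `g` of the endpoints, a top
cycle. -/
def IsTopCycleFree (C : Finset Chord) : Prop :=
  ∀ m, 3 ≤ m → ∀ g : ℕ → ℕ, StrictMonoOn g (Set.Icc 1 (2 * m)) →
    ¬ (topCycle m).image (Prod.map g g) ⊆ C

open Classical in
/-- The set of connected top-cycle-free chord diagrams of size `n`. -/
def connectedTopCycleFreeDiagrams (n : ℕ) : Finset (Finset Chord) :=
  (connectedDiagrams n).filter IsTopCycleFree

/-! ### Hochschild 1-cocycles on `K[y]` -/

/-- The coproduct `y^n ↦ ∑_k (n choose k) y^k ⊗ y^(n-k)` of the binomial coalgebra. -/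
def binomialComul (K : Type*) [Field K] : K[X] →ₗ[K] K[X] ⊗[K] K[X] :=
  (Polynomial.basisMonomials K).constr K fun n =>
    ∑ k ∈ Finset.range (n + 1),
      (n.choose k : K) • ((Polynomial.X ^ k : K[X]) ⊗ₜ[K] (Polynomial.X ^ (n - k) : K[X]))

/-- The coproduct `y^n ↦ ∑_k y^k ⊗ y^(n-k)` of the divided power coalgebra. -/
def dividedPowerComul (K : Type*) [Field K] : K[X] →ₗ[K] K[X] ⊗[K] K[X] :=
  (Polynomial.basisMonomials K).constr K fun n =>
    ∑ k ∈ Finset.range (n + 1),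
      (Polynomial.X ^ k : K[X]) ⊗ₜ[K] (Polynomial.X ^ (n - k) : K[X])

/-- `L` is a Hochschild 1-cocycle for the coproduct `Δ`: `Δ ∘ L = (id ⊗ L) ∘ Δ + L ⊗ 1`. -/
def IsOneCocycle {K : Type*} [Field K] (Δ : K[X] →ₗ[K] K[X] ⊗[K] K[X]) (L : K[X] →ₗ[K] K[X]) :
    Prop :=
  ∀ p : K[X], Δ (L p) = L.lTensor K[X] (Δ p) + L p ⊗ₜ[K] (1 : K[X])

/-- The integral `p ↦ ∫_0^y p(t) dt`. -/
def integral (K : Type*) [Field K] : K[X] →ₗ[K] K[X] :=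
  (Polynomial.basisMonomials K).constr K fun n =>
    ((n : K) + 1)⁻¹ • (Polynomial.X ^ (n + 1) : K[X])

/-- The power series `F = ∑ f_i z^i` specifies the binomial operator `L`:
`L(y^n) = ∫_0^y F(d/dt) t^n dt` for all `n`.  (The terms `i > n` of `F(d/dt) t^n` vanish.) -/
def BinomialSpecifies {K : Type*} [Field K] (F : K⟦X⟧) (L : K[X] →ₗ[K] K[X]) : Prop :=
  ∀ n : ℕ, L (Polynomial.X ^ n) = integral K (∑ i ∈ Finset.range (n + 1),
    PowerSeries.coeff i F • (Polynomial.derivative^[i] (Polynomial.X ^ n : K[X])))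

/-- The power series `F = ∑ f_i z^i` specifies the divided power operator `L`:
`L(y^n) = y F(δ/δy) y^n` for all `n`, where `δ/δy` (which is `Polynomial.divX`) sends `y^n` to
`y^(n-1)` if `n > 0` and to `0` if `n = 0`.  (The terms `i > n` of `F(δ/δy) y^n` vanish.) -/
def DividedPowerSpecifies {K : Type*} [Field K] (F : K⟦X⟧) (L : K[X] →ₗ[K] K[X]) : Prop :=
  ∀ n : ℕ, L (Polynomial.X ^ n) = Polynomial.X * ∑ i ∈ Finset.range (n + 1),
    PowerSeries.coeff i F • (Polynomial.divX^[i] (Polynomial.X ^ n : K[X]))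

/-! ### The tree-like equation and the two generating functions -/

/-- The action of `L` on `K[y]⟦x⟧`, coefficient by coefficient in `x`. -/
def mapCoeffs {K : Type*} [Field K] (L : K[X] →ₗ[K] K[X]) (G : K[X]⟦X⟧) : K[X]⟦X⟧ :=
  PowerSeries.mk fun n => L (PowerSeries.coeff n G)

/-- `G` in `K[y]⟦x⟧` solves the tree-like equation `G = x L(φ(G))`.  The equation forces the
constant term of `G` in `x` to vanish, so that `φ(G)` is a genuine substitution. -/
def IsTreeLikeSolution {K : Type*} [Field K] (φ : K⟦X⟧) (L : K[X] →ₗ[K] K[X]) (G : K[X]⟦X⟧) :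
    Prop :=
  G = PowerSeries.X * mapCoeffs L (PowerSeries.subst G φ)

/-- `∑_C f_C φ_C x^|C| L(y^(t₁(C)-1)) / (t₁(C)-1)!` over the connected chord diagrams `C`. -/
def binomialGF {K : Type*} [Field K] (φ F : K⟦X⟧) (L : K[X] →ₗ[K] K[X]) : K[X]⟦X⟧ :=
  PowerSeries.mk fun n => ∑ C ∈ connectedDiagrams n,
    (fWeight F C * phiWeight φ C * ((t C 1 - 1).factorial : K)⁻¹) •
      L (Polynomial.X ^ (t C 1 - 1))

/-- `∑_C f_C φ_C x^|C| L(y^(t₁(C)-1))` over the connected top-cycle-free chord diagrams `C`. -/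
def dividedPowerGF {K : Type*} [Field K] (φ F : K⟦X⟧) (L : K[X] →ₗ[K] K[X]) : K[X]⟦X⟧ :=
  PowerSeries.mk fun n => ∑ C ∈ connectedTopCycleFreeDiagrams n,
    (fWeight F C * phiWeight φ C) • L (Polynomial.X ^ (t C 1 - 1))

end ChordDiagram

end

/-!
Write `ℓ(p)` for the coefficient of `y` in `L p`. The cocycle condition forces `L p` to have no
constant term, and it says that `∂ (L p) = L (∂ p) + ℓ(p)`, where `∂` is `d/dy` in the binomial
case and the divided difference `y ^ n ↦ y ^ (n - 1)` in the divided power case. The numbers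
`ℓ(y ^ i)` can be arbitrary and are, up to a factorial, the coefficients `f_i`
(`existsUnique_binomialSpecifies`, `existsUnique_dividedPowerSpecifies`). Both generating
functions have the form `L H`, where `H` carries `y ^ i / i!` or `y ^ i` in place of its image
under `L`, so it suffices to show `H = x φ(L H)`. Uniqueness is clear, as the equation determines
the coefficients of `G` recursively (`IsTreeLikeSolution.unique`).

The combinatorial input is the root-share decomposition. Removing the root of a connected diagram
`A` with at least two chords, let `K` be the component containing the second endpoint, and let `C`
consist of the other chords of `A`, including the root. Then `A` arises by inserting `C` into `K`
after the `p`-th endpoint of `K`, with the source of the root of `C` pulled to the front, and this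
is a bijection between the `A` and the triples `(K, p, C)` with `1 ≤ p < 2 |K|`
(`sum_connectedDiagrams`). In the intersection order the root is followed by `K` and then by the
rest of `C`; hence `t₁(A) = t₁(K) + 1` and `f_A = f_K f_C f_{t₁(C) - 1}` (`IsInsertion.t_one`,
`IsInsertion.fWeight_insert`). The valency of a chord turns out to be one less than the number of
positions between consecutive endpoints at which this chord is the covering chord with the last
source (`card_isTop`). As the insertion doubles the position `p` of `K`, it raises the valency of
exactly one chord of `K` by one and keeps all others (`IsInsertion.bumpWeight`).

In the binomial case all positions `p` are allowed. A chord of valency `v` is raised by `v + 1` of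
them, so the sum over `p` of the raised weights is `D φ_K`, for the derivation `D` with
`D φ_i = (i + 1) φ_{i + 1}`, which exists when the `φ_i` are indeterminates
(`derivation_bumpWeight`). The decomposition becomes the transport equation `∂ H = ℓ(H) D H`
(`derivative_connectedSeries`). By the chain rule `x φ(L H)` satisfies the same linear equation
with the same value at `y = 0`, so the two agree (`eq_X_mul_compo_of_transport`), and the `φ_i`
can then be specialized (`connectedSeries_eq`).

In the divided power case an insertion creates a top cycle exactly if `p` is blocked, which can be
read off from chains of right neighbors in `K` (`IsInsertion.isTopCycleFree_iff`). The open
positions of an insertion are those of `C` followed by those of `K` from `p` on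
(`IsInsertion.openPositions_eq`). Therefore the generating functions `X_m` of diagrams whose
weight is raised at a multiset of `m` open positions, in all possible ways, satisfy
`∂ X_m = ∑_{i + j = m} X_{i + 1} ℓ(X_j)` (`divX_openSeries`). With `Ψ_a = ∑_k φ_{k + a} (L X_0)^k`
the series `x φ_m + x ∑_{i + j = m} Ψ_{i + 1} L X_j` satisfy a system with the same unique
solution (`eq_X_mul_compo_of_dividedDifference`), and for `m = 0` this is `X_0 = x φ(L X_0)`.
-/

namespace ChordDiagram

/-! ### Connectedness and relabelling -/

/-- The chords `c` and `d` are joined by a path of crossing chords of `S`. -/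
def Linked (S : Finset Chord) : Chord → Chord → Prop :=
  Relation.ReflTransGen fun c d => c ∈ S ∧ d ∈ S ∧ Crosses c d

lemma Crosses.symm {c d : Chord} (h : Crosses c d) : Crosses d c := Or.symm h

lemma Linked.symm {S : Finset Chord} {c d : Chord} (h : Linked S c d) : Linked S d c := by
  induction h with
  | refl => exact .refl
  | tail _ h ih => exact .head ⟨h.2.1, h.1, h.2.2.symm⟩ ih

lemma Linked.trans {S : Finset Chord} {c d e : Chord} (h : Linked S c d) (h' : Linked S d e) :
    Linked S c e := Relation.ReflTransGen.trans h h'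

lemma Linked.mono {S T : Finset Chord} (hST : S ⊆ T) {c d : Chord} (h : Linked S c d) :
    Linked T c d :=
  Relation.ReflTransGen.mono (fun _ _ h => ⟨hST h.1, hST h.2.1, h.2.2⟩) _ _ h

lemma sameComponent_iff {S : Finset Chord} {r d : Chord} :
    SameComponent S r d ↔ r ∈ S ∧ d ∈ S ∧ Linked S r d := by
  constructor
  · rintro ⟨hr, hd, h⟩
    rw [SimpleGraph.reachable_iff_reflTransGen] at h
    refine ⟨hr, hd, ?_⟩
    have := Relation.ReflTransGen.lift
      (p := fun c d => c ∈ S ∧ d ∈ S ∧ Crosses c d) (fun x : S => x.1)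
      (fun a b hab => ⟨a.2, b.2, hab⟩) _ _ h
    exact this
  · rintro ⟨hr, hd, h⟩
    refine ⟨hr, hd, ?_⟩
    induction h with
    | refl => exact SimpleGraph.Reachable.refl _
    | tail _ h ih => exact (ih h.1).trans (SimpleGraph.Adj.reachable (G := intersectionGraph S)
        (u := ⟨_, h.1⟩) (v := ⟨_, hd⟩) h.2.2)

lemma isConnected_iff {S : Finset Chord} :
    IsConnected S ↔ S.Nonempty ∧ ∀ c ∈ S, ∀ d ∈ S, Linked S c d := by
  rw [IsConnected, SimpleGraph.connected_iff]
  constructor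
  · rintro ⟨h, ⟨c⟩⟩
    exact ⟨⟨c.1, c.2⟩, fun c hc d hd => (sameComponent_iff.1 ⟨hc, hd, h _ _⟩).2.2⟩
  · rintro ⟨⟨c, hc⟩, h⟩
    exact ⟨fun a b => (sameComponent_iff.2 ⟨a.2, b.2, h _ a.2 _ b.2⟩).2.2, ⟨⟨c, hc⟩⟩⟩

lemma mem_component {S : Finset Chord} {r d : Chord} :
    d ∈ component S r ↔ r ∈ S ∧ d ∈ S ∧ Linked S r d := by
  classical
  rw [component, Finset.mem_filter, sameComponent_iff]
  tauto

/-- Every chord of `S` has its source before its sink, and distinct chords have no endpoint in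
common. -/
structure IsMatching (S : Finset Chord) : Prop where
  lt : ∀ c ∈ S, c.1 < c.2
  ne : ∀ c ∈ S, ∀ d ∈ S, c ≠ d → c.1 ≠ d.1 ∧ c.1 ≠ d.2 ∧ c.2 ≠ d.1 ∧ c.2 ≠ d.2

lemma IsMatching.subset {S T : Finset Chord} (h : IsMatching T) (hST : S ⊆ T) : IsMatching S :=
  ⟨fun c hc => h.lt c (hST hc), fun c hc d hd => h.ne c (hST hc) d (hST hd)⟩

/-- The set of all sources and sinks of chords of `S`. -/
def endpoints (S : Finset Chord) : Finset ℕ := S.image Prod.fst ∪ S.image Prod.snd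

lemma mem_endpoints {S : Finset Chord} {i : ℕ} :
    i ∈ endpoints S ↔ ∃ c ∈ S, c.1 = i ∨ c.2 = i := by
  simp only [endpoints, Finset.mem_union, Finset.mem_image]
  constructor
  · rintro (⟨c, hc, h⟩ | ⟨c, hc, h⟩)
    exacts [⟨c, hc, .inl h⟩, ⟨c, hc, .inr h⟩]
  · rintro ⟨c, hc, h | h⟩
    exacts [.inl ⟨c, hc, h⟩, .inr ⟨c, hc, h⟩]

lemma fst_mem_endpoints {S : Finset Chord} {c : Chord} (h : c ∈ S) : c.1 ∈ endpoints S :=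
  mem_endpoints.2 ⟨c, h, .inl rfl⟩

lemma snd_mem_endpoints {S : Finset Chord} {c : Chord} (h : c ∈ S) : c.2 ∈ endpoints S :=
  mem_endpoints.2 ⟨c, h, .inr rfl⟩

lemma IsMatching.eq_of_endpoint {S : Finset Chord} (h : IsMatching S) {c d : Chord} (hc : c ∈ S)
    (hd : d ∈ S) {i : ℕ} (hci : c.1 = i ∨ c.2 = i) (hdi : d.1 = i ∨ d.2 = i) : c = d := by
  by_contra hne
  have := h.ne c hc d hd hne
  omega

lemma IsMatching.card_endpoints {S : Finset Chord} (h : IsMatching S) :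
    (endpoints S).card = 2 * S.card := by
  rw [endpoints, Finset.card_union_of_disjoint, Finset.card_image_of_injOn,
    Finset.card_image_of_injOn, two_mul]
  · intro c hc d hd hcd
    exact h.eq_of_endpoint hc hd (.inr rfl) (.inr hcd.symm)
  · intro c hc d hd hcd
    exact h.eq_of_endpoint hc hd (.inl rfl) (.inl hcd.symm)
  · rw [Finset.disjoint_left]
    intro i hi hi'
    obtain ⟨c, hc, rfl⟩ := Finset.mem_image.1 hi
    obtain ⟨d, hd, hcd⟩ := Finset.mem_image.1 hi'
    have := h.eq_of_endpoint hc hd (.inl rfl) (.inr hcd)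
    subst this
    exact (h.lt c hc).ne hcd.symm

/-- A diagram of size `n` is a matching whose endpoints are exactly `1, ..., 2n`. -/
lemma isDiagram_iff {n : ℕ} {C : Finset Chord} :
    IsDiagram n C ↔ IsMatching C ∧ endpoints C = Finset.Icc 1 (2 * n) := by
  constructor
  · rintro ⟨h1, h2⟩
    have key : ∀ c ∈ C, ∀ d ∈ C, ∀ i, (c.1 = i ∨ c.2 = i) → (d.1 = i ∨ d.2 = i) → c = d := by
      intro c hc d hd i hci hdi
      have b := h1 c hc
      exact (h2 i (by omega) (by omega)).unique ⟨hc, hci⟩ ⟨hd, hdi⟩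
    refine ⟨⟨fun c hc => (h1 c hc).2.1, fun c hc d hd hcd => ?_⟩, ?_⟩
    · refine ⟨fun h => hcd ?_, fun h => hcd ?_, fun h => hcd ?_, fun h => hcd ?_⟩
      · exact key c hc d hd c.1 (by simp) (by simp [h])
      · exact key c hc d hd c.1 (by simp) (by simp [h])
      · exact key c hc d hd c.2 (by simp) (by simp [h])
      · exact key c hc d hd c.2 (by simp) (by simp [h])
    · ext i
      rw [mem_endpoints, Finset.mem_Icc]
      constructor
      · rintro ⟨c, hc, h⟩
        have := h1 c hc
        omega
      · rintro ⟨h, h'⟩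
        obtain ⟨c, hc, -⟩ := h2 i h h'
        exact ⟨c, hc⟩
  · rintro ⟨hM, hE⟩
    refine ⟨fun c hc => ?_, fun i hi hi' => ?_⟩
    · have h1 := fst_mem_endpoints hc
      have h2 := snd_mem_endpoints hc
      rw [hE, Finset.mem_Icc] at h1 h2
      exact ⟨h1.1, hM.lt c hc, h2.2⟩
    · have : i ∈ endpoints C := by rw [hE, Finset.mem_Icc]; exact ⟨hi, hi'⟩
      obtain ⟨c, hc, h⟩ := mem_endpoints.1 this
      exact ⟨c, ⟨hc, h⟩, fun d hd => hM.eq_of_endpoint hd.1 hc hd.2 h⟩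

lemma IsDiagram.isMatching {n : ℕ} {C : Finset Chord} (h : IsDiagram n C) : IsMatching C :=
  (isDiagram_iff.1 h).1

lemma IsDiagram.card_eq {n : ℕ} {C : Finset Chord} (h : IsDiagram n C) : C.card = n := by
  obtain ⟨h1, h2⟩ := isDiagram_iff.1 h
  have := h1.card_endpoints
  rw [h2, Nat.card_Icc] at this
  omega

lemma mem_connectedDiagrams {n : ℕ} {C : Finset Chord} :
    C ∈ connectedDiagrams n ↔ IsDiagram n C ∧ IsConnected C := by
  classical
  rw [connectedDiagrams, Finset.mem_filter, Finset.mem_powerset, and_iff_right_iff_imp]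
  rintro ⟨h, -⟩ c hc
  have := h.1 c hc
  simp only [Finset.mem_product, Finset.mem_Icc]
  omega

/-- The set of chords obtained from `S` by moving every endpoint `i` to `f i`. -/
def relabel (f : ℕ → ℕ) (S : Finset Chord) : Finset Chord := S.image (Prod.map f f)

section Relabel

variable {f : ℕ → ℕ} (hf : StrictMono f)

lemma mem_relabel {S : Finset Chord} {c : Chord} :
    c ∈ relabel f S ↔ ∃ d ∈ S, Prod.map f f d = c := Finset.mem_image

lemma mem_relabel_of_mem {S : Finset Chord} {c : Chord} (h : c ∈ S) :
    Prod.map f f c ∈ relabel f S := Finset.mem_image_of_mem _ h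

include hf

lemma map_injective : Function.Injective (Prod.map f f) :=
  hf.injective.prodMap hf.injective

lemma map_mem_relabel {S : Finset Chord} {c : Chord} :
    Prod.map f f c ∈ relabel f S ↔ c ∈ S := (map_injective hf).mem_finset_image

lemma rightNbr_map {c d : Chord} : RightNbr (Prod.map f f c) (Prod.map f f d) ↔ RightNbr c d := by
  simp [RightNbr, hf.lt_iff_lt]

lemma crosses_map {c d : Chord} : Crosses (Prod.map f f c) (Prod.map f f d) ↔ Crosses c d := by
  simp [Crosses, rightNbr_map hf]

lemma linked_relabel {S : Finset Chord} {c d : Chord} :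
    Linked (relabel f S) (Prod.map f f c) (Prod.map f f d) ↔ Linked S c d := by
  constructor
  · intro h
    generalize hd : Prod.map f f d = d' at h
    induction h generalizing d with
    | refl => rw [map_injective hf hd]; exact .refl
    | tail _ h ih =>
      obtain ⟨e, he, rfl⟩ := mem_relabel.1 h.1
      subst hd
      exact .tail (ih rfl) ⟨he, (map_mem_relabel hf).1 h.2.1, (crosses_map hf).1 h.2.2⟩
  · intro h
    exact Relation.ReflTransGen.lift (Prod.map f f) (fun a b hab =>
      ⟨mem_relabel_of_mem hab.1, mem_relabel_of_mem hab.2.1, (crosses_map hf).2 hab.2.2⟩) _ _ h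

lemma isConnected_relabel {S : Finset Chord} : IsConnected (relabel f S) ↔ IsConnected S := by
  rw [isConnected_iff, isConnected_iff, relabel, Finset.image_nonempty, ← relabel]
  refine and_congr_right fun _ => ⟨fun h c hc d hd => ?_, fun h c hc d hd => ?_⟩
  · exact (linked_relabel hf).1 (h _ (mem_relabel_of_mem hc) _ (mem_relabel_of_mem hd))
  · obtain ⟨c, hc', rfl⟩ := mem_relabel.1 hc
    obtain ⟨d, hd', rfl⟩ := mem_relabel.1 hd
    exact (linked_relabel hf).2 (h c hc' d hd')

lemma isMatching_relabel {S : Finset Chord} : IsMatching (relabel f S) ↔ IsMatching S := by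
  constructor
  · refine fun h => ⟨fun c hc => ?_, fun c hc d hd hcd => ?_⟩
    · exact hf.lt_iff_lt.1 (h.lt _ (mem_relabel_of_mem hc))
    · have := h.ne _ (mem_relabel_of_mem hc) _ (mem_relabel_of_mem hd)
        fun h => hcd (map_injective hf h)
      simpa [hf.injective.ne_iff, hf.injective.eq_iff] using this
  · refine fun h => ⟨fun c hc => ?_, fun c hc d hd hcd => ?_⟩
    · obtain ⟨c, hc', rfl⟩ := mem_relabel.1 hc
      exact hf (h.lt c hc')
    · obtain ⟨c, hc', rfl⟩ := mem_relabel.1 hc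
      obtain ⟨d, hd', rfl⟩ := mem_relabel.1 hd
      have := h.ne c hc' d hd' fun h => hcd (h ▸ rfl)
      simpa [hf.injective.ne_iff, hf.injective.eq_iff] using this

omit hf in
lemma endpoints_relabel {S : Finset Chord} : endpoints (relabel f S) = (endpoints S).image f := by
  simp only [endpoints, relabel, Finset.image_union, Finset.image_image]
  rfl

lemma relabel_injective : Function.Injective (relabel f) :=
  Finset.image_injective (map_injective hf)

lemma card_relabel {S : Finset Chord} : (relabel f S).card = S.card :=
  Finset.card_image_of_injective _ (map_injective hf)

lemma component_relabel {S : Finset Chord} {r : Chord} :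
    component (relabel f S) (Prod.map f f r) = relabel f (component S r) := by
  refine Finset.ext fun c => ?_
  rw [mem_component, mem_relabel (S := component S r)]
  constructor
  · rintro ⟨hr, hc, h⟩
    obtain ⟨c, hc', rfl⟩ := mem_relabel.1 hc
    exact ⟨c, mem_component.2 ⟨(map_mem_relabel hf).1 hr, hc', (linked_relabel hf).1 h⟩, rfl⟩
  · rintro ⟨c, hc, rfl⟩
    rw [mem_component] at hc
    exact ⟨mem_relabel_of_mem hc.1, mem_relabel_of_mem hc.2.1, (linked_relabel hf).2 hc.2.2⟩

end Relabel

/-! ### The intersection order -/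

lemma root_eq {S : Finset Chord} (h : S.Nonempty) {c : Chord} (hc : c ∈ S)
    (hlt : ∀ d ∈ S, d ≠ c → c.1 < d.1) : root S h = c := by
  by_contra hne
  exact absurd ((S.exists_min_image Prod.fst h).choose_spec.2 c hc)
    (not_le.2 (hlt _ (root_mem S h) hne))

lemma IsMatching.root_lt {S : Finset Chord} (hS : IsMatching S) (h : S.Nonempty) {d : Chord}
    (hd : d ∈ S) (hne : d ≠ root S h) : (root S h).1 < d.1 :=
  lt_of_le_of_ne ((S.exists_min_image Prod.fst h).choose_spec.2 d hd)
    (hS.ne _ (root_mem S h) _ hd hne.symm).1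

lemma root_relabel {f : ℕ → ℕ} (hf : StrictMono f) {S : Finset Chord} (hS : IsMatching S)
    (h : S.Nonempty) (h' : (relabel f S).Nonempty) :
    root (relabel f S) h' = Prod.map f f (root S h) := by
  refine root_eq _ (mem_relabel_of_mem (root_mem S h)) fun d hd hne => ?_
  obtain ⟨d, hd', rfl⟩ := mem_relabel.1 hd
  exact hf (hS.root_lt h hd' fun h => hne (h ▸ rfl))

lemma intersectionOrder_empty : intersectionOrder ∅ = [] := by
  rw [intersectionOrder]; simp

lemma intersectionOrder_relabel {f : ℕ → ℕ} (hf : StrictMono f) {S : Finset Chord}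
    (hS : IsMatching S) :
    intersectionOrder (relabel f S) = (intersectionOrder S).map (Prod.map f f) := by
  induction hn : S.card using Nat.strong_induction_on generalizing S with
  | _ n ih =>
    subst hn
    rcases S.eq_empty_or_nonempty with rfl | h
    · simp [relabel, intersectionOrder_empty]
    · have h' : (relabel f S).Nonempty := h.image _
      rw [intersectionOrder, dif_pos h', intersectionOrder.eq_1 S, dif_pos h, root_relabel hf hS h,
        component_relabel hf]
      have e1 : (relabel f (component S (root S h))).erase (Prod.map f f (root S h)) =
          relabel f ((component S (root S h)).erase (root S h)) :=
        (Finset.image_erase (map_injective hf) _ _).symm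
      have e2 : relabel f S \ relabel f (component S (root S h)) =
          relabel f (S \ component S (root S h)) :=
        (Finset.image_sdiff _ _ (map_injective hf)).symm
      rw [e1, e2, ih _ _ (hS.subset _) rfl, ih _ _ (hS.subset _) rfl, List.map_cons,
        List.map_append]
      · exact Finset.card_lt_card (Finset.sdiff_ssubset (component_subset _ _)
          ⟨_, mem_component_self (root_mem S h)⟩)
      · exact Finset.sdiff_subset
      · exact lt_of_lt_of_le (Finset.card_erase_lt_of_mem (mem_component_self (root_mem S h)))
          (Finset.card_le_card (component_subset _ _))
      · exact (Finset.erase_subset _ _).trans (component_subset _ _)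

lemma mem_intersectionOrder {S : Finset Chord} {c : Chord} : c ∈ intersectionOrder S ↔ c ∈ S := by
  induction hn : S.card using Nat.strong_induction_on generalizing S with
  | _ n ih =>
    subst hn
    rcases S.eq_empty_or_nonempty with rfl | h
    · simp [intersectionOrder_empty]
    · rw [intersectionOrder, dif_pos h, List.mem_cons, List.mem_append, ih _ _ rfl, ih _ _ rfl,
        Finset.mem_erase, Finset.mem_sdiff]
      · have h1 := root_mem S h
        have h2 := mem_component_self h1
        have h3 := @component_subset S (root S h) c
        by_cases hc : c = root S h
        · simp [hc, h1]
        · tauto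
      · exact Finset.card_lt_card (Finset.sdiff_ssubset (component_subset _ _)
          ⟨_, mem_component_self (root_mem S h)⟩)
      · exact lt_of_lt_of_le (Finset.card_erase_lt_of_mem (mem_component_self (root_mem S h)))
          (Finset.card_le_card (component_subset _ _))

lemma nodup_intersectionOrder (S : Finset Chord) : (intersectionOrder S).Nodup := by
  induction hn : S.card using Nat.strong_induction_on generalizing S with
  | _ n ih =>
    subst hn
    rcases S.eq_empty_or_nonempty with rfl | h
    · simp [intersectionOrder_empty]
    · rw [intersectionOrder, dif_pos h, List.nodup_cons, List.nodup_append]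
      refine ⟨?_, ih _ ?_ _ rfl, ih _ ?_ _ rfl, ?_⟩
      · have h2 := mem_component_self (root_mem S h)
        simp [mem_intersectionOrder, h2]
      · exact lt_of_lt_of_le (Finset.card_erase_lt_of_mem (mem_component_self (root_mem S h)))
          (Finset.card_le_card (component_subset _ _))
      · exact Finset.card_lt_card (Finset.sdiff_ssubset (component_subset _ _)
          ⟨_, mem_component_self (root_mem S h)⟩)
      · intro a ha b hb hab
        subst hab
        rw [mem_intersectionOrder] at ha hb
        exact (Finset.mem_sdiff.1 hb).2 (Finset.mem_of_mem_erase ha)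

lemma length_intersectionOrder (S : Finset Chord) : (intersectionOrder S).length = S.card := by
  rw [← List.toFinset_card_of_nodup (nodup_intersectionOrder S)]
  congr 1
  ext c
  rw [List.mem_toFinset, mem_intersectionOrder]

/-- A connected set of chords crossing no other chord of `S` is a component of `S`. -/
lemma component_eq {S T : Finset Chord} (hTS : T ⊆ S) (hT : IsConnected T)
    (hcr : ∀ c ∈ T, ∀ d ∈ S, d ∉ T → ¬ Crosses c d) {r : Chord} (hr : r ∈ T) :
    component S r = T := by
  ext c
  rw [mem_component]
  constructor
  · rintro ⟨-, -, h⟩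
    induction h with
    | refl => exact hr
    | tail _ h ih => exact by_contra fun hn => hcr _ ih _ h.2.1 hn h.2.2
  · exact fun hc => ⟨hTS hr, hTS hc, ((isConnected_iff.1 hT).2 _ hr _ hc).mono hTS⟩

/-- The intersection order of a connected diagram begins with its root. -/
lemma intersectionOrder_of_isConnected {S : Finset Chord} (hS : IsConnected S) (h : S.Nonempty) :
    intersectionOrder S = root S h :: intersectionOrder (S.erase (root S h)) := by
  rw [intersectionOrder, dif_pos h, component_eq subset_rfl hS (fun c _ d hd hn => (hn hd).elim)
    (root_mem S h), Finset.sdiff_self, intersectionOrder_empty, List.append_nil]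

/-- The component of the first chord is listed before everything else. -/
lemma intersectionOrder_eq_append {S T : Finset Chord} (hTS : T ⊆ S) (hT : IsConnected T)
    (hcr : ∀ c ∈ T, ∀ d ∈ S, d ∉ T → ¬ Crosses c d) {r : Chord} (hr : r ∈ T)
    (hlt : ∀ d ∈ S, d ≠ r → r.1 < d.1) :
    intersectionOrder S = intersectionOrder T ++ intersectionOrder (S \ T) := by
  have h : S.Nonempty := ⟨r, hTS hr⟩
  have h' : T.Nonempty := ⟨r, hr⟩
  rw [intersectionOrder_of_isConnected hT h', intersectionOrder, dif_pos h,
    root_eq h (hTS hr) hlt, root_eq h' hr fun d hd => hlt d (hTS hd), component_eq hTS hT hcr hr,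
    List.cons_append]

/-! ### Inserting one connected diagram into another -/

lemma IsDiagram.bounds {n : ℕ} {C : Finset Chord} (h : IsDiagram n C) {c : Chord} (hc : c ∈ C) :
    1 ≤ c.1 ∧ c.1 < c.2 ∧ c.2 ≤ 2 * n := h.1 c hc

lemma IsDiagram.exists_endpoint {n : ℕ} {C : Finset Chord} (h : IsDiagram n C) {i : ℕ}
    (h1 : 1 ≤ i) (h2 : i ≤ 2 * n) : ∃ c ∈ C, c.1 = i ∨ c.2 = i :=
  have ⟨c, hc, _⟩ := h.2 i h1 h2
  ⟨c, hc⟩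

lemma IsDiagram.pos {n : ℕ} {C : Finset Chord} (h : IsDiagram n C) (hc : IsConnected C) :
    1 ≤ n := by
  obtain ⟨c, hc⟩ := (isConnected_iff.1 hc).1
  have := h.bounds hc
  omega

lemma IsDiagram.exists_root {n : ℕ} {C : Finset Chord} (h : IsDiagram n C) (hn : 1 ≤ n) :
    ∃ b, ((1, b) : Chord) ∈ C := by
  obtain ⟨⟨a, b⟩, hc, hi⟩ := h.exists_endpoint le_rfl (by omega : 1 ≤ 2 * n)
  have := h.bounds hc
  have : a = 1 := by simp only at *; omega
  exact ⟨b, this ▸ hc⟩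

/-- A position inside a connected diagram is covered by some chord. -/
lemma exists_cover {n : ℕ} {C : Finset Chord} (h : IsDiagram n C) (hc : IsConnected C) {x : ℕ}
    (h1 : 1 ≤ x) (h2 : x < 2 * n) : ∃ c ∈ C, c.1 ≤ x ∧ x < c.2 := by
  by_contra! hn
  obtain ⟨c, hcC, hc1⟩ := h.exists_endpoint le_rfl (by omega : 1 ≤ 2 * n)
  obtain ⟨d, hdC, hd1⟩ := h.exists_endpoint (by omega : 1 ≤ 2 * n) le_rfl
  -- otherwise everything linked to the chord at `1` ends by `x`, but the chord at `2n` does not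
  have key : ∀ e, Linked C c e → e.2 ≤ x := by
    intro e he
    induction he with
    | refl =>
      have := h.bounds hcC
      exact hn c hcC (by omega)
    | tail _ h' ih =>
      refine hn _ h'.2.1 ?_
      have := h'.2.2
      simp only [Crosses, RightNbr] at this
      omega
  have h3 := key d ((isConnected_iff.1 hc).2 c hcC d hdC)
  have h4 := h.bounds hdC
  omega

/-- A position inside a connected diagram which is not immediately after the source of the root is
covered by a chord different from the root. -/
lemma exists_cover_ne_root {n : ℕ} {C : Finset Chord} (h : IsDiagram n C) (hc : IsConnected C)
    {x : ℕ} (h1 : 2 ≤ x) (h2 : x < 2 * n) : ∃ c ∈ C, 2 ≤ c.1 ∧ c.1 ≤ x ∧ x < c.2 := by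
  by_contra! hn
  obtain ⟨b, hb⟩ := h.exists_root (by omega)
  have hroot : ∀ e ∈ C, e.1 = 1 → e = (1, b) := fun e he h1 =>
    h.isMatching.eq_of_endpoint he hb (.inl h1) (.inl rfl)
  have hxb : x < b := by
    by_contra! hbx
    obtain ⟨c, hcC, hc1, hc2⟩ := exists_cover h hc (by omega : 1 ≤ x) h2
    have := h.bounds hcC
    rcases Nat.lt_or_ge 1 c.1 with h3 | h3
    · have := hn c hcC h3 hc1
      omega
    · rw [hroot c hcC (by omega)] at hc2
      simp only at hc2
      omega
  obtain ⟨c, hcC, hc1⟩ := h.exists_endpoint (by omega : 1 ≤ 2) (by omega : 2 ≤ 2 * n)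
  have hcn : c.1 ≠ 1 := by
    intro h3
    have := hroot c hcC h3
    subst this
    simp only at hc1
    omega
  -- the chords linked to the one at `2` all end by `x`, so none of them is the root or crosses it
  have key : ∀ e, Linked C c e → e.2 ≤ x ∧ 2 ≤ e.1 := by
    intro e he
    induction he with
    | refl =>
      have := h.bounds hcC
      exact ⟨hn c hcC (by omega) (by omega), by omega⟩
    | @tail e f _ h' ih =>
      have h3 := h'.2.2
      simp only [Crosses, RightNbr] at h3
      have h4 := h.bounds h'.2.1
      have h5 : 2 ≤ f.1 := by
        by_contra h6
        have := hroot f h'.2.1 (by omega)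
        subst this
        simp only at h3
        omega
      exact ⟨hn _ h'.2.1 h5 (by omega), h5⟩
  have := key (1, b) ((isConnected_iff.1 hc).2 c hcC _ hb)
  simp at this

/-- How the endpoints of the outer diagram move when a diagram of size `m` is inserted after its
`p`-th endpoint and the source of the inserted root is pulled to the front. -/
def outerMap (p m x : ℕ) : ℕ := if x ≤ p then x + 1 else x + 2 * m

/-- How the endpoints of a diagram move when it is inserted after the `p`-th endpoint of another
diagram and the source of its root is pulled to the front. -/
def innerMap (p x : ℕ) : ℕ := if x ≤ 1 then x else x + p

/-- The root-share product: the diagram `C` is inserted into the diagram `K` after the `p`-th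
endpoint of `K`, except that the source of the root of `C` becomes the very first endpoint. -/
def insertDiagram (K : Finset Chord) (p : ℕ) (C : Finset Chord) : Finset Chord :=
  relabel (outerMap p C.card) K ∪ relabel (innerMap p) C

lemma outerMap_strictMono {p m : ℕ} (hm : 1 ≤ m) : StrictMono (outerMap p m) := by
  intro x y h
  simp only [outerMap]
  split_ifs <;> omega

lemma innerMap_strictMono {p : ℕ} : StrictMono (innerMap p) := by
  intro x y h
  simp only [innerMap]
  split_ifs <;> omega

/-- `K` and `C` are connected diagrams of sizes `k` and `m`, and `p` is a position inside `K`. -/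
structure IsInsertion (k m : ℕ) (K : Finset Chord) (p : ℕ) (C : Finset Chord) : Prop where
  outer : IsDiagram k K
  outer_conn : IsConnected K
  inner : IsDiagram m C
  inner_conn : IsConnected C
  one_le : 1 ≤ p
  lt : p < 2 * k

namespace IsInsertion

variable {k m p : ℕ} {K C : Finset Chord} (h : IsInsertion k m K p C)
include h

lemma inner_pos : 1 ≤ m := h.inner.pos h.inner_conn

lemma outer_pos : 1 ≤ k := h.outer.pos h.outer_conn

lemma eq_union : insertDiagram K p C = relabel (outerMap p m) K ∪ relabel (innerMap p) C := by
  rw [insertDiagram, h.inner.card_eq]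

lemma strictMono : StrictMono (outerMap p m) := outerMap_strictMono h.inner_pos

lemma mem_iff {e : Chord} : e ∈ insertDiagram K p C ↔
    (∃ c ∈ K, e = Prod.map (outerMap p m) (outerMap p m) c) ∨
      ∃ d ∈ C, e = Prod.map (innerMap p) (innerMap p) d := by
  rw [h.eq_union, Finset.mem_union, mem_relabel, mem_relabel]
  simp only [eq_comm]

lemma outer_mem {c : Chord} (hc : c ∈ K) :
    Prod.map (outerMap p m) (outerMap p m) c ∈ insertDiagram K p C :=
  h.mem_iff.2 (.inl ⟨c, hc, rfl⟩)

lemma inner_mem {d : Chord} (hd : d ∈ C) :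
    Prod.map (innerMap p) (innerMap p) d ∈ insertDiagram K p C :=
  h.mem_iff.2 (.inr ⟨d, hd, rfl⟩)

lemma forall_mem {P : Chord → Prop} : (∀ e ∈ insertDiagram K p C, P e) ↔
    (∀ c ∈ K, P (Prod.map (outerMap p m) (outerMap p m) c)) ∧
      ∀ d ∈ C, P (Prod.map (innerMap p) (innerMap p) d) := by
  refine ⟨fun H => ⟨fun c hc => H _ (h.outer_mem hc), fun d hd => H _ (h.inner_mem hd)⟩, ?_⟩
  rintro ⟨H1, H2⟩ e he
  rcases h.mem_iff.1 he with ⟨c, hc, rfl⟩ | ⟨d, hd, rfl⟩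
  exacts [H1 c hc, H2 d hd]

/-- The endpoints of the outer and inner diagram remain distinct. -/
lemma outer_ne_inner {x y : ℕ} (hx : 1 ≤ x) (hy : 1 ≤ y) (hy' : y ≤ 2 * m) :
    outerMap p m x ≠ innerMap p y := by
  have := h.one_le
  simp only [outerMap, innerMap]
  split_ifs <;> omega

lemma outer_chord_ne_inner {c d : Chord} (hc : c ∈ K) (hd : d ∈ C) :
    Prod.map (outerMap p m) (outerMap p m) c ≠ Prod.map (innerMap p) (innerMap p) d := by
  intro H
  have h1 := h.outer.bounds hc
  have h2 := h.inner.bounds hd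
  exact h.outer_ne_inner (x := c.1) (y := d.1) (by omega) (by omega) (by omega)
    (congrArg Prod.fst H)

lemma disjoint : Disjoint (relabel (outerMap p m) K) (relabel (innerMap p) C) := by
  rw [Finset.disjoint_left]
  intro e he he'
  obtain ⟨c, hc, rfl⟩ := mem_relabel.1 he
  obtain ⟨d, hd, H⟩ := mem_relabel.1 he'
  exact h.outer_chord_ne_inner hc hd H.symm

/-- Only the root of `C` crosses chords of `K`. -/
lemma not_crosses {c d : Chord} (hc : c ∈ K) (hd : d ∈ C) (hd1 : d.1 ≠ 1) :
    ¬ Crosses (Prod.map (outerMap p m) (outerMap p m) c)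
      (Prod.map (innerMap p) (innerMap p) d) := by
  have h1 := h.outer.bounds hc
  have h2 := h.inner.bounds hd
  have h3 := h.one_le
  simp only [Crosses, RightNbr, Prod.map_fst, Prod.map_snd, outerMap, innerMap]
  split_ifs <;> omega

/-- The root of `C` crosses exactly the chords of `K` that cover the position `p`. -/
lemma rightNbr_root_outer {b : ℕ} {c : Chord} (hb : (1, b) ∈ C) (hc : c ∈ K) :
    RightNbr (Prod.map (innerMap p) (innerMap p) (1, b))
      (Prod.map (outerMap p m) (outerMap p m) c) ↔ c.1 ≤ p ∧ p < c.2 := by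
  have h1 := h.outer.bounds hc
  have h2 := h.inner.bounds hb
  have h3 := h.one_le
  simp only [RightNbr, Prod.map_fst, Prod.map_snd, outerMap, innerMap] at *
  split_ifs <;> omega

lemma isMatching : IsMatching (insertDiagram K p C) := by
  have hK := (isMatching_relabel h.strictMono).2 h.outer.isMatching
  have hC := (isMatching_relabel (innerMap_strictMono (p := p))).2 h.inner.isMatching
  have hne : ∀ c ∈ K, ∀ d ∈ C, ∀ x y, (x = c.1 ∨ x = c.2) → (y = d.1 ∨ y = d.2) →
      outerMap p m x ≠ innerMap p y := by
    intro c hc d hd x y hx hy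
    have h1 := h.outer.bounds hc
    have h2 := h.inner.bounds hd
    exact h.outer_ne_inner (by omega) (by omega) (by omega)
  rw [h.eq_union]
  refine ⟨fun c hc => ?_, fun c hc d hd hcd => ?_⟩
  · rcases Finset.mem_union.1 hc with hc | hc
    exacts [hK.lt c hc, hC.lt c hc]
  · rcases Finset.mem_union.1 hc with hc' | hc' <;> rcases Finset.mem_union.1 hd with hd' | hd'
    · exact hK.ne c hc' d hd' hcd
    · obtain ⟨c, hc'', rfl⟩ := mem_relabel.1 hc'
      obtain ⟨d, hd'', rfl⟩ := mem_relabel.1 hd'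
      have := hne c hc'' d hd''
      exact ⟨this _ _ (.inl rfl) (.inl rfl), this _ _ (.inl rfl) (.inr rfl),
        this _ _ (.inr rfl) (.inl rfl), this _ _ (.inr rfl) (.inr rfl)⟩
    · obtain ⟨c, hc'', rfl⟩ := mem_relabel.1 hc'
      obtain ⟨d, hd'', rfl⟩ := mem_relabel.1 hd'
      have := hne d hd'' c hc''
      exact ⟨(this _ _ (.inl rfl) (.inl rfl)).symm, (this _ _ (.inr rfl) (.inl rfl)).symm,
        (this _ _ (.inl rfl) (.inr rfl)).symm, (this _ _ (.inr rfl) (.inr rfl)).symm⟩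
    · exact hC.ne c hc' d hd' hcd

lemma isDiagram : IsDiagram (k + m) (insertDiagram K p C) := by
  refine isDiagram_iff.2 ⟨h.isMatching, ?_⟩
  have hu : endpoints (insertDiagram K p C) =
      (endpoints K).image (outerMap p m) ∪ (endpoints C).image (innerMap p) := by
    rw [← endpoints_relabel, ← endpoints_relabel, h.eq_union]
    simp only [endpoints, Finset.image_union]
    ext; simp only [Finset.mem_union]; tauto
  rw [hu, (isDiagram_iff.1 h.outer).2, (isDiagram_iff.1 h.inner).2]
  have h1 := h.one_le
  have h2 := h.lt
  have h3 := h.inner_pos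
  ext i
  simp only [Finset.mem_union, Finset.mem_image, Finset.mem_Icc]
  constructor
  · rintro (⟨x, hx, rfl⟩ | ⟨x, hx, rfl⟩)
    · simp only [outerMap]; split_ifs <;> omega
    · simp only [innerMap]; split_ifs <;> omega
  · intro hi
    by_cases hi1 : i = 1
    · exact .inr ⟨1, by omega, by simp [innerMap, hi1]⟩
    by_cases hi2 : i ≤ p + 1
    · exact .inl ⟨i - 1, by omega, by simp only [outerMap]; split_ifs <;> omega⟩
    by_cases hi3 : i ≤ p + 2 * m
    · exact .inr ⟨i - p, by omega, by simp only [innerMap]; split_ifs <;> omega⟩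
    · exact .inl ⟨i - 2 * m, by omega, by simp only [outerMap]; split_ifs <;> omega⟩

lemma isConnected : IsConnected (insertDiagram K p C) := by
  obtain ⟨b, hb⟩ := h.inner.exists_root h.inner_pos
  obtain ⟨c₀, hc₀, hc₁⟩ := exists_cover h.outer h.outer_conn h.one_le h.lt
  set r := Prod.map (innerMap p) (innerMap p) (1, b)
  have hr : r ∈ insertDiagram K p C := h.inner_mem hb
  have key : ∀ e ∈ insertDiagram K p C, Linked (insertDiagram K p C) r e := by
    rw [h.forall_mem]
    constructor
    · intro c hc
      have h1 : Linked (insertDiagram K p C) r (Prod.map (outerMap p m) (outerMap p m) c₀) :=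
        .single ⟨hr, h.outer_mem hc₀, .inl ((h.rightNbr_root_outer hb hc₀).2 hc₁)⟩
      refine h1.trans (((linked_relabel h.strictMono).2
        ((isConnected_iff.1 h.outer_conn).2 _ hc₀ _ hc)).mono ?_)
      rw [h.eq_union]
      exact Finset.subset_union_left
    · intro d hd
      refine ((linked_relabel innerMap_strictMono).2
        ((isConnected_iff.1 h.inner_conn).2 _ hb _ hd)).mono ?_
      rw [h.eq_union]
      exact Finset.subset_union_right
  exact isConnected_iff.2 ⟨⟨r, hr⟩, fun c hc d hd => (key c hc).symm.trans (key d hd)⟩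

lemma root_lt {b : ℕ} (hb : (1, b) ∈ C) : ∀ e ∈ insertDiagram K p C,
    e ≠ Prod.map (innerMap p) (innerMap p) (1, b) → 1 < e.1 := by
  intro e he hne
  have h1 := h.isDiagram.bounds he
  by_contra h2
  refine hne (h.isMatching.eq_of_endpoint he (h.inner_mem hb) (i := 1) (.inl (by omega)) (.inl ?_))
  simp [innerMap]

lemma erase_root {b : ℕ} (hb : (1, b) ∈ C) :
    (insertDiagram K p C).erase (Prod.map (innerMap p) (innerMap p) (1, b)) =
      relabel (outerMap p m) K ∪ relabel (innerMap p) (C.erase (1, b)) := by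
  have e1 : relabel (innerMap p) (C.erase (1, b)) = _ :=
    Finset.image_erase (map_injective innerMap_strictMono) _ _
  rw [e1, h.eq_union, Finset.erase_union_distrib, Finset.erase_eq_of_notMem (s := relabel _ K)]
  · rfl
  · exact fun H => Finset.disjoint_left.1 h.disjoint H (mem_relabel_of_mem hb)

/-- After the new root, the intersection order of `insertDiagram K p C` lists the chords of `K` and
then those of `C`. -/
lemma intersectionOrder_eq {b : ℕ} (hb : (1, b) ∈ C) :
    intersectionOrder (insertDiagram K p C) =
      Prod.map (innerMap p) (innerMap p) (1, b) ::
        ((intersectionOrder K).map (Prod.map (outerMap p m) (outerMap p m)) ++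
          (intersectionOrder (C.erase (1, b))).map (Prod.map (innerMap p) (innerMap p))) := by
  have hne : (insertDiagram K p C).Nonempty := ⟨_, h.inner_mem hb⟩
  have hroot : root _ hne = Prod.map (innerMap p) (innerMap p) (1, b) := by
    refine root_eq hne (h.inner_mem hb) fun e he hne => ?_
    have := h.root_lt hb e he hne
    simpa [innerMap] using this
  rw [intersectionOrder_of_isConnected h.isConnected hne, hroot, h.erase_root hb]
  obtain ⟨a, ha⟩ := h.outer.exists_root h.outer_pos
  congr 1
  have hdisj : Disjoint (relabel (outerMap p m) K) (relabel (innerMap p) (C.erase (1, b))) :=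
    h.disjoint.mono_right (Finset.image_subset_image (Finset.erase_subset _ _))
  rw [intersectionOrder_eq_append (T := relabel (outerMap p m) K)
    (r := Prod.map (outerMap p m) (outerMap p m) (1, a)) Finset.subset_union_left
    ((isConnected_relabel h.strictMono).2 h.outer_conn), Finset.union_sdiff_cancel_left hdisj,
    intersectionOrder_relabel h.strictMono h.outer.isMatching,
    intersectionOrder_relabel innerMap_strictMono (h.inner.isMatching.subset
      (Finset.erase_subset _ _))]
  · intro c hc d hd hdn
    obtain ⟨c, hc', rfl⟩ := mem_relabel.1 hc
    obtain ⟨d, hd', rfl⟩ := mem_relabel.1 ((Finset.mem_union.1 hd).resolve_left hdn)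
    refine h.not_crosses hc' (Finset.mem_of_mem_erase hd') fun hd1 => ?_
    exact (Finset.mem_erase.1 hd').1 (h.inner.isMatching.eq_of_endpoint
      (Finset.mem_of_mem_erase hd') hb (.inl hd1) (.inl rfl))
  · exact mem_relabel_of_mem ha
  · intro e he hne
    have he' : e ∈ insertDiagram K p C := by
      rw [← h.erase_root hb] at he
      exact Finset.mem_of_mem_erase he
    have h1 := h.isDiagram.bounds he'
    have h2 := h.isMatching.ne _ (h.outer_mem ha) _ he' hne.symm
    have h3 : 1 < e.1 := by
      refine h.root_lt hb e he' ?_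
      rw [← h.erase_root hb] at he
      exact (Finset.mem_erase.1 he).1
    have h4 := h.one_le
    simp only [outerMap, Prod.map_fst] at h2 ⊢
    split_ifs at h2 ⊢
    omega

end IsInsertion

/-! ### The root-share decomposition -/

lemma isConnected_component {S : Finset Chord} {r : Chord} (hr : r ∈ S) :
    IsConnected (component S r) := by
  have key : ∀ d, Linked S r d → Linked (component S r) r d := by
    intro d hd
    induction hd with
    | refl => exact .refl
    | tail h1 h2 ih =>
      exact .tail ih ⟨mem_component.2 ⟨hr, h2.1, h1⟩, mem_component.2 ⟨hr, h2.2.1, .tail h1 h2⟩,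
        h2.2.2⟩
  exact isConnected_iff.2 ⟨⟨r, mem_component_self hr⟩, fun c hc d hd =>
    (key c (mem_component.1 hc).2.2).symm.trans (key d (mem_component.1 hd).2.2)⟩

lemma not_crosses_component {S : Finset Chord} {r c d : Chord} (hc : c ∈ component S r)
    (hd : d ∈ S) (hd' : d ∉ component S r) : ¬ Crosses c d := by
  intro h
  rw [mem_component] at hc
  exact hd' (mem_component.2 ⟨hc.1, hd, .tail hc.2.2 ⟨hc.2.1, hd, h⟩⟩)

lemma exists_relabel_eq {f : ℕ → ℕ} {T : Finset Chord} (h : ∀ i ∈ endpoints T, ∃ j, f j = i) :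
    ∃ K, relabel f K = T := by
  choose! g hg using h
  refine ⟨relabel g T, ?_⟩
  rw [relabel, relabel, Finset.image_image]
  conv_rhs => rw [← Finset.image_id (s := T)]
  refine Finset.image_congr fun c hc => ?_
  exact Prod.ext (hg _ (fst_mem_endpoints hc)) (hg _ (snd_mem_endpoints hc))

namespace IsInsertion

variable {k m p : ℕ} {K C : Finset Chord} (h : IsInsertion k m K p C)
include h

/-- The outer diagram is a component once the root is removed. -/
lemma component_erase_root {b : ℕ} (hb : (1, b) ∈ C) {e : Chord}
    (he : e ∈ relabel (outerMap p m) K) :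
    component ((insertDiagram K p C).erase (Prod.map (innerMap p) (innerMap p) (1, b))) e =
      relabel (outerMap p m) K := by
  rw [h.erase_root hb]
  refine component_eq Finset.subset_union_left ((isConnected_relabel h.strictMono).2 h.outer_conn)
    ?_ he
  intro c hc d hd hdn
  obtain ⟨c, hc', rfl⟩ := mem_relabel.1 hc
  obtain ⟨d, hd', rfl⟩ := mem_relabel.1 ((Finset.mem_union.1 hd).resolve_left hdn)
  refine h.not_crosses hc' (Finset.mem_of_mem_erase hd') fun hd1 => ?_
  exact (Finset.mem_erase.1 hd').1 (h.inner.isMatching.eq_of_endpoint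
    (Finset.mem_of_mem_erase hd') hb (.inl hd1) (.inl rfl))

/-- An insertion determines its two parts: the new root is the chord at `1`, and `K` is the component
of the chord at `2` after its removal. -/
lemma injective {k' m' p' : ℕ} {K' C' : Finset Chord} (h' : IsInsertion k' m' K' p' C')
    (he : insertDiagram K p C = insertDiagram K' p' C') :
    k = k' ∧ m = m' ∧ K = K' ∧ p = p' ∧ C = C' := by
  obtain ⟨b, hb⟩ := h.inner.exists_root h.inner_pos
  obtain ⟨b', hb'⟩ := h'.inner.exists_root h'.inner_pos
  obtain ⟨a, ha⟩ := h.outer.exists_root h.outer_pos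
  obtain ⟨a', ha'⟩ := h'.outer.exists_root h'.outer_pos
  have o1 := h.one_le
  have o2 := h'.one_le
  have hr : Prod.map (innerMap p) (innerMap p) (1, b) =
      Prod.map (innerMap p') (innerMap p') (1, b') :=
    h.isMatching.eq_of_endpoint (h.inner_mem hb) (he ▸ h'.inner_mem hb') (i := 1)
      (.inl (by simp [innerMap])) (.inl (by simp [innerMap]))
  have hs : Prod.map (outerMap p m) (outerMap p m) (1, a) =
      Prod.map (outerMap p' m') (outerMap p' m') (1, a') :=
    h.isMatching.eq_of_endpoint (h.outer_mem ha) (he ▸ h'.outer_mem ha') (i := 2)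
      (.inl (by simp [outerMap, o1])) (.inl (by simp [outerMap, o2]))
  have hK : relabel (outerMap p m) K = relabel (outerMap p' m') K' := by
    rw [← h.component_erase_root hb (mem_relabel_of_mem ha),
      ← h'.component_erase_root hb' (mem_relabel_of_mem ha'), he, hr, hs]
  have hk : k = k' := by
    have := congrArg Finset.card hK
    rwa [card_relabel h.strictMono, card_relabel h'.strictMono, h.outer.card_eq,
      h'.outer.card_eq] at this
  have hn := h.isDiagram.card_eq
  rw [he, h'.isDiagram.card_eq] at hn
  have hm : m = m' := by omega
  subst hk hm
  have hE := congrArg endpoints hK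
  rw [endpoints_relabel, endpoints_relabel, (isDiagram_iff.1 h.outer).2,
    (isDiagram_iff.1 h'.outer).2] at hE
  have l1 := h.lt
  have l2 := h'.lt
  have hm1 := h.inner_pos
  -- `p + 2` is the first endpoint after `1` that does not belong to the outer diagram
  have hp : p = p' := by
    have e1 := Finset.ext_iff.1 hE (p + 2)
    have e2 := Finset.ext_iff.1 hE (p' + 2)
    simp only [Finset.mem_image, Finset.mem_Icc] at e1 e2
    rcases lt_trichotomy p p' with hlt | heq | hlt
    · obtain ⟨x, hx, hx'⟩ := e1.2 ⟨p + 1, by omega, by simp [outerMap]; omega⟩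
      simp only [outerMap] at hx'
      split_ifs at hx' <;> omega
    · exact heq
    · obtain ⟨x, hx, hx'⟩ := e2.1 ⟨p' + 1, by omega, by simp [outerMap]; omega⟩
      simp only [outerMap] at hx'
      split_ifs at hx' <;> omega
  subst hp
  refine ⟨rfl, rfl, relabel_injective h.strictMono hK, rfl,
    relabel_injective (innerMap_strictMono (p := p)) ?_⟩
  rw [← Finset.union_sdiff_cancel_left h.disjoint, ← Finset.union_sdiff_cancel_left h'.disjoint,
    ← h.eq_union, ← h'.eq_union, he, hK]

end IsInsertion

/-- If the endpoints of a component `T` of `D` without its root do not lie under any other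
remaining chord, then these other chords all lie on the same side of each endpoint of `T` as the
sink of the root. -/
lemma side_of_root_sink {D T : Finset Chord} {b : ℕ}
    (hD : ∀ d ∈ D, Linked D (1, b) d) (hlt : ∀ d ∈ D, 1 ≤ d.1 ∧ d.1 < d.2)
    (hcr : ∀ c ∈ T, ∀ d ∈ D, d ∉ T → d ≠ (1, b) → ¬ Crosses c d)
    (hspan : ∀ d ∈ D, d ∉ T → d ≠ (1, b) → ∀ c ∈ T, (c.1 < d.1 ∨ d.2 < c.1) ∧
      (c.2 < d.1 ∨ d.2 < c.2)) {d : Chord} (hd : d ∈ D) (hdT : d ∉ T) (hdr : d ≠ (1, b)) {x : ℕ}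
    (hx : x ∈ endpoints T) : (x < d.1 ↔ x < b) ∧ (x < d.2 ↔ x < b) := by
  have hspan' : ∀ d ∈ D, d ∉ T → d ≠ (1, b) → x < d.1 ∨ d.2 < x := by
    intro d hd hdT hdr
    obtain ⟨c, hc, rfl | rfl⟩ := mem_endpoints.1 hx
    exacts [(hspan d hd hdT hdr c hc).1, (hspan d hd hdT hdr c hc).2]
  -- the property propagates along crossings, starting from the root
  have key : ∀ e, Linked D (1, b) e →
      e ∈ T ∨ e = (1, b) ∨ ((x < e.1 ↔ x < b) ∧ (x < e.2 ↔ x < b)) := by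
    intro e he
    induction he with
    | refl => exact .inr (.inl rfl)
    | @tail e f _ h ih =>
      by_cases hfT : f ∈ T
      · exact .inl hfT
      by_cases hfr : f = (1, b)
      · exact .inr (.inl hfr)
      refine .inr (.inr ?_)
      have h1 := hspan' f h.2.1 hfT hfr
      have h2 := hlt f h.2.1
      have h3 := h.2.2
      rcases ih with he | rfl | he
      · exact (hcr e he f h.2.1 hfT hfr h3).elim
      · simp only [Crosses, RightNbr] at h3
        omega
      · have h4 := hlt e h.1
        simp only [Crosses, RightNbr] at h3
        omega
  rcases key d (hD d hd) with h | h | h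
  exacts [(hdT h).elim, (hdr h).elim, h]

/-- Every connected diagram with at least two chords arises by insertion: `K` is the component of
the second chord once the root is removed, and `C` consists of the other chords. -/
lemma exists_eq_insertDiagram {n : ℕ} (hn : 2 ≤ n) {D : Finset Chord} (hD : IsDiagram n D)
    (hDc : IsConnected D) :
    ∃ k m K p C, k + m = n ∧ IsInsertion k m K p C ∧ insertDiagram K p C = D := by
  obtain ⟨b, hb⟩ := hD.exists_root (by omega)
  obtain ⟨c₀, hc₀, hc₁, hc₂, hc₃⟩ := exists_cover_ne_root hD hDc le_rfl (by omega)
  have hM := hD.isMatching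
  have hbb := hD.bounds hb
  have hc₀r : c₀ ≠ (1, b) := by rintro rfl; simp at hc₁
  have hc₀S : c₀ ∈ D.erase (1, b) := Finset.mem_erase.2 ⟨hc₀r, hc₀⟩
  set T := component (D.erase (1, b)) c₀ with hT
  have hc₀T : c₀ ∈ T := mem_component_self hc₀S
  have hTc : IsConnected T := isConnected_component hc₀S
  have hTS : T ⊆ D.erase (1, b) := component_subset _ _
  have hTD : T ⊆ D := hTS.trans (Finset.erase_subset _ _)
  have hrT : (1, b) ∉ T := fun h => (Finset.mem_erase.1 (hTS h)).1 rfl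
  have hcr : ∀ c ∈ T, ∀ d ∈ D, d ∉ T → d ≠ (1, b) → ¬ Crosses c d := fun c hc d hd hdT hdr =>
    not_crosses_component hc (Finset.mem_erase.2 ⟨hdr, hd⟩) hdT
  have hone : ∀ d ∈ D, d ≠ (1, b) → 2 ≤ d.1 := by
    intro d hd hdr
    have h1 := (hM.ne d hd _ hb hdr).1
    have h2 := (hD.bounds hd).1
    simp only at h1
    omega
  -- no endpoint of `T` lies under another remaining chord: this holds for the chord at `2`, and it
  -- propagates along the crossings in `T`
  have hspan : ∀ d ∈ D, d ∉ T → d ≠ (1, b) → ∀ c ∈ T, (c.1 < d.1 ∨ d.2 < c.1) ∧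
      (c.2 < d.1 ∨ d.2 < c.2) := by
    intro d hd hdT hdr c hc
    have hd1 := hone d hd hdr
    have hl := (isConnected_iff.1 hTc).2 _ hc₀T _ hc
    induction hl with
    | refl =>
      have h1 := hM.ne c₀ hc₀ d hd (fun h => hdT (h ▸ hc₀T))
      have h2 := hcr _ hc₀T d hd hdT hdr
      simp only [Crosses, RightNbr] at h2
      omega
    | @tail e f _ h ih =>
      have h0 := ih h.1
      have h1 := hM.ne f (hTD h.2.1) d hd (fun H => hdT (H ▸ h.2.1))
      have h2 := hcr _ h.2.1 d hd hdT hdr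
      have h3 := h.2.2
      simp only [Crosses, RightNbr] at h2 h3
      have h4 := (hD.bounds hd).2.1
      omega
  have hlink : ∀ d ∈ D, Linked D (1, b) d := (isConnected_iff.1 hDc).2 _ hb
  have hside : ∀ d ∈ D, d ∉ T → d ≠ (1, b) → ∀ x ∈ endpoints T,
      (x < d.1 ↔ x < b) ∧ (x < d.2 ↔ x < b) := fun d hd hdT hdr x hx =>
    side_of_root_sink hlink (fun d hd => ⟨(hD.bounds hd).1, (hD.bounds hd).2.1⟩) hcr
      hspan hd hdT hdr hx
  -- the inner diagram is connected, because only the root crosses chords of `T`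
  have hrC : (1, b) ∈ D \ T := Finset.mem_sdiff.2 ⟨hb, hrT⟩
  have hCc : IsConnected (D \ T) := by
    have key : ∀ d, Linked D (1, b) d → d ∈ T ∨ Linked (D \ T) (1, b) d ∧ d ∈ D \ T := by
      intro d hd
      induction hd with
      | refl => exact .inr ⟨.refl, hrC⟩
      | @tail e f _ h ih =>
        by_cases hfT : f ∈ T
        · exact .inl hfT
        refine .inr ?_
        have hf : f ∈ D \ T := Finset.mem_sdiff.2 ⟨h.2.1, hfT⟩
        rcases ih with he | he
        · have : f = (1, b) := by
            by_contra hfr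
            exact hcr e he f h.2.1 hfT hfr h.2.2
          rw [this]
          exact ⟨.refl, hrC⟩
        · exact ⟨.tail he.1 ⟨he.2, hf, h.2.2⟩, hf⟩
    have key' : ∀ d ∈ D \ T, Linked (D \ T) (1, b) d := fun d hd =>
      ((key d (hlink d (Finset.mem_sdiff.1 hd).1)).resolve_left (Finset.mem_sdiff.1 hd).2).1
    exact isConnected_iff.2 ⟨⟨_, hrC⟩, fun c hc d hd => (key' c hc).symm.trans (key' d hd)⟩
  -- the root crosses the outer diagram, so `T` has endpoints on both sides of its sink `b`
  obtain ⟨c₁, hc₁T, hc₁r⟩ : ∃ c ∈ T, Crosses c (1, b) := by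
    have key : ∀ e, Linked D c₀ e → e ∈ T ∨ ∃ c ∈ T, Crosses c (1, b) := by
      intro e he
      induction he with
      | refl => exact .inl hc₀T
      | @tail e f _ h ih =>
        rcases ih with he | he
        · by_cases hfr : f = (1, b)
          · exact .inr ⟨e, he, hfr ▸ h.2.2⟩
          · exact .inl (by_contra fun hfT => hcr e he f h.2.1 hfT hfr h.2.2)
        · exact .inr he
    exact (key (1, b) (hlink c₀ hc₀).symm).resolve_left hrT
  have hdisjE : ∀ x ∈ endpoints T, x ∉ endpoints (D \ T) := by
    intro x hx hx'
    obtain ⟨c, hc, hcx⟩ := mem_endpoints.1 hx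
    obtain ⟨d, hd, hdx⟩ := mem_endpoints.1 hx'
    have := hM.eq_of_endpoint (hTD hc) (Finset.mem_sdiff.1 hd).1 hcx hdx
    exact (Finset.mem_sdiff.1 hd).2 (this ▸ hc)
  have hbE : b ∉ endpoints T := fun h => hdisjE b h (snd_mem_endpoints hrC)
  have h1E : 1 ∉ endpoints T := fun h => hdisjE 1 h (fst_mem_endpoints hrC)
  have h2E : 2 ∈ endpoints T := by
    have : c₀.1 = 2 := by omega
    exact this ▸ fst_mem_endpoints hc₀T
  have hcov : ∀ x, 1 ≤ x → x ≤ 2 * n → x ∈ endpoints T ∨ x ∈ endpoints (D \ T) := by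
    intro x h1 h2
    obtain ⟨c, hc, hcx⟩ := hD.exists_endpoint h1 h2
    by_cases hcT : c ∈ T
    · exact .inl (mem_endpoints.2 ⟨c, hcT, hcx⟩)
    · exact .inr (mem_endpoints.2 ⟨c, Finset.mem_sdiff.2 ⟨hc, hcT⟩, hcx⟩)
  have hrange : ∀ x ∈ endpoints T, 2 ≤ x ∧ x ≤ 2 * n := by
    intro x hx
    obtain ⟨c, hc, hcx⟩ := mem_endpoints.1 hx
    have h1 := hD.bounds (hTD hc)
    have h2 := hone c (hTD hc) fun h => hrT (h ▸ hc)
    omega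
  -- `q` and `s` are the endpoints of `T` next to `b`; between them lie all endpoints of the other
  -- chords except the source of the root
  obtain ⟨q, hq, hqmax⟩ := ((endpoints T).filter (· < b)).exists_max_image id
    ⟨2, Finset.mem_filter.2 ⟨h2E, by
      rcases eq_or_ne b 2 with h | h
      · exact (hbE (h ▸ h2E)).elim
      · simp only at hbb; omega⟩⟩
  obtain ⟨s, hs, hsmin⟩ := ((endpoints T).filter (b < ·)).exists_min_image id
    ⟨c₁.2, Finset.mem_filter.2 ⟨snd_mem_endpoints hc₁T, by
      have := hD.bounds (hTD hc₁T)
      simp only [Crosses, RightNbr] at hc₁r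
      omega⟩⟩
  simp only [Finset.mem_filter, id_eq, and_imp] at hq hqmax hs hsmin
  have hq2 := hrange q hq.1
  have hs2 := hrange s hs.1
  have hET : endpoints T = Finset.Icc 2 q ∪ Finset.Icc s (2 * n) := by
    ext x
    rw [Finset.mem_union, Finset.mem_Icc, Finset.mem_Icc]
    constructor
    · intro hx
      have h1 := hrange x hx
      rcases lt_trichotomy x b with h | h | h
      · exact .inl ⟨h1.1, hqmax x hx h⟩
      · exact (hbE (h ▸ hx)).elim
      · exact .inr ⟨hsmin x hx h, h1.2⟩
    · intro hx
      refine (hcov x (by omega) (by omega)).resolve_right fun hx' => ?_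
      obtain ⟨d, hd, hdx⟩ := mem_endpoints.1 hx'
      rw [Finset.mem_sdiff] at hd
      by_cases hdr : d = (1, b)
      · subst hdr
        simp only at hdx
        omega
      · have h1 := hside d hd.1 hd.2 hdr q hq.1
        have h2 := hside d hd.1 hd.2 hdr s hs.1
        have h3 : x ≠ s := by rintro rfl; exact hdisjE x hs.1 hx'
        omega
  -- counting endpoints gives the length of the gap between `q` and `s`
  have hcardT := (hM.subset hTD).card_endpoints
  have hcardE : (endpoints T).card = (q + 1 - 2) + (2 * n + 1 - s) := by
    rw [hET, Finset.card_union_of_disjoint, Nat.card_Icc, Nat.card_Icc]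
    rw [Finset.disjoint_left]
    intro x h1 h2
    rw [Finset.mem_Icc] at h1 h2
    omega
  have hcard : T.card + (D \ T).card = n := by
    rw [add_comm, Finset.card_sdiff_add_card_eq_card hTD, hD.card_eq]
  have hm1 : 1 ≤ (D \ T).card := Finset.card_pos.2 ⟨_, hrC⟩
  set k := T.card
  set m := (D \ T).card
  have hs' : s = q + 2 * m := by omega
  have hup : (Finset.Icc 1 (2 * k)).image (outerMap (q - 1) m) = endpoints T := by
    ext x
    rw [hET, Finset.mem_image, Finset.mem_union, Finset.mem_Icc, Finset.mem_Icc]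
    constructor
    · rintro ⟨y, hy, rfl⟩
      rw [Finset.mem_Icc] at hy
      simp only [outerMap]
      split_ifs <;> omega
    · rintro (hx | hx)
      · exact ⟨x - 1, Finset.mem_Icc.2 (by omega), by simp only [outerMap]; split_ifs <;> omega⟩
      · exact ⟨x - 2 * m, Finset.mem_Icc.2 (by omega), by
          simp only [outerMap]; split_ifs <;> omega⟩
  have hEC : endpoints (D \ T) = Finset.Icc 1 (2 * n) \ endpoints T := by
    ext x
    rw [Finset.mem_sdiff, Finset.mem_Icc]
    constructor
    · intro hx
      refine ⟨?_, fun h => hdisjE x h hx⟩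
      obtain ⟨d, hd, hdx⟩ := mem_endpoints.1 hx
      have := hD.bounds (Finset.mem_sdiff.1 hd).1
      omega
    · exact fun hx => (hcov x hx.1.1 hx.1.2).resolve_left hx.2
  have hlo : (Finset.Icc 1 (2 * m)).image (innerMap (q - 1)) = endpoints (D \ T) := by
    ext x
    rw [hEC, hET, Finset.mem_image, Finset.mem_sdiff, Finset.mem_union, Finset.mem_Icc,
      Finset.mem_Icc, Finset.mem_Icc]
    constructor
    · rintro ⟨y, hy, rfl⟩
      rw [Finset.mem_Icc] at hy
      simp only [innerMap]
      split_ifs <;> omega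
    · intro hx
      by_cases h1 : x = 1
      · exact ⟨1, Finset.mem_Icc.2 (by omega), by simp [innerMap, h1]⟩
      · exact ⟨x - (q - 1), Finset.mem_Icc.2 (by omega), by
          simp only [innerMap]; split_ifs <;> omega⟩
  have hupm : StrictMono (outerMap (q - 1) m) := outerMap_strictMono hm1
  have hlom : StrictMono (innerMap (q - 1)) := innerMap_strictMono
  obtain ⟨K, hK⟩ := exists_relabel_eq (f := outerMap (q - 1) m) (T := T) (fun i hi => by
    rw [← hup, Finset.mem_image] at hi
    exact ⟨hi.choose, hi.choose_spec.2⟩)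
  obtain ⟨C, hC⟩ := exists_relabel_eq (f := innerMap (q - 1)) (T := D \ T) (fun i hi => by
    rw [← hlo, Finset.mem_image] at hi
    exact ⟨hi.choose, hi.choose_spec.2⟩)
  have hins : IsInsertion k m K (q - 1) C := by
    refine ⟨isDiagram_iff.2 ⟨(isMatching_relabel hupm).1 (hK ▸ hM.subset hTD), ?_⟩,
      (isConnected_relabel hupm).1 (hK ▸ hTc),
      isDiagram_iff.2 ⟨(isMatching_relabel hlom).1 (hC ▸ hM.subset Finset.sdiff_subset), ?_⟩,
      (isConnected_relabel hlom).1 (hC ▸ hCc), by omega, by omega⟩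
    · refine Finset.image_injective hupm.injective ?_
      rw [hup, ← endpoints_relabel, hK]
    · refine Finset.image_injective hlom.injective ?_
      rw [hlo, ← endpoints_relabel, hC]
  refine ⟨k, m, K, q - 1, C, hcard, hins, ?_⟩
  rw [hins.eq_union, hK, hC, Finset.union_sdiff_of_subset hTD]

/-- Summation over connected diagrams along the root-share decomposition. -/
lemma sum_connectedDiagrams {M : Type*} [AddCommMonoid M] {n : ℕ} (hn : 2 ≤ n)
    (g : Finset Chord → M) :
    ∑ D ∈ connectedDiagrams n, g D = ∑ km ∈ Finset.HasAntidiagonal.antidiagonal n,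
      ∑ K ∈ connectedDiagrams km.1, ∑ C ∈ connectedDiagrams km.2,
        ∑ p ∈ Finset.Ico 1 (2 * km.1), g (insertDiagram K p C) := by
  have e1 : ∀ km : ℕ × ℕ, ∑ K ∈ connectedDiagrams km.1, ∑ C ∈ connectedDiagrams km.2,
      ∑ p ∈ Finset.Ico 1 (2 * km.1), g (insertDiagram K p C) =
      ∑ x ∈ connectedDiagrams km.1 ×ˢ connectedDiagrams km.2 ×ˢ Finset.Ico 1 (2 * km.1),
        g (insertDiagram x.1 x.2.2 x.2.1) := by
    intro km
    rw [Finset.sum_product]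
    refine Finset.sum_congr rfl fun K _ => ?_
    rw [Finset.sum_product]
  simp_rw [e1]
  rw [Finset.sum_sigma']
  have hmem : ∀ x ∈ (Finset.HasAntidiagonal.antidiagonal n).sigma (fun km : ℕ × ℕ =>
      connectedDiagrams km.1 ×ˢ connectedDiagrams km.2 ×ˢ Finset.Ico 1 (2 * km.1)),
      x.1.1 + x.1.2 = n ∧ IsInsertion x.1.1 x.1.2 x.2.1 x.2.2.2 x.2.2.1 := by
    rintro ⟨⟨k, m⟩, K, C, p⟩ hx
    simp only [Finset.mem_sigma, Finset.HasAntidiagonal.mem_antidiagonal, Finset.mem_product,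
      Finset.mem_Ico, mem_connectedDiagrams] at hx
    exact ⟨hx.1, hx.2.1.1, hx.2.1.2, hx.2.2.1.1, hx.2.2.1.2, hx.2.2.2.1, hx.2.2.2.2⟩
  symm
  refine Finset.sum_nbij (fun x => insertDiagram x.2.1 x.2.2.2 x.2.2.1) ?_ ?_ ?_ fun _ _ => rfl
  · intro x hx
    obtain ⟨h1, h2⟩ := hmem x hx
    exact mem_connectedDiagrams.2 ⟨h1 ▸ h2.isDiagram, h2.isConnected⟩
  · intro x hx y hy hxy
    obtain ⟨-, h2⟩ := hmem x hx
    obtain ⟨-, h3⟩ := hmem y hy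
    obtain ⟨⟨k, m⟩, K, C, p⟩ := x
    obtain ⟨⟨k', m'⟩, K', C', p'⟩ := y
    obtain ⟨rfl, rfl, rfl, rfl, rfl⟩ := h2.injective h3 hxy
    rfl
  · intro D hD
    obtain ⟨hD, hDc⟩ := mem_connectedDiagrams.1 hD
    obtain ⟨k, m, K, p, C, rfl, h, rfl⟩ := exists_eq_insertDiagram hn hD hDc
    refine ⟨⟨(k, m), K, C, p⟩, ?_, rfl⟩
    simp only [Finset.coe_sigma, Set.mem_sigma_iff, Finset.mem_coe,
      Finset.HasAntidiagonal.mem_antidiagonal, Finset.mem_product, Finset.mem_Ico, mem_connectedDiagrams]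
    exact ⟨trivial, ⟨h.outer, h.outer_conn⟩, ⟨h.inner, h.inner_conn⟩, h.one_le, h.lt⟩

/-! ### Terminal chords and the weight `f_C` -/

lemma idxOf_map_of_injective {f : Chord → Chord} (hf : Function.Injective f) (l : List Chord)
    (c : Chord) : (l.map f).idxOf (f c) = l.idxOf c := by
  induction l with
  | nil => rfl
  | cons a l ih =>
    by_cases h : a = c
    · subst h; simp
    · rw [List.map_cons, List.idxOf_cons_ne _ h, List.idxOf_cons_ne _ (fun H => h (hf H)), ih]

/-- The set of positions of the terminal chords of `C` in the intersection order. -/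
noncomputable def terminalPositions (C : Finset Chord) : Finset ℕ := (terminalChords C).image (index C)

lemma mem_terminalChords {C : Finset Chord} {c : Chord} :
    c ∈ terminalChords C ↔ c ∈ C ∧ IsTerminal C c := by
  classical
  exact Finset.mem_filter

lemma index_injOn (C : Finset Chord) : Set.InjOn (index C) C := by
  intro c hc d hd h
  exact (List.idxOf_inj (mem_intersectionOrder.2 hc)).1 (Nat.succ_injective h)

lemma card_terminalPositions (C : Finset Chord) :
    (terminalPositions C).card = (terminalChords C).card :=
  Finset.card_image_of_injOn ((index_injOn C).mono fun _ hc => (mem_terminalChords.1 hc).1)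

lemma index_le_card {C : Finset Chord} {c : Chord} (hc : c ∈ C) : index C c ≤ C.card := by
  have := List.idxOf_lt_length_of_mem (mem_intersectionOrder.2 hc)
  rw [length_intersectionOrder] at this
  exact this

lemma terminalPositions_bounds {C : Finset Chord} {i : ℕ} (hi : i ∈ terminalPositions C) :
    1 ≤ i ∧ i ≤ C.card := by
  obtain ⟨c, hc, rfl⟩ := Finset.mem_image.1 hi
  exact ⟨Nat.le_add_left _ _, index_le_card (mem_terminalChords.1 hc).1⟩

lemma isDiagram_one_iff {C : Finset Chord} : IsDiagram 1 C ↔ C = {(1, 2)} := by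
  constructor
  · intro h
    obtain ⟨c, hc⟩ := Finset.card_eq_one.1 h.card_eq
    obtain ⟨b, hb⟩ := h.exists_root le_rfl
    have := h.bounds hb
    have hb2 : b = 2 := by simp only at this; omega
    rw [hc, Finset.mem_singleton] at hb
    rw [hc, ← hb, hb2]
  · rintro rfl
    refine isDiagram_iff.2 ⟨⟨by simp, by simp⟩, by decide⟩

lemma isConnected_single : IsConnected {((1, 2) : Chord)} := by
  refine isConnected_iff.2 ⟨by simp, fun c hc d hd => ?_⟩
  rw [Finset.mem_singleton] at hc hd
  rw [hc, hd]
  exact .refl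

lemma connectedDiagrams_one : connectedDiagrams 1 = {{(1, 2)}} := by
  ext C
  rw [mem_connectedDiagrams, isDiagram_one_iff, Finset.mem_singleton, and_iff_left_iff_imp]
  rintro rfl
  exact isConnected_single

lemma connectedDiagrams_zero : connectedDiagrams 0 = ∅ := by
  refine Finset.eq_empty_of_forall_notMem fun C hC => ?_
  obtain ⟨h1, h2⟩ := mem_connectedDiagrams.1 hC
  exact absurd (h1.pos h2) (by omega)

lemma terminalChords_single : terminalChords {((1, 2) : Chord)} = {(1, 2)} := by
  ext c
  rw [mem_terminalChords, Finset.mem_singleton, and_iff_left_iff_imp]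
  rintro rfl d hd
  rw [Finset.mem_singleton] at hd
  subst hd
  simp [RightNbr]

lemma terminalPositions_single : terminalPositions {((1, 2) : Chord)} = {1} := by
  have h : intersectionOrder {((1, 2) : Chord)} = [(1, 2)] := by
    rw [intersectionOrder_of_isConnected isConnected_single (by simp),
      root_eq (by simp) (c := (1, 2)) (by simp) (by simp)]
    simp [intersectionOrder_empty]
  rw [terminalPositions, terminalChords_single, Finset.image_singleton, index, h,
    List.idxOf_cons_self]

namespace IsInsertion

variable {k m p : ℕ} {K C : Finset Chord} (h : IsInsertion k m K p C)
include h

lemma isTerminal_outer {c : Chord} (hc : c ∈ K) :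
    IsTerminal (insertDiagram K p C) (Prod.map (outerMap p m) (outerMap p m) c) ↔
      IsTerminal K c := by
  rw [IsTerminal, h.forall_mem]
  simp only [rightNbr_map h.strictMono]
  refine and_iff_left_of_imp fun _ d hd => ?_
  by_cases hd1 : d.1 = 1
  · have h1 := h.outer.bounds hc
    simp only [RightNbr, Prod.map_fst, hd1, outerMap, innerMap]
    split_ifs <;> omega
  · exact fun H => h.not_crosses hc hd hd1 (.inl H)

lemma isTerminal_inner {d : Chord} (hd : d ∈ C) (hd1 : d.1 ≠ 1) :
    IsTerminal (insertDiagram K p C) (Prod.map (innerMap p) (innerMap p) d) ↔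
      IsTerminal C d := by
  rw [IsTerminal, h.forall_mem]
  simp only [rightNbr_map innerMap_strictMono]
  exact and_iff_right_of_imp fun _ c hc H => h.not_crosses hc hd hd1 (.inr H)

lemma not_isTerminal_root {b : ℕ} (hb : (1, b) ∈ C) :
    ¬ IsTerminal (insertDiagram K p C) (Prod.map (innerMap p) (innerMap p) (1, b)) := by
  obtain ⟨c, hc, hc'⟩ := exists_cover h.outer h.outer_conn h.one_le h.lt
  exact fun H => H _ (h.outer_mem hc) ((h.rightNbr_root_outer hb hc).2 hc')

lemma index_outer {c : Chord} (hc : c ∈ K) :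
    index (insertDiagram K p C) (Prod.map (outerMap p m) (outerMap p m) c) = index K c + 1 := by
  obtain ⟨b, hb⟩ := h.inner.exists_root h.inner_pos
  rw [index, index, h.intersectionOrder_eq hb, List.idxOf_cons_ne _
    (h.outer_chord_ne_inner hc hb).symm, List.idxOf_append_of_mem
    (List.mem_map_of_mem (mem_intersectionOrder.2 hc)),
    idxOf_map_of_injective (map_injective h.strictMono)]

lemma index_inner {d : Chord} (hd : d ∈ C) (hd1 : d.1 ≠ 1) :
    index (insertDiagram K p C) (Prod.map (innerMap p) (innerMap p) d) = k + index C d := by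
  obtain ⟨b, hb⟩ := h.inner.exists_root h.inner_pos
  have hne : (1, b) ≠ d := by rintro rfl; exact hd1 rfl
  have hC := intersectionOrder_of_isConnected h.inner_conn ⟨_, hb⟩
  rw [root_eq ⟨_, hb⟩ hb fun e he hne => ?_] at hC
  · rw [index, index, h.intersectionOrder_eq hb, hC, List.idxOf_cons_ne _ hne, List.idxOf_cons_ne _
      (fun H => hne (map_injective innerMap_strictMono H)), List.idxOf_append_of_notMem,
      List.length_map, length_intersectionOrder,
      idxOf_map_of_injective (map_injective innerMap_strictMono), h.outer.card_eq]
    · omega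
    · intro H
      obtain ⟨c, hc, hc'⟩ := List.mem_map.1 H
      exact h.outer_chord_ne_inner (mem_intersectionOrder.1 hc) hd hc'
  · have h1 := h.inner.bounds he
    have h2 := (h.inner.isMatching.ne e he _ hb hne).1
    simp only at h2 ⊢
    omega

lemma index_root {b : ℕ} (hb : (1, b) ∈ C) : index C (1, b) = 1 := by
  have hC := intersectionOrder_of_isConnected h.inner_conn ⟨_, hb⟩
  rw [root_eq ⟨_, hb⟩ hb fun e he hne => ?_] at hC
  · rw [index, hC, List.idxOf_cons_self]
  · have h1 := h.inner.bounds he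
    have h2 := (h.inner.isMatching.ne e he _ hb hne).1
    simp only at h2 ⊢
    omega

/-- The terminal chords of an insertion are those of its two parts except the new root, which crosses
the outer diagram. -/
lemma terminalPositions_eq : terminalPositions (insertDiagram K p C) =
    (terminalPositions K).image (· + 1) ∪ ((terminalPositions C).erase 1).image (k + ·) := by
  obtain ⟨b, hb⟩ := h.inner.exists_root h.inner_pos
  have hroot : ∀ d ∈ C, d.1 = 1 → d = (1, b) := fun d hd hd1 =>
    h.inner.isMatching.eq_of_endpoint hd hb (.inl hd1) (.inl rfl)
  ext i
  simp only [terminalPositions, Finset.mem_union, Finset.mem_image, Finset.mem_erase,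
    mem_terminalChords]
  constructor
  · rintro ⟨e, ⟨he, het⟩, rfl⟩
    rcases h.mem_iff.1 he with ⟨c, hc, rfl⟩ | ⟨d, hd, rfl⟩
    · exact .inl ⟨_, ⟨c, ⟨hc, (h.isTerminal_outer hc).1 het⟩, rfl⟩, (h.index_outer hc).symm⟩
    · by_cases hd1 : d.1 = 1
      · rw [hroot d hd hd1] at het
        exact (h.not_isTerminal_root hb het).elim
      · refine .inr ⟨_, ⟨fun H => hd1 ?_, d, ⟨hd, (h.isTerminal_inner hd hd1).1 het⟩, rfl⟩,
          (h.index_inner hd hd1).symm⟩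
        rw [index_injOn C hd hb (H.trans (h.index_root hb).symm)]
  · rintro (⟨_, ⟨c, ⟨hc, hct⟩, rfl⟩, rfl⟩ | ⟨_, ⟨hi, d, ⟨hd, hdt⟩, rfl⟩, rfl⟩)
    · exact ⟨_, ⟨h.outer_mem hc, (h.isTerminal_outer hc).2 hct⟩, h.index_outer hc⟩
    · have hd1 : d.1 ≠ 1 := fun hd1 => hi (by rw [hroot d hd hd1, h.index_root hb])
      exact ⟨_, ⟨h.inner_mem hd, (h.isTerminal_inner hd hd1).2 hdt⟩, h.index_inner hd hd1⟩

end IsInsertion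

/-- Case distinction for connected diagrams: a single chord, or an insertion. -/
lemma IsDiagram.eq_single_or {n : ℕ} {C : Finset Chord} (h : IsDiagram n C) (hc : IsConnected C) :
    (n = 1 ∧ C = {(1, 2)}) ∨
      ∃ k m K p D, k + m = n ∧ IsInsertion k m K p D ∧ insertDiagram K p D = C := by
  have hn := h.pos hc
  rcases hn.eq_or_lt with rfl | hn
  · exact .inl ⟨rfl, isDiagram_one_iff.1 h⟩
  · exact .inr (exists_eq_insertDiagram hn h hc)

/-- The last chord in the intersection order is terminal. -/
lemma size_mem_terminalPositions {n : ℕ} {C : Finset Chord} (h : IsDiagram n C)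
    (hc : IsConnected C) : n ∈ terminalPositions C := by
  induction n using Nat.strong_induction_on generalizing C with
  | _ n ih =>
    rcases h.eq_single_or hc with ⟨rfl, rfl⟩ | ⟨k, m, K, p, D, rfl, hI, rfl⟩
    · simp [terminalPositions_single]
    · have h1 := hI.inner_pos
      have h2 := hI.outer_pos
      rw [hI.terminalPositions_eq, Finset.mem_union, Finset.mem_image, Finset.mem_image]
      rcases eq_or_ne m 1 with rfl | hm
      · exact .inl ⟨k, ih k (by omega) hI.outer hI.outer_conn, rfl⟩
      · exact .inr ⟨m, Finset.mem_erase.2 ⟨hm, ih m (by omega) hI.inner hI.inner_conn⟩, rfl⟩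

/-- The root of a connected diagram is terminal only for the single chord. -/
lemma one_notMem_terminalPositions {n : ℕ} (hn : n ≠ 1) {C : Finset Chord} (h : IsDiagram n C)
    (hc : IsConnected C) : 1 ∉ terminalPositions C := by
  rcases h.eq_single_or hc with ⟨rfl, rfl⟩ | ⟨k, m, K, p, D, rfl, hI, rfl⟩
  · exact (hn rfl).elim
  · rw [hI.terminalPositions_eq, Finset.mem_union, Finset.mem_image, Finset.mem_image]
    rintro (⟨i, hi, hi'⟩ | ⟨i, hi, hi'⟩)
    · have := terminalPositions_bounds hi
      omega
    · have := hI.outer_pos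
      have := terminalPositions_bounds (Finset.mem_of_mem_erase hi)
      have := (Finset.mem_erase.1 hi).1
      omega

/-- The product of `F` over the gaps between consecutive entries of a list. -/
def gapProd {M : Type*} [CommMonoid M] (F : ℕ → M) : List ℕ → M
  | a :: b :: l => F (b - a) * gapProd F (b :: l)
  | _ => 1

section GapProd

variable {M : Type*} [CommMonoid M] (F : ℕ → M)

lemma prod_getD_eq_gapProd (l : List ℕ) :
    ∏ j ∈ Finset.Ico 1 l.length, F (l.getD j 0 - l.getD (j - 1) 0) = gapProd F l := by
  rw [Finset.prod_Ico_eq_prod_range]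
  induction l with
  | nil => simp [gapProd]
  | cons a l ih =>
    cases l with
    | nil => simp [gapProd]
    | cons b l =>
      simp only [List.length_cons, Nat.add_sub_cancel] at ih ⊢
      rw [Finset.prod_range_succ', gapProd, ← ih, mul_comm]
      congr 1
      refine Finset.prod_congr rfl fun j _ => ?_
      have e1 : 1 + (j + 1) = (1 + j) + 1 := by omega
      have e2 : 1 + (j + 1) - 1 = (1 + j - 1) + 1 := by omega
      rw [e1, List.getD_cons_succ, ← e1, e2, List.getD_cons_succ]

lemma gapProd_map_add (c : ℕ) (l : List ℕ) : gapProd F (l.map (· + c)) = gapProd F l := by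
  induction l with
  | nil => rfl
  | cons a l ih =>
    cases l with
    | nil => rfl
    | cons b l =>
      rw [List.map_cons] at ih
      rw [List.map_cons, List.map_cons, gapProd, ih, gapProd, Nat.add_sub_add_right]

lemma gapProd_append (l : List ℕ) (x y : ℕ) (l' : List ℕ) :
    gapProd F ((l ++ [x]) ++ (y :: l')) =
      gapProd F (l ++ [x]) * F (y - x) * gapProd F (y :: l') := by
  induction l with
  | nil => simp [gapProd]
  | cons a l ih =>
    cases l with
    | nil =>
      simp only [List.nil_append, List.cons_append, gapProd, mul_one] at ih ⊢
      rw [mul_assoc]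
    | cons b l =>
      simp only [List.cons_append, gapProd, mul_assoc] at ih ⊢
      rw [ih]

end GapProd

/-- The increasing list `t₁(C) < t₂(C) < ...`. -/
noncomputable def terminalList (C : Finset Chord) : List ℕ := (terminalPositions C).sort (· ≤ ·)

lemma length_terminalList (C : Finset Chord) :
    (terminalList C).length = (terminalChords C).card := by
  rw [terminalList, Finset.length_sort, card_terminalPositions]

lemma t_eq (C : Finset Chord) (j : ℕ) : t C j = (terminalList C).getD (j - 1) 0 := rfl

lemma fWeight_eq {K : Type*} [Field K] (F : K⟦X⟧) (C : Finset Chord) :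
    fWeight F C = PowerSeries.coeff 0 F ^ (C.card - (terminalList C).length) *
      gapProd (fun i => PowerSeries.coeff i F) (terminalList C) := by
  rw [fWeight, ← prod_getD_eq_gapProd, length_terminalList]
  rfl

lemma mem_terminalList {C : Finset Chord} {i : ℕ} :
    i ∈ terminalList C ↔ i ∈ terminalPositions C := Finset.mem_sort _

lemma sortedLT_terminalList (C : Finset Chord) : (terminalList C).Pairwise (· < ·) :=
  List.sortedLT_iff_pairwise.1 (Finset.sortedLT_sort _)

lemma terminalList_eq_of {C : Finset Chord} {l : List ℕ} (hl : l.Pairwise (· < ·))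
    (h : ∀ i, i ∈ l ↔ i ∈ terminalPositions C) : terminalList C = l := by
  refine List.Perm.eq_of_pairwise' (r := (· < ·)) (sortedLT_terminalList C) hl ?_
  refine (List.perm_ext_iff_of_nodup (Finset.sort_nodup _ _) (hl.imp fun h => h.ne)).2 fun i => ?_
  rw [h]
  exact mem_terminalList

/-- The last entry of `terminalList C` is the size of `C`. -/
lemma exists_terminalList_eq_append {n : ℕ} {C : Finset Chord} (h : IsDiagram n C)
    (hc : IsConnected C) : ∃ l, terminalList C = l ++ [n] := by
  have hn := mem_terminalList.2 (size_mem_terminalPositions h hc)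
  obtain ⟨l, l', hl⟩ := List.append_of_mem hn
  refine ⟨l, ?_⟩
  cases l' with
  | nil => exact hl
  | cons a l' =>
    have h1 : a ∈ terminalList C := by rw [hl]; simp
    have h2 := terminalPositions_bounds (mem_terminalList.1 h1)
    have h3 := sortedLT_terminalList C
    rw [hl, List.pairwise_append] at h3
    have h4 := (List.pairwise_cons.1 h3.2.1).1 a (by simp)
    rw [h.card_eq] at h2
    omega

lemma exists_terminalList_eq_cons {n : ℕ} {C : Finset Chord} (h : IsDiagram n C)
    (hc : IsConnected C) : ∃ l, terminalList C = t C 1 :: l := by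
  obtain ⟨l, hl⟩ := exists_terminalList_eq_append h hc
  rw [t_eq, hl]
  cases l with
  | nil => exact ⟨[], rfl⟩
  | cons a l => exact ⟨l ++ [n], rfl⟩

lemma one_le_t {n : ℕ} {C : Finset Chord} (h : IsDiagram n C) (hc : IsConnected C) :
    1 ≤ t C 1 := by
  obtain ⟨l, hl⟩ := exists_terminalList_eq_cons h hc
  have : t C 1 ∈ terminalList C := by
    rw [hl]
    exact List.mem_cons_self
  exact (terminalPositions_bounds (mem_terminalList.1 this)).1

lemma length_terminalList_le (C : Finset Chord) : (terminalList C).length ≤ C.card := by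
  rw [length_terminalList]
  exact Finset.card_le_card fun c hc => (mem_terminalChords.1 hc).1

lemma terminalList_single : terminalList {((1, 2) : Chord)} = [1] := by
  rw [terminalList, terminalPositions_single, Finset.sort_singleton]

lemma t_single : t {((1, 2) : Chord)} 1 = 1 := by
  rw [t_eq, terminalList_single]
  rfl

lemma fWeight_single {K : Type*} [Field K] (F : K⟦X⟧) : fWeight F {((1, 2) : Chord)} = 1 := by
  rw [fWeight_eq, terminalList_single]
  simp [gapProd]

namespace IsInsertion

variable {k m p : ℕ} {K C : Finset Chord} (h : IsInsertion k m K p C)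
include h

lemma terminalList_of_one (hm : m = 1) :
    terminalList (insertDiagram K p C) = (terminalList K).map (· + 1) := by
  subst hm
  refine terminalList_eq_of ?_ fun i => ?_
  · rw [List.pairwise_map]
    exact (sortedLT_terminalList K).imp fun h => by omega
  · rw [h.terminalPositions_eq, isDiagram_one_iff.1 h.inner, terminalPositions_single]
    simp [mem_terminalList]

lemma terminalList_of_ne_one (hm : m ≠ 1) : terminalList (insertDiagram K p C) =
    (terminalList K).map (· + 1) ++ (terminalList C).map (· + k) := by
  have h1 := one_notMem_terminalPositions hm h.inner h.inner_conn
  refine terminalList_eq_of ?_ fun i => ?_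
  · rw [List.pairwise_append, List.pairwise_map, List.pairwise_map]
    refine ⟨(sortedLT_terminalList K).imp fun h => by omega,
      (sortedLT_terminalList C).imp fun h => by omega, fun a ha b hb => ?_⟩
    obtain ⟨a, ha', rfl⟩ := List.mem_map.1 ha
    obtain ⟨b, hb', rfl⟩ := List.mem_map.1 hb
    rw [mem_terminalList] at ha' hb'
    have h2 := terminalPositions_bounds ha'
    have h3 := terminalPositions_bounds hb'
    have h4 : b ≠ 1 := fun h => h1 (h ▸ hb')
    rw [h.outer.card_eq] at h2
    omega
  · rw [h.terminalPositions_eq, Finset.erase_eq_of_notMem h1]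
    simp [mem_terminalList, add_comm k]

lemma t_one : t (insertDiagram K p C) 1 = t K 1 + 1 := by
  obtain ⟨l, hl⟩ := exists_terminalList_eq_cons h.outer h.outer_conn
  rw [t_eq]
  rcases eq_or_ne m 1 with hm | hm
  · rw [h.terminalList_of_one hm, hl]; rfl
  · rw [h.terminalList_of_ne_one hm, hl]; rfl

/-- The weight `f` of an insertion: the only new gap between terminal chords is the one from the
last chord of `K` to the first terminal chord of `C`. -/
lemma fWeight_insert {R : Type*} [Field R] (F : R⟦X⟧) : fWeight F (insertDiagram K p C) =
    fWeight F K * (fWeight F C * PowerSeries.coeff (t C 1 - 1) F) := by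
  have hK := length_terminalList_le K
  have hC := length_terminalList_le C
  rw [h.outer.card_eq] at hK
  rw [h.inner.card_eq] at hC
  rw [fWeight_eq, fWeight_eq, h.isDiagram.card_eq, h.outer.card_eq]
  rcases eq_or_ne m 1 with hm | hm
  -- an inserted single chord is not terminal any more, which accounts for a factor `f₀`
  · rw [h.terminalList_of_one hm, gapProd_map_add, List.length_map]
    subst hm
    rw [isDiagram_one_iff.1 h.inner, fWeight_single, t_single, Nat.sub_add_comm hK, pow_succ]
    ring
  · rw [h.terminalList_of_ne_one hm, fWeight_eq, h.inner.card_eq]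
    obtain ⟨l, hl⟩ := exists_terminalList_eq_append h.outer h.outer_conn
    obtain ⟨l', hl'⟩ := exists_terminalList_eq_cons h.inner h.inner_conn
    have e1 : (terminalList K).map (· + 1) ++ (terminalList C).map (· + k) =
        (l.map (· + 1) ++ [k + 1]) ++ ((t C 1 + k) :: l'.map (· + k)) := by
      rw [hl, hl']; simp
    have e2 : l.map (· + 1) ++ [k + 1] = (terminalList K).map (· + 1) := by rw [hl]; simp
    have e3 : (t C 1 + k) :: l'.map (· + k) = (terminalList C).map (· + k) := by
      rw [hl', List.map_cons]
    have e4 : t C 1 + k - (k + 1) = t C 1 - 1 := by omega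
    have e5 : k + m - ((terminalList K).map (· + 1) ++ (terminalList C).map (· + k)).length =
        (k - (terminalList K).length) + (m - (terminalList C).length) := by
      rw [List.length_append, List.length_map, List.length_map]
      omega
    rw [e5, e1, gapProd_append, e2, e3, gapProd_map_add, gapProd_map_add, e4, pow_add]
    ring

end IsInsertion

/-! ### Valency as a count of positions -/

/-- Among the chords of `C` covering the position between the endpoints `x` and `x + 1`, the chord
`c` is the one with the last source. -/
def IsTop (C : Finset Chord) (x : ℕ) (c : Chord) : Prop :=
  c.1 ≤ x ∧ x < c.2 ∧ ∀ e ∈ C, c.1 < e.1 → e.1 ≤ x → e.2 ≤ x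

lemma IsTop.eq {C : Finset Chord} (hC : IsMatching C) {x : ℕ} {c d : Chord} (hc : c ∈ C)
    (hd : d ∈ C) (h : IsTop C x c) (h' : IsTop C x d) : c = d := by
  by_contra hne
  have h1 := (hC.ne c hc d hd hne).1
  have h2 := h.2.2 d hd
  have h3 := h'.2.2 c hc
  have h4 := h.1
  have h5 := h.2.1
  have h6 := h'.1
  have h7 := h'.2.1
  omega

lemma exists_isTop {n : ℕ} {C : Finset Chord} (h : IsDiagram n C) (hc : IsConnected C) {x : ℕ}
    (h1 : 1 ≤ x) (h2 : x < 2 * n) : ∃ c ∈ C, IsTop C x c := by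
  classical
  obtain ⟨c, hc, hcx⟩ := exists_cover h hc h1 h2
  obtain ⟨d, hd, hmax⟩ := (C.filter fun c => c.1 ≤ x ∧ x < c.2).exists_max_image Prod.fst
    ⟨c, Finset.mem_filter.2 ⟨hc, hcx⟩⟩
  rw [Finset.mem_filter] at hd
  refine ⟨d, hd.1, hd.2.1, hd.2.2, fun e he h3 h4 => ?_⟩
  by_contra h5
  have := hmax e (Finset.mem_filter.2 ⟨he, h4, by omega⟩)
  omega

open Classical in
/-- The valency of `c` is one less than the number of positions at which `c` is the top chord.
These positions are the one right after the source of `c`, those right after the sinks of the left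
neighbors counted by the valency, and the ends of the components following the source. -/
lemma card_isTop {n : ℕ} {C : Finset Chord} (h : IsDiagram n C) {c : Chord} (hc : c ∈ C) :
    ((Finset.Ico 1 (2 * n)).filter fun x => IsTop C x c).card = valency C c + 1 := by
  have hM := h.isMatching
  have hcb := h.bounds hc
  have hsrc : ∀ d ∈ C, ∀ e ∈ C, d.1 ≠ e.2 := by
    intro d hd e he H
    have := hM.eq_of_endpoint hd he (.inl H) (.inr rfl)
    subst this
    have := h.bounds hd
    omega
  have hset : (Finset.Ico 1 (2 * n)).filter (fun x => IsTop C x c) = insert c.1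
      (((leftNbrs C c).filter (fun b => ∀ d ∈ C, c.1 < d.1 → ¬ Crosses b d)).image Prod.snd ∪
        followingComponentEnds (C \ leftNbrs C c) c.1) := by
    ext x
    simp only [Finset.mem_filter, Finset.mem_Ico, Finset.mem_insert, Finset.mem_union,
      Finset.mem_image, followingComponentEnds, leftNbrs, Finset.mem_sdiff]
    simp only [RightNbr, Crosses]
    constructor
    · rintro ⟨hx, h1, h2, h3⟩
      rcases h1.eq_or_lt with h1 | h1
      · exact .inl h1.symm
      obtain ⟨d, hd, hdx⟩ := h.exists_endpoint hx.1 hx.2.le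
      have hdb := h.bounds hd
      have hdx2 : d.2 = x := by
        rcases hdx with hdx | hdx
        · have := h3 d hd (by omega) hdx.le
          omega
        · exact hdx
      refine .inr ?_
      have hdc : d ≠ c := by rintro rfl; omega
      have hne := hM.ne d hd c hc hdc
      -- the position `x` follows the sink of `d`: if the source of `d` comes before that of `c`, then
      -- `d` is a counted left neighbor, otherwise `x` is the end of a component
      rcases lt_or_gt_of_ne hne.1 with h4 | h4
      · refine .inl ⟨d, ⟨⟨hd, by omega⟩, fun e he h5 => ?_⟩, hdx2⟩
        have := h3 e he h5
        omega
      · refine .inr ⟨⟨d, ⟨hd, by omega⟩, hdx2⟩, h1, fun e he => ?_⟩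
        have h5 := h3 e he.1
        have h6 := h.bounds he.1
        have h7 : e.1 = c.1 → e = c := fun H => hM.eq_of_endpoint he.1 hc (.inl H) (.inl rfl)
        constructor
        · intro h8
          have := h5 h8.1 h8.2
          omega
        · intro h8
          refine ⟨?_, by omega⟩
          by_contra h9
          rcases eq_or_ne e.1 c.1 with h10 | h10
          · rw [h7 h10] at h8
            omega
          · exact he.2 ⟨he.1, by omega⟩
    · rintro (rfl | ⟨d, ⟨⟨hd, h1⟩, h2⟩, rfl⟩ | ⟨⟨d, ⟨hd, h1⟩, rfl⟩, h2, h3⟩)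
      · exact ⟨by omega, le_rfl, hcb.2.1, fun e he h4 h5 => by omega⟩
      · have hdb := h.bounds hd
        refine ⟨by omega, by omega, by omega, fun e he h4 h5 => ?_⟩
        have := h2 e he h4
        have := hsrc e he d hd
        omega
      · have h4 := h3 c ⟨hc, by omega⟩
        have h5 := h3 d ⟨hd, h1⟩
        have hdb := h.bounds hd
        refine ⟨by omega, by omega, by omega, fun e he h6 h7 => ?_⟩
        have := h3 e ⟨he, by omega⟩
        omega
  rw [hset, Finset.card_insert_of_notMem, Finset.card_union_of_disjoint,
    Finset.card_image_of_injOn]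
  · rfl
  · intro d hd e he hde
    simp only [Finset.coe_filter, Set.mem_ofPred_eq, leftNbrs, Finset.mem_filter] at hd he
    exact hM.eq_of_endpoint hd.1.1 he.1.1 (.inr rfl) (.inr hde.symm)
  · rw [Finset.disjoint_left]
    intro x hx hx'
    obtain ⟨d, hd, rfl⟩ := Finset.mem_image.1 hx
    obtain ⟨e, he, hde⟩ := Finset.mem_image.1 (Finset.mem_filter.1 hx').1
    have hd' := (Finset.mem_filter.1 hd).1
    have hdC := (Finset.mem_filter.1 hd').1
    rw [Finset.mem_sdiff] at he
    have := hM.eq_of_endpoint he.1 hdC (.inr hde) (.inr rfl)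
    exact he.2 (this ▸ hd')
  · rw [Finset.mem_union, not_or]
    constructor
    · intro H
      obtain ⟨d, hd, hdc⟩ := Finset.mem_image.1 H
      have hdC := (Finset.mem_filter.1 (Finset.mem_filter.1 hd).1).1
      exact hsrc c hc d hdC hdc.symm
    · intro H
      exact lt_irrefl _ (Finset.mem_filter.1 H).2.1

/-- The positions of an insertion are those of `K` up to `p`, those of `C`, and those of `K` from `p`
on.  The position `p` of `K` occurs twice, on both sides of the inserted diagram. -/
lemma sum_Ico_insert {p k m : ℕ} (h1 : 1 ≤ p) (h2 : p < 2 * k) (h3 : 1 ≤ m) (g : ℕ → ℕ) :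
    ∑ z ∈ Finset.Ico 1 (2 * (k + m)), g z = ∑ x ∈ Finset.Ico 1 (p + 1), g (x + 1) +
      ∑ y ∈ Finset.Ico 1 (2 * m), g (innerMap p y) + ∑ x ∈ Finset.Ico p (2 * k), g (x + 2 * m) := by
  have e1 : ∑ y ∈ Finset.Ico 1 (2 * m), g (innerMap p y) =
      g 1 + ∑ y ∈ Finset.Ico 2 (2 * m), g (y + p) := by
    rw [Finset.sum_eq_sum_Ico_succ_bot (by omega)]
    congr 1
    refine Finset.sum_congr rfl fun y hy => ?_
    rw [Finset.mem_Ico] at hy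
    simp only [innerMap]
    rw [if_neg (by omega)]
  rw [e1, Finset.sum_Ico_add', Finset.sum_Ico_add', Finset.sum_Ico_add',
    Finset.sum_eq_sum_Ico_succ_bot (by omega)]
  rw [← Finset.sum_Ico_consecutive g (by omega : 1 + 1 ≤ p + 1 + 1)
    (by omega : p + 1 + 1 ≤ 2 * (k + m)),
    ← Finset.sum_Ico_consecutive g (by omega : p + 1 + 1 ≤ p + 2 * m)
    (by omega : p + 2 * m ≤ 2 * (k + m))]
  have e2 : 2 + p = p + 1 + 1 := by omega
  have e3 : 2 * m + p = p + 2 * m := by omega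
  have e4 : 2 * k + 2 * m = 2 * (k + m) := by omega
  rw [e2, e3, e4]
  ring

namespace IsInsertion

variable {k m p : ℕ} {K C : Finset Chord} (h : IsInsertion k m K p C)
include h

lemma isTop_outer_left {x : ℕ} (hx : x ≤ p) {c : Chord} (hc : c ∈ K) :
    IsTop (insertDiagram K p C) (x + 1) (Prod.map (outerMap p m) (outerMap p m) c) ↔
      IsTop K x c := by
  have h0 := h.one_le
  have hm := h.inner_pos
  have hle : ∀ y, outerMap p m y ≤ x + 1 ↔ y ≤ x := by
    intro y
    simp only [outerMap]
    split_ifs <;> omega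
  have hlt : ∀ y, x + 1 < outerMap p m y ↔ x < y := by
    intro y
    have := hle y
    omega
  rw [IsTop, IsTop, h.forall_mem]
  simp only [Prod.map_fst, Prod.map_snd, hle, hlt, h.strictMono.lt_iff_lt]
  refine and_congr_right fun _ => and_congr_right fun _ => and_iff_left_of_imp fun _ d hd h1 h2 => ?_
  have h3 := h.inner.bounds hd
  have h4 := h.outer.bounds hc
  simp only [outerMap, innerMap] at h1 h2
  split_ifs at h1 h2 <;> omega

lemma isTop_outer_right {x : ℕ} (hx : p ≤ x) {c : Chord} :
    IsTop (insertDiagram K p C) (x + 2 * m) (Prod.map (outerMap p m) (outerMap p m) c) ↔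
      IsTop K x c := by
  have h0 := h.one_le
  have hm := h.inner_pos
  have hle : ∀ y, outerMap p m y ≤ x + 2 * m ↔ y ≤ x := by
    intro y
    simp only [outerMap]
    split_ifs <;> omega
  have hlt : ∀ y, x + 2 * m < outerMap p m y ↔ x < y := by
    intro y
    have := hle y
    omega
  rw [IsTop, IsTop, h.forall_mem]
  simp only [Prod.map_fst, Prod.map_snd, hle, hlt, h.strictMono.lt_iff_lt]
  refine and_congr_right fun _ => and_congr_right fun _ => and_iff_left_of_imp fun _ d hd h1 h2 => ?_
  have h3 := h.inner.bounds hd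
  simp only [innerMap]
  split_ifs <;> omega

lemma not_isTop_inner_right {x : ℕ} (hx : p ≤ x) {d : Chord} (hd : d ∈ C) :
    ¬ IsTop (insertDiagram K p C) (x + 2 * m) (Prod.map (innerMap p) (innerMap p) d) := by
  intro H
  have h1 := H.2.1
  have h3 := h.inner.bounds hd
  simp only [Prod.map_snd, innerMap] at h1
  split_ifs at h1 <;> omega

lemma not_isTop_inner_left {x : ℕ} (hx1 : 1 ≤ x) (hx : x ≤ p) {d : Chord} (hd : d ∈ C) :
    ¬ IsTop (insertDiagram K p C) (x + 1) (Prod.map (innerMap p) (innerMap p) d) := by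
  intro H
  have h0 := h.lt
  obtain ⟨c, hc, hc1, hc2⟩ := exists_cover h.outer h.outer_conn hx1 (by omega)
  have h1 := H.2.2 _ (h.outer_mem hc)
  have h2 := H.1
  have h3 := h.inner.bounds hd
  have h4 := h.outer.bounds hc
  have h5 := h.inner_pos
  have h6 := H.2.1
  simp only [Prod.map_fst, Prod.map_snd, innerMap, outerMap] at h1 h2 h6
  split_ifs at h1 h2 h6 <;> omega

lemma isTop_inner {y : ℕ} (hy1 : 1 ≤ y) (hy : y < 2 * m) {d : Chord} (hd : d ∈ C) :
    IsTop (insertDiagram K p C) (innerMap p y) (Prod.map (innerMap p) (innerMap p) d) ↔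
      IsTop C y d := by
  have hle : ∀ x, innerMap p x ≤ innerMap p y ↔ x ≤ y := fun x => innerMap_strictMono.le_iff_le
  have hlt : ∀ x z, innerMap p x < innerMap p z ↔ x < z :=
    fun x z => innerMap_strictMono.lt_iff_lt
  rw [IsTop, IsTop, h.forall_mem]
  simp only [Prod.map_fst, Prod.map_snd, hle, hlt]
  refine and_congr_right fun h1 => and_congr_right fun h2 => and_iff_right_of_imp fun H c hc h3 h4 => ?_
  have h5 := h.inner.bounds hd
  have h6 := h.outer.bounds hc
  by_cases hy2 : y = 1
  · subst hy2
    simp only [outerMap, innerMap] at h4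
    split_ifs at h4 <;> omega
  have hd1 : d.1 ≠ 1 := by
    intro hd1
    obtain ⟨e, he, he1, he2, he3⟩ := exists_cover_ne_root h.inner h.inner_conn
      (by omega : 2 ≤ y) hy
    have := H e he (by omega) he2
    omega
  simp only [outerMap, innerMap] at h3 h4 ⊢
  split_ifs at h3 h4 ⊢ <;> omega

lemma not_isTop_outer {y : ℕ} (hy1 : 1 ≤ y) (hy : y < 2 * m) {c : Chord} (hc : c ∈ K) :
    ¬ IsTop (insertDiagram K p C) (innerMap p y) (Prod.map (outerMap p m) (outerMap p m) c) := by
  intro H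
  have h1 := H.1
  have h2 := H.2.1
  have h6 := h.outer.bounds hc
  have h0 := h.one_le
  by_cases hy2 : y = 1
  · subst hy2
    simp only [Prod.map_fst, outerMap, innerMap] at h1
    split_ifs at h1 <;> omega
  obtain ⟨e, he, he1, he2, he3⟩ := exists_cover_ne_root h.inner h.inner_conn
      (by omega : 2 ≤ y) hy
  have h3 := H.2.2 _ (h.inner_mem he)
  have h4 : innerMap p e.1 ≤ innerMap p y := innerMap_strictMono.monotone he2
  have h5 : innerMap p y < innerMap p e.2 := innerMap_strictMono he3
  simp only [Prod.map_fst, Prod.map_snd, h4, true_implies] at h1 h2 h3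
  have h7 : innerMap p y = y + p := by simp only [innerMap]; rw [if_neg (by omega)]
  have h8 : innerMap p e.1 = e.1 + p := by simp only [innerMap]; rw [if_neg (by omega)]
  have h9 : outerMap p m c.1 < innerMap p e.1 := by
    rw [h7] at h1
    rw [h8]
    simp only [outerMap] at h1 ⊢
    split_ifs at h1 ⊢ <;> omega
  have := h3 h9
  omega

open Classical in
/-- An insertion raises by one the valency of the top chord at the position of insertion, since this
position is doubled. -/
lemma valency_outer {c : Chord} (hc : c ∈ K) :
    valency (insertDiagram K p C) (Prod.map (outerMap p m) (outerMap p m) c) =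
      valency K c + if IsTop K p c then 1 else 0 := by
  have h1 := card_isTop h.isDiagram (h.outer_mem hc)
  have h2 := card_isTop h.outer hc
  have h3 := h.one_le
  have h4 := h.lt
  rw [Finset.card_filter] at h1 h2
  rw [sum_Ico_insert h3 h4 h.inner_pos] at h1
  rw [Finset.sum_congr rfl (g := fun x => if IsTop K x c then 1 else 0) (fun x hx => by
      rw [Finset.mem_Ico] at hx; simp only [h.isTop_outer_left (by omega : x ≤ p) hc]),
    Finset.sum_eq_zero (s := Finset.Ico 1 (2 * m)) (fun x hx => by
      rw [Finset.mem_Ico] at hx; rw [if_neg (h.not_isTop_outer hx.1 hx.2 hc)]),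
    Finset.sum_congr (s₁ := Finset.Ico p (2 * k)) rfl
      (g := fun x => if IsTop K x c then 1 else 0) (fun x hx => by
      rw [Finset.mem_Ico] at hx; simp only [h.isTop_outer_right hx.1]),
    Finset.sum_Ico_succ_top h3] at h1
  rw [← Finset.sum_Ico_consecutive _ h3 h4.le] at h2
  omega

lemma valency_inner {d : Chord} (hd : d ∈ C) :
    valency (insertDiagram K p C) (Prod.map (innerMap p) (innerMap p) d) = valency C d := by
  classical
  have h1 := card_isTop h.isDiagram (h.inner_mem hd)
  have h2 := card_isTop h.inner hd
  rw [Finset.card_filter] at h1 h2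
  rw [sum_Ico_insert h.one_le h.lt h.inner_pos] at h1
  rw [Finset.sum_eq_zero (s := Finset.Ico 1 (p + 1)) (fun x hx => by
      rw [Finset.mem_Ico] at hx; rw [if_neg (h.not_isTop_inner_left hx.1 (by omega) hd)]),
    Finset.sum_congr (s₁ := Finset.Ico 1 (2 * m)) rfl
      (g := fun x => if IsTop C x d then 1 else 0) (fun x hx => by
      rw [Finset.mem_Ico] at hx; simp only [h.isTop_inner hx.1 hx.2 hd]),
    Finset.sum_eq_zero (s := Finset.Ico p (2 * k)) (fun x hx => by
      rw [Finset.mem_Ico] at hx; rw [if_neg (h.not_isTop_inner_right hx.1 hd)])] at h1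
  omega

end IsInsertion

/-! ### Weights with bumped valencies -/

open Classical in
/-- The product of the weights `φ` of the valencies of the chords of `C`, after the valency of the
top chord has been raised by one for each position in the multiset `s`. -/
noncomputable def bumpWeight {R : Type*} [CommRing R] (φ : ℕ → R) (C : Finset Chord)
    (s : Multiset ℕ) : R :=
  ∏ c ∈ C, φ (valency C c + s.countP fun x => IsTop C x c)

lemma phiWeight_eq {K : Type*} [Field K] (φ : K⟦X⟧) (C : Finset Chord) :
    phiWeight φ C = bumpWeight (fun i => PowerSeries.coeff i φ) C 0 := by
  simp [phiWeight, bumpWeight]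

lemma map_bumpWeight {R S : Type*} [CommRing R] [CommRing S] (f : R →+* S) (φ : ℕ → R)
    (C : Finset Chord) (s : Multiset ℕ) :
    f (bumpWeight φ C s) = bumpWeight (fun i => f (φ i)) C s := map_prod _ _ _

/-- The weight of an insertion at `p` is the product of the weights of its parts, the outer diagram
being bumped at `p`. -/
lemma IsInsertion.bumpWeight {k m p : ℕ} {K C : Finset Chord} (h : IsInsertion k m K p C)
    {R : Type*} [CommRing R] (φ : ℕ → R) {s₁ s₂ : Multiset ℕ}
    (h₁ : ∀ y ∈ s₁, 1 ≤ y ∧ y < 2 * m) (h₂ : ∀ x ∈ s₂, p ≤ x) :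
    bumpWeight φ (insertDiagram K p C) (s₁.map (innerMap p) + s₂.map (· + 2 * m)) =
      bumpWeight φ K (p ::ₘ s₂) * ChordDiagram.bumpWeight φ C s₁ := by
  classical
  rw [ChordDiagram.bumpWeight, h.eq_union, Finset.prod_union h.disjoint, ← h.eq_union, relabel,
    relabel, Finset.prod_image (map_injective h.strictMono).injOn,
    Finset.prod_image (map_injective innerMap_strictMono).injOn]
  congr 1
  · refine Finset.prod_congr rfl fun c hc => ?_
    rw [h.valency_outer hc, Multiset.countP_add, Multiset.countP_map, Multiset.countP_map,
      Multiset.countP_cons]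
    have e1 : s₁.filter (fun y => IsTop (insertDiagram K p C) (innerMap p y)
        (Prod.map (outerMap p m) (outerMap p m) c)) = 0 :=
      Multiset.filter_eq_nil.2 fun y hy => h.not_isTop_outer (h₁ y hy).1 (h₁ y hy).2 hc
    have e2 : s₂.filter (fun x => IsTop (insertDiagram K p C) (x + 2 * m)
        (Prod.map (outerMap p m) (outerMap p m) c)) = s₂.filter fun x => IsTop K x c :=
      Multiset.filter_congr fun x hx => h.isTop_outer_right (h₂ x hx)
    rw [e1, e2, Multiset.countP_eq_card_filter]
    congr 1
    rw [Multiset.card_zero]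
    omega
  · refine Finset.prod_congr rfl fun d hd => ?_
    rw [h.valency_inner hd, Multiset.countP_add, Multiset.countP_map, Multiset.countP_map]
    have e1 : s₁.filter (fun y => IsTop (insertDiagram K p C) (innerMap p y)
        (Prod.map (innerMap p) (innerMap p) d)) = s₁.filter fun x => IsTop C x d :=
      Multiset.filter_congr fun y hy => h.isTop_inner (h₁ y hy).1 (h₁ y hy).2 hd
    have e2 : s₂.filter (fun x => IsTop (insertDiagram K p C) (x + 2 * m)
        (Prod.map (innerMap p) (innerMap p) d)) = 0 :=
      Multiset.filter_eq_nil.2 fun x hx => h.not_isTop_inner_right (h₂ x hx) hd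
    rw [e1, e2, Multiset.countP_eq_card_filter]
    rfl

lemma valency_single : valency {((1, 2) : Chord)} (1, 2) = 0 := by
  classical
  have h := card_isTop (isDiagram_one_iff.2 rfl) (Finset.mem_singleton_self ((1, 2) : Chord))
  have h' : (Finset.Ico 1 (2 * 1)).card = 1 := rfl
  have := Finset.card_filter_le (Finset.Ico 1 (2 * 1)) fun x => IsTop {((1, 2) : Chord)} x (1, 2)
  omega

lemma bumpWeight_single {R : Type*} [CommRing R] (φ : ℕ → R) {s : Multiset ℕ}
    (hs : ∀ x ∈ s, x = 1) : bumpWeight φ {((1, 2) : Chord)} s = φ s.card := by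
  classical
  rw [bumpWeight, Finset.prod_singleton, valency_single, zero_add,
    Multiset.countP_eq_card.2]
  intro x hx
  rw [hs x hx]
  exact ⟨le_rfl, by simp, by simp⟩

/-- If `D φ_i = (i + 1) φ_{i + 1}`, then `D` acts on the weight of a connected diagram by bumping it
once, in all possible ways. -/
lemma derivation_bumpWeight {A R : Type*} [CommRing A] [CommRing R] [Algebra A R]
    (D : Derivation A R R) {φ : ℕ → R} (hφ : ∀ i, D (φ i) = (i + 1) * φ (i + 1)) {n : ℕ}
    {C : Finset Chord} (h : IsDiagram n C) (hc : IsConnected C) :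
    D (bumpWeight φ C 0) = ∑ p ∈ Finset.Ico 1 (2 * n), bumpWeight φ C {p} := by
  classical
  have hprod : ∀ S : Finset Chord, D (∏ c ∈ S, φ (valency C c)) =
      ∑ c ∈ S, (valency C c + 1) * φ (valency C c + 1) * ∏ d ∈ S.erase c, φ (valency C d) := by
    intro S
    induction S using Finset.induction_on with
    | empty => simp
    | insert a S ha ih =>
      rw [Finset.prod_insert ha, D.leibniz, ih, hφ, Finset.sum_insert ha,
        Finset.erase_insert ha, smul_eq_mul, smul_eq_mul, Finset.mul_sum, add_comm]
      congr 1
      · ring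
      · refine Finset.sum_congr rfl fun c hc => ?_
        have hca : a ≠ c := by rintro rfl; exact ha hc
        rw [Finset.erase_insert_of_ne hca, Finset.prod_insert
          (fun H => ha (Finset.mem_of_mem_erase H))]
        ring
  have hbump : ∀ p ∈ Finset.Ico 1 (2 * n), bumpWeight φ C {p} =
      ∑ c ∈ C, if IsTop C p c then φ (valency C c + 1) * ∏ d ∈ C.erase c, φ (valency C d)
        else 0 := by
    intro p hp
    rw [Finset.mem_Ico] at hp
    obtain ⟨c, hcC, hct⟩ := exists_isTop h hc hp.1 hp.2
    have huniq : ∀ d ∈ C, d ≠ c → ¬ IsTop C p d := fun d hd hne hdt =>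
      hne (hdt.eq h.isMatching hd hcC hct)
    rw [Finset.sum_eq_single_of_mem c hcC fun d hd hne => if_neg (huniq d hd hne), if_pos hct,
      bumpWeight, ← Finset.mul_prod_erase C _ hcC]
    simp only [← Multiset.cons_zero, Multiset.countP_cons, Multiset.countP_zero, zero_add,
      if_pos hct]
    congr 1
    refine Finset.prod_congr rfl fun d hd => ?_
    rw [Finset.mem_erase] at hd
    rw [if_neg (huniq d hd.2 hd.1), add_zero]
  rw [bumpWeight]
  simp only [Multiset.countP_zero, add_zero]
  rw [hprod, Finset.sum_congr rfl hbump, Finset.sum_comm]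
  refine Finset.sum_congr rfl fun c hcC => ?_
  rw [← Finset.sum_filter, Finset.sum_const, card_isTop h hcC, nsmul_eq_mul, mul_assoc]
  push_cast
  ring

/-! ### Top cycles -/

/-- `g` is reached from `e` by repeatedly passing to right neighbors in `C`. -/
def RightChain (C : Finset Chord) : Chord → Chord → Prop :=
  Relation.ReflTransGen fun c d => d ∈ C ∧ RightNbr c d

lemma RightChain.mono {S C : Finset Chord} (hSC : S ⊆ C) {e g : Chord} (h : RightChain S e g) :
    RightChain C e g := by
  induction h with
  | refl => exact .refl
  | tail _ h ih => exact .tail ih ⟨hSC h.1, h.2⟩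

lemma RightChain.mem {C : Finset Chord} {e g : Chord} (h : RightChain C e g) (he : e ∈ C) :
    g ∈ C := by
  cases h with
  | refl => exact he
  | tail _ h => exact h.1

lemma RightChain.le {C : Finset Chord} {e g : Chord} (h : RightChain C e g) :
    e.1 ≤ g.1 ∧ e.2 ≤ g.2 := by
  induction h with
  | refl => exact ⟨le_rfl, le_rfl⟩
  | tail _ h ih => exact ⟨ih.1.trans h.2.1.le, ih.2.trans h.2.2.2.le⟩

/-- Among the chords of `C` satisfying `P` there are `d` and, with a later source, `e` such that a
chain of right neighbors starting with `e` leads to a chord crossing `d` at its sink. -/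
def HasDetour (C : Finset Chord) (P : Chord → Prop) : Prop :=
  ∃ d ∈ C, ∃ e ∈ C, P d ∧ P e ∧ d.1 < e.1 ∧ ∃ g, RightChain C e g ∧ g.1 < d.2 ∧ d.2 < g.2

lemma hasDetour_congr {C : Finset Chord} {P Q : Chord → Prop} (h : ∀ c ∈ C, P c ↔ Q c) :
    HasDetour C P ↔ HasDetour C Q := by
  constructor
  · rintro ⟨d, hd, e, he, h1, h2, h3⟩
    exact ⟨d, hd, e, he, (h d hd).1 h1, (h e he).1 h2, h3⟩
  · rintro ⟨d, hd, e, he, h1, h2, h3⟩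
    exact ⟨d, hd, e, he, (h d hd).2 h1, (h e he).2 h2, h3⟩

lemma not_hasDetour_of_forall {C : Finset Chord} {P : Chord → Prop} (h : ∀ c ∈ C, ¬ P c) :
    ¬ HasDetour C P := fun ⟨d, hd, _, _, h1, _⟩ => h d hd h1

/-- A chain of right neighbors `H 0, ..., H N` together with a right neighbor `d` of `H 0` whose
source comes before that of `H 1` and whose sink lies under `H N`. -/
def IsClosedChain (C : Finset Chord) (N : ℕ) (H : ℕ → Chord) (d : Chord) : Prop :=
  (∀ i ≤ N, H i ∈ C) ∧ (∀ i < N, RightNbr (H i) (H (i + 1))) ∧ RightNbr (H 0) d ∧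
    d.1 < (H 1).1 ∧ (H N).1 < d.2 ∧ d.2 < (H N).2

lemma exists_isClosedChain {C : Finset Chord} {r : Chord} (hr : r ∈ C)
    (h : HasDetour C (RightNbr r)) : ∃ N, 1 ≤ N ∧ ∃ H, ∃ d ∈ C, IsClosedChain C N H d := by
  obtain ⟨d, hd, e, he, hrd, hre, hde, g, hg, hg1, hg2⟩ := h
  have key : ∀ g, RightChain C e g → ∃ N, 1 ≤ N ∧ ∃ H : ℕ → Chord, H 0 = r ∧ H 1 = e ∧ H N = g ∧
      (∀ i ≤ N, H i ∈ C) ∧ ∀ i < N, RightNbr (H i) (H (i + 1)) := by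
    intro g hg
    induction hg with
    | refl =>
      refine ⟨1, le_rfl, fun i => if i = 0 then r else e, rfl, rfl, rfl, fun i _ => ?_,
        fun i hi => ?_⟩
      · dsimp only; split_ifs <;> assumption
      · have : i = 0 := by omega
        subst this
        exact hre
    | @tail f g _ h ih =>
      obtain ⟨N, hN, H, h0, h1, h2, h3, h4⟩ := ih
      refine ⟨N + 1, by omega, fun i => if i ≤ N then H i else g, ?_, ?_, ?_, fun i _ => ?_,
        fun i hi => ?_⟩
      · simp [h0]
      · simp [hN, h1]
      · simp
      · dsimp only; split_ifs with hi
        exacts [h3 i hi, h.1]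
      · rcases Nat.lt_succ_iff_lt_or_eq.1 hi with hi | rfl
        · simpa [hi.le, Nat.succ_le_of_lt hi] using h4 i hi
        · simpa [h2] using h.2
  obtain ⟨N, hN, H, h0, h1, h2, h3, h4⟩ := key g hg
  exact ⟨N, hN, H, d, hd, h3, h4, h0 ▸ hrd, h1 ▸ hde, h2 ▸ hg1, h2 ▸ hg2⟩

/-- A closed chain of minimal length is an induced cycle, and it is a top cycle. -/
lemma not_isTopCycleFree_of_hasDetour {C : Finset Chord} (hC : IsMatching C) {r : Chord}
    (hr : r ∈ C) (h : HasDetour C (RightNbr r)) : ¬ IsTopCycleFree C := by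
  classical
  have hex := exists_isClosedChain hr h
  set N := Nat.find hex with hN
  obtain ⟨hN1, H, d, hd, hmem, hstep, hd0, hd1, hdN, hdN'⟩ := Nat.find_spec hex
  rw [← hN] at hN1 hmem hstep hdN hdN'
  have hmin : ∀ M, 1 ≤ M → M < N → ∀ H, ¬ IsClosedChain C M H d :=
    fun M h1 h2 H hH => Nat.find_min hex h2 ⟨h1, H, d, hd, hH⟩
  have hmono : ∀ i j, i ≤ j → j ≤ N → (H i).1 ≤ (H j).1 := by
    intro i j hij hj
    induction j, hij using Nat.le_induction with
    | base => exact le_rfl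
    | succ j _ ih => exact (ih (by omega)).trans (hstep j (by omega)).1.le
  -- chords at distance two do not cross, because the chain could be shortened
  have hskip : ∀ i, i + 2 ≤ N → (H i).2 < (H (i + 2)).1 := by
    intro i hi
    have h1 := hstep i (by omega)
    have h2 : RightNbr (H (i + 1)) (H (i + 2)) := hstep (i + 1) (by omega)
    have h3 := hC.ne _ (hmem i (by omega)) _ (hmem (i + 2) hi) (by
      intro H'
      have h1 := h1.1
      have h2 := h2.1
      rw [H'] at h1
      exact lt_asymm h1 h2)
    by_contra h4
    refine hmin (N - 1) (by omega) (by omega) (fun j => if j ≤ i then H j else H (j + 1))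
      ⟨fun j hj => ?_, fun j hj => ?_, ?_, ?_, ?_, ?_⟩
    · dsimp only; split_ifs
      exacts [hmem j (by omega), hmem (j + 1) (by omega)]
    · dsimp only
      rcases lt_trichotomy j i with hji | rfl | hji
      · rw [if_pos hji.le, if_pos (by omega)]
        exact hstep j (by omega)
      · rw [if_pos le_rfl, if_neg (by omega)]
        change RightNbr (H j) (H (j + 2))
        simp only [RightNbr] at h1 h2 ⊢
        omega
      · rw [if_neg (by omega), if_neg (by omega)]
        exact hstep (j + 1) (by omega)
    · simpa using hd0
    · dsimp only
      split_ifs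
      · exact hd1
      · have := hmono 1 (1 + 1) (by omega) (by omega)
        omega
    · dsimp only
      rw [if_neg (by omega), Nat.sub_add_cancel hN1]
      exact hdN
    · dsimp only
      rw [if_neg (by omega), Nat.sub_add_cancel hN1]
      exact hdN'
  -- likewise `d` ends after `H (N - 1)`, because the last chord of the chain could be dropped
  have hlast : (H (N - 1)).2 < d.2 := by
    rcases hN1.eq_or_lt with h1 | h1
    · rw [← h1]
      exact hd0.2.2
    · by_contra h2
      have h3 := hmono (N - 1) N (by omega) le_rfl
      have h4 := hmono 1 (N - 1) (by omega) (by omega)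
      have h5 := hC.ne _ (hmem (N - 1) (by omega)) d hd (by
        intro H'
        rw [H'] at h4
        omega)
      exact hmin (N - 1) (by omega) (by omega) H ⟨fun i hi => hmem i (by omega),
        fun i hi => hstep i (by omega), hd0, hd1, by omega, by omega⟩
  -- the relabelling sends the `i + 1`-st path chord of the top cycle to `H i` and its closing chord
  -- to `d`
  set g : ℕ → ℕ := fun x => if x = 2 then d.1 else if x = 2 * N + 3 then d.2 else
    if x % 2 = 1 then (H ((x - 1) / 2)).1 else (H ((x - 4) / 2)).2 with hg
  have hgs : ∀ i ≤ N, g (2 * i + 1) = (H i).1 := by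
    intro i hi
    rw [hg]
    dsimp only
    rw [if_neg (by omega), if_neg (by omega), if_pos (by omega)]
    congr 2
    omega
  have hgt : ∀ i, g (2 * i + 4) = (H i).2 := by
    intro i
    rw [hg]
    dsimp only
    rw [if_neg (by omega), if_neg (by omega), if_neg (by omega)]
    congr 2
    omega
  have hg2 : g 2 = d.1 := by rw [hg]; rfl
  have hgN : g (2 * N + 3) = d.2 := by
    rw [hg]
    dsimp only
    rw [if_neg (by omega), if_pos rfl]
  intro hfree
  refine hfree (N + 2) (by omega) g ?_ ?_
  · refine strictMonoOn_of_lt_succ Set.ordConnected_Icc fun x _ hx hx' => ?_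
    rw [Order.succ_eq_add_one] at hx' ⊢
    rw [Set.mem_Icc] at hx hx'
    obtain ⟨i, rfl | rfl⟩ : ∃ i, x = 2 * i + 1 ∨ x = 2 * i + 2 := ⟨(x - 1) / 2, by omega⟩
    · rcases Nat.eq_zero_or_pos i with rfl | hi
      · rw [hgs 0 (by omega), show 2 * 0 + 1 + 1 = 2 from rfl, hg2]
        exact hd0.1
      · rcases (by omega : i ≤ N ∨ i = N + 1) with hi' | rfl
        · have e : 2 * i + 1 + 1 = 2 * (i - 1) + 4 := by omega
          rw [hgs i hi', e, hgt]
          have := (hstep (i - 1) (by omega)).2.1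
          rwa [Nat.sub_add_cancel hi] at this
        · have e : 2 * (N + 1) + 1 + 1 = 2 * N + 4 := by omega
          have e' : 2 * (N + 1) + 1 = 2 * N + 3 := by omega
          rw [e, e', hgt, hgN]
          exact hdN'
    · have e : 2 * i + 2 + 1 = 2 * (i + 1) + 1 := by omega
      rcases Nat.eq_zero_or_pos i with rfl | hi
      · rw [e, hgs (0 + 1) hN1, show 2 * 0 + 2 = 2 from rfl, hg2]
        exact hd1
      · have e' : 2 * i + 2 = 2 * (i - 1) + 4 := by omega
        rcases (by omega : i < N ∨ i = N) with hi' | rfl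
        · rw [e, e', hgt, hgs (i + 1) hi']
          have := hskip (i - 1) (by omega)
          rwa [show i - 1 + 2 = i + 1 by omega] at this
        · rw [e', hgt, show 2 * (N - 1) + 4 + 1 = 2 * N + 3 by omega, hgN]
          exact hlast
  · intro c hc
    obtain ⟨c, hc', rfl⟩ := Finset.mem_image.1 hc
    rcases Finset.mem_insert.1 hc' with rfl | hc'
    · rw [Prod.map_apply, hg2, show 2 * (N + 2) - 1 = 2 * N + 3 by omega, hgN]
      exact hd
    · obtain ⟨i, hi, rfl⟩ := Finset.mem_image.1 hc'
      rw [Finset.mem_Icc] at hi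
      rw [Prod.map_apply, show 2 * i - 1 = 2 * (i - 1) + 1 by omega,
        show 2 * i + 2 = 2 * (i - 1) + 4 by omega, hgs _ (by omega), hgt]
      exact hmem _ (by omega)

/-- The top cycles are the minimal detours of right neighbors of a chord `r`, which is their root. -/
lemma isTopCycleFree_iff {C : Finset Chord} (hC : IsMatching C) :
    IsTopCycleFree C ↔ ∀ r ∈ C, ¬ HasDetour C (RightNbr r) := by
  refine ⟨fun h r hr hd => not_isTopCycleFree_of_hasDetour hC hr hd h, fun h m hm g hg hsub => ?_⟩
  have hlt : ∀ x y, 1 ≤ x → x < y → y ≤ 2 * m → g x < g y := fun x y h1 h2 h3 =>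
    hg ⟨h1, by omega⟩ ⟨by omega, h3⟩ h2
  have hH : ∀ i, 1 ≤ i → i ≤ m - 1 → (g (2 * i - 1), g (2 * i + 2)) ∈ C := by
    intro i h1 h2
    refine hsub (Finset.mem_image.2 ⟨(2 * i - 1, 2 * i + 2), Finset.mem_insert_of_mem ?_, rfl⟩)
    exact Finset.mem_image.2 ⟨i, Finset.mem_Icc.2 ⟨h1, h2⟩, rfl⟩
  have hd : (g 2, g (2 * m - 1)) ∈ C :=
    hsub (Finset.mem_image.2 ⟨(2, 2 * m - 1), Finset.mem_insert_self _ _, rfl⟩)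
  refine h _ (hH 1 le_rfl (by omega)) ⟨_, hd, _, hH 2 (by omega) (by omega), ?_, ?_, ?_,
    (g (2 * (m - 1) - 1), g (2 * (m - 1) + 2)), ?_, ?_, ?_⟩
  · exact ⟨hlt _ _ (by omega) (by omega) (by omega), hlt _ _ (by omega) (by omega) (by omega),
      hlt _ _ (by omega) (by omega) (by omega)⟩
  · exact ⟨hlt _ _ (by omega) (by omega) (by omega), hlt _ _ (by omega) (by omega) (by omega),
      hlt _ _ (by omega) (by omega) (by omega)⟩
  · exact hlt _ _ (by omega) (by omega) (by omega)
  · have key : ∀ i, 2 ≤ i → i ≤ m - 1 →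
        RightChain C (g (2 * 2 - 1), g (2 * 2 + 2)) (g (2 * i - 1), g (2 * i + 2)) := by
      intro i hi
      induction i, hi using Nat.le_induction with
      | base => exact fun _ => .refl
      | succ i hi ih =>
        intro hi'
        refine .tail (ih (by omega)) ⟨hH _ (by omega) hi', ?_⟩
        exact ⟨hlt _ _ (by omega) (by omega) (by omega), hlt _ _ (by omega) (by omega) (by omega),
          hlt _ _ (by omega) (by omega) (by omega)⟩
    exact key (m - 1) (by omega) le_rfl
  · exact hlt _ _ (by omega) (by omega) (by omega)
  · exact hlt _ _ (by omega) (by omega) (by omega)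

/-- The position `p` is blocked in `C` if inserting a diagram there creates a top cycle through the
new root. -/
def IsBlocked (C : Finset Chord) (p : ℕ) : Prop := HasDetour C fun c => c.1 ≤ p ∧ p < c.2

lemma RightChain.exists_cover {C : Finset Chord} {e g : Chord} (h : RightChain C e g) {w : ℕ}
    (h1 : e.1 < w) (h2 : w < g.2) : ∃ f, RightChain C e f ∧ f.1 < w ∧ w < f.2 := by
  induction h with
  | refl => exact ⟨e, .refl, h1, h2⟩
  | @tail f g hf h ih =>
    rcases lt_or_ge g.1 w with h3 | h3
    · exact ⟨g, .tail hf h, h3, h2⟩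
    · exact ih (h3.trans_lt h.2.2.1)

/-- If all positions from `x` to `z` are covered by chords of `S`, then a chain of right neighbors
leads from a chord covering `x` to a chord covering `z`. -/
lemma exists_rightChain {S : Finset Chord} (hS : IsMatching S) {x z : ℕ} (hxz : x ≤ z)
    (hcov : ∀ w, x ≤ w → w ≤ z → ∃ c ∈ S, c.1 ≤ w ∧ w < c.2) :
    ∃ e ∈ S, e.1 ≤ x ∧ x < e.2 ∧ ∃ g, RightChain S e g ∧ g.1 ≤ z ∧ z < g.2 := by
  induction z, hxz using Nat.le_induction with
  | base =>
    obtain ⟨c, hc, h1, h2⟩ := hcov x le_rfl le_rfl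
    exact ⟨c, hc, h1, h2, c, .refl, h1, h2⟩
  | succ z hxz ih =>
    obtain ⟨e, he, he1, he2, g, hg, hg1, hg2⟩ := ih fun w h1 h2 => hcov w h1 (by omega)
    by_cases h1 : z + 1 < g.2
    · exact ⟨e, he, he1, he2, g, hg, by omega, h1⟩
    obtain ⟨c, hc, hc1, hc2⟩ := hcov (z + 1) (by omega) le_rfl
    have h2 : c.1 ≠ z + 1 := by
      intro h2
      have := hS.eq_of_endpoint hc (hg.mem he) (.inl h2) (.inr (by omega))
      subst this
      omega
    by_cases h3 : c.1 ≤ x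
    · exact ⟨c, hc, h3, by omega, c, .refl, hc1, hc2⟩
    obtain ⟨f, hf, hf1, hf2⟩ := hg.exists_cover (w := c.1) (by omega) (by omega)
    by_cases h4 : z + 1 < f.2
    · exact ⟨e, he, he1, he2, f, hf, by omega, h4⟩
    · exact ⟨e, he, he1, he2, c, .tail hf ⟨hc, hf1, hf2, by omega⟩, hc1, hc2⟩

/-- A position covered by the root is blocked, unless it directly follows its source. -/
lemma isBlocked_of_root_covers {n : ℕ} {C : Finset Chord} (h : IsDiagram n C) (hc : IsConnected C)
    {b : ℕ} (hb : (1, b) ∈ C) {y : ℕ} (hy : 2 ≤ y) (hyb : y < b) : IsBlocked C y := by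
  have hbb := h.bounds hb
  simp only at hbb
  have hM := h.isMatching
  have hcov : ∀ w, 2 ≤ w → w < 2 * n → ∃ c ∈ C.erase (1, b), c.1 ≤ w ∧ w < c.2 := by
    intro w h1 h2
    obtain ⟨c, hcC, h3, h4⟩ := exists_cover_ne_root h hc h1 h2
    refine ⟨c, Finset.mem_erase.2 ⟨?_, hcC⟩, h4⟩
    rintro rfl
    simp at h3
  have hbn : b < 2 * n := by
    by_contra hbn
    obtain ⟨c, hcC, hc1, hc2⟩ := hcov (2 * n - 1) (by omega) (by omega)
    rw [Finset.mem_erase] at hcC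
    have := h.bounds hcC.2
    exact hcC.1 (hM.eq_of_endpoint hcC.2 hb (i := b) (.inr (by omega)) (.inr rfl))
  obtain ⟨e, he, he1, he2, g, hg, hg1, hg2⟩ := exists_rightChain
    (hM.subset (Finset.erase_subset (1, b) C)) hyb.le fun w h1 h2 => hcov w (by omega) (by omega)
  have hgC := Finset.mem_erase.1 (hg.mem he)
  have he' := Finset.mem_erase.1 he
  have h1 := hM.ne _ hgC.2 _ hb hgC.1
  have h2 := (hM.ne _ he'.2 _ hb he'.1).1
  have h3 := h.bounds he'.2
  simp only at h1 h2
  exact ⟨(1, b), hb, e, he'.2, ⟨by simp only; omega, hyb⟩, ⟨he1, he2⟩, by simp only; omega, g,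
    hg.mono (Finset.erase_subset _ _), by simp only; omega, hg2⟩

namespace IsInsertion

variable {k m p : ℕ} {K C : Finset Chord} (h : IsInsertion k m K p C)
include h

lemma not_rightNbr_outer_inner {c d : Chord} (hc : c ∈ K) (hd : d ∈ C) :
    ¬ RightNbr (Prod.map (outerMap p m) (outerMap p m) c)
      (Prod.map (innerMap p) (innerMap p) d) := by
  by_cases hd1 : d.1 = 1
  · have h1 := h.outer.bounds hc
    simp only [RightNbr, Prod.map_fst, hd1, outerMap, innerMap]
    split_ifs <;> omega
  · exact fun H => h.not_crosses hc hd hd1 (.inl H)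

lemma rightChain_outer {c : Chord} (hc : c ∈ K) {g' : Chord} :
    RightChain (insertDiagram K p C) (Prod.map (outerMap p m) (outerMap p m) c) g' ↔
      ∃ g, g' = Prod.map (outerMap p m) (outerMap p m) g ∧ RightChain K c g := by
  constructor
  · intro hg
    induction hg with
    | refl => exact ⟨c, rfl, .refl⟩
    | tail _ h' ih =>
      obtain ⟨f, rfl, hf⟩ := ih
      rcases h.mem_iff.1 h'.1 with ⟨g, hg, rfl⟩ | ⟨d, hd, rfl⟩
      · exact ⟨g, rfl, .tail hf ⟨hg, (rightNbr_map h.strictMono).1 h'.2⟩⟩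
      · exact (h.not_rightNbr_outer_inner (hf.mem hc) hd h'.2).elim
  · rintro ⟨g, rfl, hg⟩
    induction hg with
    | refl => exact .refl
    | tail _ h' ih => exact .tail ih ⟨h.outer_mem h'.1, (rightNbr_map h.strictMono).2 h'.2⟩

lemma rightChain_inner {d : Chord} (hd : d ∈ C) (hd1 : d.1 ≠ 1) {g' : Chord} :
    RightChain (insertDiagram K p C) (Prod.map (innerMap p) (innerMap p) d) g' ↔
      ∃ g, g' = Prod.map (innerMap p) (innerMap p) g ∧ RightChain C d g := by
  constructor
  · intro hg
    induction hg with
    | refl => exact ⟨d, rfl, .refl⟩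
    | tail _ h' ih =>
      obtain ⟨f, rfl, hf⟩ := ih
      rcases h.mem_iff.1 h'.1 with ⟨g, hg, rfl⟩ | ⟨g, hg, rfl⟩
      · have h1 := hf.le.1
        have h2 := h.inner.bounds hd
        exact (h.not_crosses hg (hf.mem hd) (by omega) (.inr h'.2)).elim
      · exact ⟨g, rfl, .tail hf ⟨hg, (rightNbr_map innerMap_strictMono).1 h'.2⟩⟩
  · rintro ⟨g, rfl, hg⟩
    induction hg with
    | refl => exact .refl
    | tail _ h' ih => exact .tail ih ⟨h.inner_mem h'.1, (rightNbr_map innerMap_strictMono).2 h'.2⟩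

/-- A detour in an insertion lies in one of the two parts, or it goes around the sink of the new
root within the outer diagram. -/
lemma hasDetour_iff {b : ℕ} (hb : (1, b) ∈ C) {P : Chord → Prop} :
    HasDetour (insertDiagram K p C) P ↔
      HasDetour K (fun c => P (Prod.map (outerMap p m) (outerMap p m) c)) ∨
      HasDetour C (fun d => P (Prod.map (innerMap p) (innerMap p) d)) ∨
      (P (Prod.map (innerMap p) (innerMap p) (1, b)) ∧ ∃ e ∈ K,
        P (Prod.map (outerMap p m) (outerMap p m) e) ∧
          ∃ g, RightChain K e g ∧ g.1 ≤ p ∧ p < g.2) := by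
  have hroot : ∀ d ∈ C, d.1 = 1 → d = (1, b) := fun d hd hd1 =>
    h.inner.isMatching.eq_of_endpoint hd hb (.inl hd1) (.inl rfl)
  have hsrc : ∀ e ∈ K, innerMap p 1 < outerMap p m e.1 := by
    intro e he
    have := h.outer.bounds he
    have := h.inner_pos
    simp only [innerMap, outerMap]
    split_ifs <;> omega
  constructor
  · rintro ⟨d', hd', e', he', hPd, hPe, hlt, g', hg', hg1, hg2⟩
    have hge := hg'.le
    have hR : RightNbr d' g' := ⟨hlt.trans_le hge.1, hg1, hg2⟩
    rcases h.mem_iff.1 hd' with ⟨d, hd, rfl⟩ | ⟨d, hd, rfl⟩ <;>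
      rcases h.mem_iff.1 he' with ⟨e, he, rfl⟩ | ⟨e, he, rfl⟩
    · obtain ⟨g, rfl, hg⟩ := (h.rightChain_outer he).1 hg'
      exact .inl ⟨d, hd, e, he, hPd, hPe, h.strictMono.lt_iff_lt.1 hlt, g, hg,
        h.strictMono.lt_iff_lt.1 hg1, h.strictMono.lt_iff_lt.1 hg2⟩
    · have he1 : e.1 ≠ 1 := by
        intro he1
        have := hsrc d hd
        simp only [Prod.map_fst, he1] at hlt
        omega
      obtain ⟨g, rfl, hg⟩ := (h.rightChain_inner he he1).1 hg'
      exact (h.not_rightNbr_outer_inner hd (hg.mem he) hR).elim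
    · obtain ⟨g, rfl, hg⟩ := (h.rightChain_outer he).1 hg'
      by_cases hd1 : d.1 = 1
      · rw [hroot d hd hd1] at hR hPd
        exact .inr (.inr ⟨hPd, e, he, hPe, g, hg, (h.rightNbr_root_outer hb (hg.mem he)).1 hR⟩)
      · exact (h.not_crosses (hg.mem he) hd hd1 (.inr hR)).elim
    · have hlt' : d.1 < e.1 := innerMap_strictMono.lt_iff_lt.1 hlt
      have hd1 := h.inner.bounds hd
      obtain ⟨g, rfl, hg⟩ := (h.rightChain_inner he (by omega)).1 hg'
      exact .inr (.inl ⟨d, hd, e, he, hPd, hPe, hlt', g, hg,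
        innerMap_strictMono.lt_iff_lt.1 hg1, innerMap_strictMono.lt_iff_lt.1 hg2⟩)
  · rintro (⟨d, hd, e, he, hPd, hPe, hlt, g, hg, hg1, hg2⟩ |
      ⟨d, hd, e, he, hPd, hPe, hlt, g, hg, hg1, hg2⟩ | ⟨hP, e, he, hPe, g, hg, hgp⟩)
    · exact ⟨_, h.outer_mem hd, _, h.outer_mem he, hPd, hPe, h.strictMono hlt, _,
        (h.rightChain_outer he).2 ⟨g, rfl, hg⟩, h.strictMono hg1, h.strictMono hg2⟩
    · have hd1 := h.inner.bounds hd
      exact ⟨_, h.inner_mem hd, _, h.inner_mem he, hPd, hPe, innerMap_strictMono hlt, _,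
        (h.rightChain_inner he (by omega)).2 ⟨g, rfl, hg⟩, innerMap_strictMono hg1,
        innerMap_strictMono hg2⟩
    · have := (h.rightNbr_root_outer hb (hg.mem he)).2 hgp
      exact ⟨_, h.inner_mem hb, _, h.outer_mem he, hP, hPe, hsrc e he, _,
        (h.rightChain_outer he).2 ⟨g, rfl, hg⟩, this.2.1, this.2.2⟩

/-- A top cycle in an insertion lies in one of the parts, unless its root is the new root and the rest
of it belongs to the outer diagram. -/
lemma isTopCycleFree_iff : IsTopCycleFree (insertDiagram K p C) ↔
    IsTopCycleFree K ∧ IsTopCycleFree C ∧ ¬ IsBlocked K p := by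
  obtain ⟨b, hb⟩ := h.inner.exists_root h.inner_pos
  have hroot : ∀ d ∈ C, d.1 = 1 → d = (1, b) := fun d hd hd1 =>
    h.inner.isMatching.eq_of_endpoint hd hb (.inl hd1) (.inl rfl)
  rw [ChordDiagram.isTopCycleFree_iff h.isMatching,
    ChordDiagram.isTopCycleFree_iff h.outer.isMatching,
    ChordDiagram.isTopCycleFree_iff h.inner.isMatching, h.forall_mem]
  have h1 : ∀ r ∈ K, (HasDetour (insertDiagram K p C)
      (RightNbr (Prod.map (outerMap p m) (outerMap p m) r)) ↔ HasDetour K (RightNbr r)) := by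
    intro r hr
    rw [h.hasDetour_iff hb, hasDetour_congr (Q := RightNbr r)
      fun c _ => rightNbr_map h.strictMono, or_iff_left]
    rintro (H | ⟨H, -⟩)
    · exact not_hasDetour_of_forall (fun d hd => h.not_rightNbr_outer_inner hr hd) H
    · exact h.not_rightNbr_outer_inner hr hb H
  have h2 : ∀ r ∈ C, r.1 ≠ 1 → (HasDetour (insertDiagram K p C)
      (RightNbr (Prod.map (innerMap p) (innerMap p) r)) ↔ HasDetour C (RightNbr r)) := by
    intro r hr hr1
    have h3 : ∀ c ∈ K, ¬ RightNbr (Prod.map (innerMap p) (innerMap p) r)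
        (Prod.map (outerMap p m) (outerMap p m) c) := fun c hc H =>
      h.not_crosses hc hr hr1 (.inr H)
    rw [h.hasDetour_iff hb, hasDetour_congr (C := C) (Q := RightNbr r)
      fun c _ => rightNbr_map innerMap_strictMono, or_iff_right (not_hasDetour_of_forall h3),
      or_iff_left]
    rintro ⟨-, e, he, H, -⟩
    exact h3 e he H
  have h3 : HasDetour (insertDiagram K p C)
      (RightNbr (Prod.map (innerMap p) (innerMap p) (1, b))) ↔
      IsBlocked K p ∨ HasDetour C (RightNbr (1, b)) := by
    rw [h.hasDetour_iff hb, hasDetour_congr (C := C) (Q := RightNbr (1, b))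
      fun c _ => rightNbr_map innerMap_strictMono,
      hasDetour_congr (C := K) fun c hc => h.rightNbr_root_outer hb hc, IsBlocked]
    refine or_congr_right (or_iff_left ?_)
    rintro ⟨H, -⟩
    exact lt_irrefl _ H.1
  constructor
  · rintro ⟨H1, H2⟩
    have H3 := H2 _ hb
    rw [h3, not_or] at H3
    refine ⟨fun r hr => (h1 r hr).not.1 (H1 r hr), fun r hr => ?_, H3.1⟩
    by_cases hr1 : r.1 = 1
    · rw [hroot r hr hr1]
      exact H3.2
    · exact (h2 r hr hr1).not.1 (H2 r hr)
  · rintro ⟨H1, H2, H3⟩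
    refine ⟨fun r hr => (h1 r hr).not.2 (H1 r hr), fun r hr => ?_⟩
    by_cases hr1 : r.1 = 1
    · rw [hroot r hr hr1, h3, not_or]
      exact ⟨H3, H2 _ hb⟩
    · exact (h2 r hr hr1).not.2 (H2 r hr)

/-- The positions before the inserted diagram become blocked: the new root covers them, and a chain of
the outer diagram leads from there past the sink of the new root. -/
lemma isBlocked_left {x : ℕ} (hx1 : 1 ≤ x) (hx : x ≤ p) :
    IsBlocked (insertDiagram K p C) (x + 1) := by
  obtain ⟨b, hb⟩ := h.inner.exists_root h.inner_pos
  have hbb := h.inner.bounds hb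
  have hlt := h.lt
  rw [IsBlocked, h.hasDetour_iff hb]
  obtain ⟨e, he, he1, he2, g, hg, hg1, hg2⟩ := exists_rightChain h.outer.isMatching hx
    fun w h1 h2 => exists_cover h.outer h.outer_conn (by omega) (by omega)
  refine .inr (.inr ⟨?_, e, he, ?_, g, hg, hg1, hg2⟩)
  · simp only [Prod.map_fst, Prod.map_snd, innerMap] at hbb ⊢
    split_ifs <;> omega
  · simp only [Prod.map_fst, Prod.map_snd, outerMap]
    have := h.inner_pos
    split_ifs <;> omega

lemma isBlocked_right {x : ℕ} (hx : p ≤ x) :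
    IsBlocked (insertDiagram K p C) (x + 2 * m) ↔ IsBlocked K x := by
  obtain ⟨b, hb⟩ := h.inner.exists_root h.inner_pos
  have h1 : ∀ c ∈ K, ((Prod.map (outerMap p m) (outerMap p m) c).1 ≤ x + 2 * m ∧
      x + 2 * m < (Prod.map (outerMap p m) (outerMap p m) c).2) ↔ (c.1 ≤ x ∧ x < c.2) := by
    intro c _
    have := h.inner_pos
    simp only [Prod.map_fst, Prod.map_snd, outerMap]
    split_ifs <;> omega
  have h2 : ∀ d ∈ C, ¬ ((Prod.map (innerMap p) (innerMap p) d).1 ≤ x + 2 * m ∧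
      x + 2 * m < (Prod.map (innerMap p) (innerMap p) d).2) := by
    intro d hd
    have := h.inner.bounds hd
    simp only [Prod.map_fst, Prod.map_snd, innerMap]
    split_ifs <;> omega
  rw [IsBlocked, h.hasDetour_iff hb, hasDetour_congr (C := K) h1, IsBlocked, or_iff_left]
  rintro (H | ⟨H, -⟩)
  exacts [not_hasDetour_of_forall h2 H, h2 _ hb H]

/-- The position right after the source of the new root is covered by no other chord; all other
positions inside the inserted diagram are covered by the same outer chords as `p`. -/
lemma isBlocked_inner (hp : ¬ IsBlocked K p) {y : ℕ} (hy1 : 1 ≤ y) (hy : y < 2 * m) :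
    IsBlocked (insertDiagram K p C) (innerMap p y) ↔ IsBlocked C y := by
  obtain ⟨b, hb⟩ := h.inner.exists_root h.inner_pos
  have h1 : ∀ d ∈ C, ((Prod.map (innerMap p) (innerMap p) d).1 ≤ innerMap p y ∧
      innerMap p y < (Prod.map (innerMap p) (innerMap p) d).2) ↔ (d.1 ≤ y ∧ y < d.2) := fun d _ =>
    and_congr innerMap_strictMono.le_iff_le innerMap_strictMono.lt_iff_lt
  rw [IsBlocked, h.hasDetour_iff hb, hasDetour_congr (C := C) h1, h1 _ hb, ← IsBlocked]
  rcases hy1.eq_or_lt with rfl | hy2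
  · have h2 : ∀ c ∈ K, ¬ ((Prod.map (outerMap p m) (outerMap p m) c).1 ≤ innerMap p 1 ∧
        innerMap p 1 < (Prod.map (outerMap p m) (outerMap p m) c).2) := by
      intro c hc
      have := h.outer.bounds hc
      simp only [Prod.map_fst, Prod.map_snd, outerMap, innerMap]
      split_ifs <;> omega
    rw [or_iff_right (not_hasDetour_of_forall h2), or_iff_left]
    rintro ⟨-, e, he, H, -⟩
    exact h2 e he H
  · have h2 : ∀ c ∈ K, ((Prod.map (outerMap p m) (outerMap p m) c).1 ≤ innerMap p y ∧
        innerMap p y < (Prod.map (outerMap p m) (outerMap p m) c).2) ↔ (c.1 ≤ p ∧ p < c.2) := by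
      intro c hc
      simp only [Prod.map_fst, Prod.map_snd, outerMap, innerMap]
      split_ifs <;> omega
    -- detours around the new root through the outer diagram block `y`, but `y` is then covered by the
    -- new root and blocked in `C` already
    rw [hasDetour_congr (C := K) h2, ← IsBlocked, or_iff_right hp, or_iff_left_of_imp]
    rintro ⟨H, -⟩
    exact isBlocked_of_root_covers h.inner h.inner_conn hb hy2 H.2

end IsInsertion

open Classical in
/-- The positions of a diagram of size `n` at which a top-cycle-free diagram may be inserted without
creating a top cycle. -/
noncomputable def openPositions (n : ℕ) (C : Finset Chord) : Finset ℕ :=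
  (Finset.Ico 1 (2 * n)).filter fun x => ¬ IsBlocked C x

lemma mem_openPositions {n : ℕ} {C : Finset Chord} {x : ℕ} :
    x ∈ openPositions n C ↔ (1 ≤ x ∧ x < 2 * n) ∧ ¬ IsBlocked C x := by
  classical
  rw [openPositions, Finset.mem_filter, Finset.mem_Ico]

/-- The open positions of an insertion are those of the inner diagram, followed by those of the outer
diagram from the position of insertion on. -/
lemma IsInsertion.openPositions_eq {k m p : ℕ} {K C : Finset Chord}
    (h : IsInsertion k m K p C) (hp : ¬ IsBlocked K p) :
    openPositions (k + m) (insertDiagram K p C) = (openPositions m C).image (innerMap p) ∪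
      ((openPositions k K).filter (p ≤ ·)).image (· + 2 * m) := by
  have h1 := h.one_le
  have h2 := h.lt
  have h3 := h.inner_pos
  ext z
  simp only [Finset.mem_union, Finset.mem_image, Finset.mem_filter, mem_openPositions]
  constructor
  · rintro ⟨hz, hzb⟩
    by_cases hz1 : z = 1 ∨ (p + 2 ≤ z ∧ z < p + 2 * m)
    · obtain ⟨y, hy1, hy2, rfl⟩ : ∃ y, 1 ≤ y ∧ y < 2 * m ∧ innerMap p y = z := by
        rcases hz1 with rfl | hz1
        · exact ⟨1, le_rfl, by omega, rfl⟩
        · exact ⟨z - p, by omega, by omega, by simp only [innerMap]; split_ifs <;> omega⟩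
      exact .inl ⟨y, ⟨⟨hy1, hy2⟩, (h.isBlocked_inner hp hy1 hy2).not.1 hzb⟩, rfl⟩
    · by_cases hz2 : z ≤ p + 1
      · refine (hzb ?_).elim
        have := h.isBlocked_left (x := z - 1) (by omega) (by omega)
        rwa [Nat.sub_add_cancel hz.1] at this
      · obtain ⟨x, rfl⟩ : ∃ x, z = x + 2 * m := ⟨z - 2 * m, by omega⟩
        exact .inr ⟨x, ⟨⟨by omega, (h.isBlocked_right (by omega)).not.1 hzb⟩, by omega⟩, rfl⟩
  · rintro (⟨y, ⟨⟨hy1, hy2⟩, hy⟩, rfl⟩ | ⟨x, ⟨⟨hx1, hx⟩, hpx⟩, rfl⟩)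
    · refine ⟨?_, (h.isBlocked_inner hp hy1 hy2).not.2 hy⟩
      simp only [innerMap]
      split_ifs <;> omega
    · exact ⟨by omega, (h.isBlocked_right hpx).not.2 hx⟩

lemma mem_connectedTopCycleFreeDiagrams {n : ℕ} {C : Finset Chord} :
    C ∈ connectedTopCycleFreeDiagrams n ↔ C ∈ connectedDiagrams n ∧ IsTopCycleFree C := by
  classical
  rw [connectedTopCycleFreeDiagrams, Finset.mem_filter]

lemma isTopCycleFree_single : IsTopCycleFree {((1, 2) : Chord)} := by
  rw [isTopCycleFree_iff (isDiagram_one_iff.2 rfl).isMatching]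
  rintro r hr ⟨d, hd, -, -, h, -⟩
  rw [Finset.mem_singleton] at hr hd
  subst hr hd
  exact lt_irrefl _ h.1

lemma openPositions_single : openPositions 1 {((1, 2) : Chord)} = {1} := by
  ext x
  rw [mem_openPositions, Finset.mem_singleton]
  constructor
  · rintro ⟨h, -⟩
    omega
  · rintro rfl
    refine ⟨by omega, ?_⟩
    rintro ⟨d, hd, e, he, -, -, h, -⟩
    rw [Finset.mem_singleton] at hd he
    subst hd he
    exact lt_irrefl _ h

/-- Summation over connected top-cycle-free diagrams along the root-share decomposition. -/
lemma sum_connectedTopCycleFreeDiagrams {M : Type*} [AddCommMonoid M] {n : ℕ} (hn : 2 ≤ n)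
    (g : Finset Chord → M) :
    ∑ D ∈ connectedTopCycleFreeDiagrams n, g D = ∑ km ∈ Finset.HasAntidiagonal.antidiagonal n,
      ∑ K ∈ connectedTopCycleFreeDiagrams km.1, ∑ C ∈ connectedTopCycleFreeDiagrams km.2,
        ∑ p ∈ openPositions km.1 K, g (insertDiagram K p C) := by
  classical
  rw [connectedTopCycleFreeDiagrams, Finset.sum_filter, sum_connectedDiagrams hn]
  refine Finset.sum_congr rfl fun km _ => ?_
  rw [connectedTopCycleFreeDiagrams, Finset.sum_filter]
  refine Finset.sum_congr rfl fun K hK => ?_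
  rw [connectedTopCycleFreeDiagrams, Finset.sum_filter]
  rw [mem_connectedDiagrams] at hK
  have key : ∀ C ∈ connectedDiagrams km.2, ∀ p ∈ Finset.Ico 1 (2 * km.1),
      (IsTopCycleFree (insertDiagram K p C) ↔
        IsTopCycleFree K ∧ IsTopCycleFree C ∧ ¬ IsBlocked K p) := by
    intro C hC p hp
    rw [mem_connectedDiagrams] at hC
    rw [Finset.mem_Ico] at hp
    exact IsInsertion.isTopCycleFree_iff ⟨hK.1, hK.2, hC.1, hC.2, hp.1, hp.2⟩
  by_cases hKf : IsTopCycleFree K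
  · rw [if_pos hKf]
    refine Finset.sum_congr rfl fun C hC => ?_
    by_cases hCf : IsTopCycleFree C
    · rw [if_pos hCf, openPositions, Finset.sum_filter]
      refine Finset.sum_congr rfl fun p hp => ?_
      simp only [key C hC p hp, hKf, hCf, true_and]
    · rw [if_neg hCf]
      exact Finset.sum_eq_zero fun p hp => if_neg fun H => hCf ((key C hC p hp).1 H).2.1
  · rw [if_neg hKf]
    exact Finset.sum_eq_zero fun C hC => Finset.sum_eq_zero fun p hp =>
      if_neg fun H => hKf ((key C hC p hp).1 H).1

/-! ### Coefficientwise operators and composition of power series -/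

section Algebra

variable {B : Type*} [CommRing B]

/-- The action of an additive map on the coefficients of a power series. -/
noncomputable def coeffMap (T : B →+ B) : B⟦X⟧ →+ B⟦X⟧ where
  toFun G := PowerSeries.mk fun n => T (PowerSeries.coeff n G)
  map_zero' := by ext; simp
  map_add' _ _ := by ext; simp

@[simp]
lemma coeff_coeffMap (T : B →+ B) (G : B⟦X⟧) (n : ℕ) :
    PowerSeries.coeff n (coeffMap T G) = T (PowerSeries.coeff n G) :=
  PowerSeries.coeff_mk n fun n => T (PowerSeries.coeff n G)

lemma coeffMap_X_mul (T : B →+ B) (G : B⟦X⟧) :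
    coeffMap T (PowerSeries.X * G) = PowerSeries.X * coeffMap T G := by
  ext n
  cases n <;> simp [PowerSeries.coeff_succ_X_mul]

lemma coeffMap_C (T : B →+ B) (b : B) :
    coeffMap T (PowerSeries.C b) = PowerSeries.C (T b) := by
  ext n
  rw [coeff_coeffMap, PowerSeries.coeff_C, PowerSeries.coeff_C]
  split_ifs <;> simp

/-- Any identity `T (a * b) = S a * U b + V a * W b` passes to coefficients of power series. -/
lemma coeffMap_mul {T S U V W : B →+ B} {F G : B⟦X⟧}
    (h : ∀ i j, T (PowerSeries.coeff i F * PowerSeries.coeff j G) =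
      S (PowerSeries.coeff i F) * U (PowerSeries.coeff j G) +
        V (PowerSeries.coeff i F) * W (PowerSeries.coeff j G)) :
    coeffMap T (F * G) = coeffMap S F * coeffMap U G + coeffMap V F * coeffMap W G := by
  ext n
  simp only [coeff_coeffMap, PowerSeries.coeff_mul, map_add, map_sum, h, Finset.sum_add_distrib]

/-- The composition `∑ k, φ_k u ^ k`, for `u` without constant term. -/
noncomputable def compo (φ : ℕ → B) (u : B⟦X⟧) : B⟦X⟧ :=
  PowerSeries.mk fun n => ∑ k ∈ Finset.range (n + 1), φ k * PowerSeries.coeff n (u ^ k)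

lemma coeff_pow_eq_zero {u : B⟦X⟧} (hu : PowerSeries.constantCoeff u = 0) {n k : ℕ} (h : n < k) :
    PowerSeries.coeff n (u ^ k) = 0 := by
  have h1 : PowerSeries.X ^ k ∣ u ^ k := pow_dvd_pow_of_dvd (PowerSeries.X_dvd_iff.2 hu) k
  exact PowerSeries.X_pow_dvd_iff.1 h1 n h

lemma coeff_compo {u : B⟦X⟧} (hu : PowerSeries.constantCoeff u = 0) (φ : ℕ → B) {n N : ℕ}
    (h : n ≤ N) : PowerSeries.coeff n (compo φ u) =
      PowerSeries.coeff n (∑ k ∈ Finset.range (N + 1), PowerSeries.C (φ k) * u ^ k) := by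
  rw [compo, PowerSeries.coeff_mk, map_sum]
  simp only [PowerSeries.coeff_C_mul]
  refine Finset.sum_subset (Finset.range_mono (by omega)) fun k _ hk => ?_
  rw [Finset.mem_range] at hk
  rw [coeff_pow_eq_zero hu (by omega), mul_zero]

lemma coeff_mul_congr {F F' G : B⟦X⟧} {n : ℕ}
    (h : ∀ i ≤ n, PowerSeries.coeff i F = PowerSeries.coeff i F') :
    PowerSeries.coeff n (F * G) = PowerSeries.coeff n (F' * G) := by
  rw [PowerSeries.coeff_mul, PowerSeries.coeff_mul]
  refine Finset.sum_congr rfl fun x hx => ?_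
  rw [Finset.HasAntidiagonal.mem_antidiagonal] at hx
  rw [h _ (by omega)]

lemma compo_eq_add {u : B⟦X⟧} (hu : PowerSeries.constantCoeff u = 0) (φ : ℕ → B) :
    compo φ u = PowerSeries.C (φ 0) + u * compo (fun k => φ (k + 1)) u := by
  ext n
  rw [coeff_compo hu φ (Nat.le_succ n), Finset.sum_range_succ', map_add, map_add, add_comm,
    pow_zero, mul_one, mul_comm u, coeff_mul_congr fun i hi => coeff_compo hu _ hi,
    Finset.sum_mul]
  congr 3
  funext k
  ring

/-- The chain rule for a derivation of the coefficient ring. -/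
lemma coeffMap_compo {T : B →+ B} (hT : ∀ a b, T (a * b) = T a * b + a * T b) {u : B⟦X⟧}
    (hu : PowerSeries.constantCoeff u = 0) (φ : ℕ → B) :
    coeffMap T (compo φ u) = compo (fun k => T (φ k)) u +
      compo (fun k => (k + 1) * φ (k + 1)) u * coeffMap T u := by
  have hmul : ∀ F G : B⟦X⟧, coeffMap T (F * G) = coeffMap T F * G + F * coeffMap T G := by
    intro F G
    have hid : ∀ F : B⟦X⟧, coeffMap (AddMonoidHom.id B) F = F := fun F => by ext; simp
    have := coeffMap_mul (T := T) (S := T) (U := AddMonoidHom.id B) (V := AddMonoidHom.id B)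
      (W := T) (F := F) (G := G) fun i j => hT _ _
    rwa [hid, hid] at this
  have hone : coeffMap T 1 = 0 := by
    have := hmul 1 1
    simpa using this
  have hpow : ∀ k : ℕ, coeffMap T (u ^ (k + 1)) =
      PowerSeries.C ((k : B) + 1) * u ^ k * coeffMap T u := by
    intro k
    induction k with
    | zero => simp
    | succ k ih =>
      rw [pow_succ, hmul, ih]
      push_cast
      simp only [map_add, map_one, pow_succ]
      ring
  have hu' : PowerSeries.constantCoeff (coeffMap T u) = 0 := by
    rw [← PowerSeries.coeff_zero_eq_constantCoeff_apply, coeff_coeffMap,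
      PowerSeries.coeff_zero_eq_constantCoeff_apply, hu, map_zero]
  ext n
  rw [coeff_coeffMap, coeff_compo hu φ (Nat.le_succ n), map_add,
    coeff_compo hu _ (Nat.le_succ n), coeff_mul_congr fun i hi => coeff_compo hu _ hi,
    ← coeff_coeffMap, ← map_add, map_sum, Finset.sum_mul]
  congr 1
  simp only [hmul, coeffMap_C, Finset.sum_add_distrib]
  congr 1
  rw [Finset.sum_range_succ', pow_zero, hone, mul_zero, add_zero]
  refine Finset.sum_congr rfl fun k _ => ?_
  rw [hpow, map_mul]
  ring

lemma map_compo {B' : Type*} [CommRing B'] (f : B →+* B') (φ : ℕ → B) (u : B⟦X⟧) :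
    PowerSeries.map f (compo φ u) = compo (fun k => f (φ k)) (PowerSeries.map f u) := by
  ext n
  simp [compo, ← map_pow]

lemma compo_zero (φ : ℕ → B) : compo φ 0 = PowerSeries.C (φ 0) := by
  rw [compo_eq_add (map_zero _)]
  simp

/-- The initial condition satisfied by both sides of a tree-like equation. -/
lemma map_compo_of_map_eq_zero {B' : Type*} [CommRing B'] (f : B →+* B') (φ : ℕ → B) {u : B⟦X⟧}
    (hu : PowerSeries.map f u = 0) :
    PowerSeries.map f (compo φ u) = PowerSeries.map f (PowerSeries.C (φ 0)) := by
  rw [map_compo, hu, compo_zero, PowerSeries.map_C]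

/-- If `H` satisfies the transport equation `∂ H = ℓ(H) D H`, with `D` the derivation shifting the
argument of `φ`, then `H = x φ(L H)`.  Indeed the difference of the two sides satisfies the same
transport equation with initial value zero. -/
lemma eq_X_mul_compo_of_transport {B' : Type*} [CommRing B'] {d D L l : B →+ B} {ev : B →+* B'}
    {φ : ℕ → B} (hd : ∀ a b, d (a * b) = d a * b + a * d b)
    (hD : ∀ a b, D (a * b) = D a * b + a * D b) (hdφ : ∀ k, d (φ k) = 0)
    (hDφ : ∀ k : ℕ, D (φ k) = (k + 1) * φ (k + 1)) (hdL : ∀ b, d (L b) = L (d b) + l b)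
    (hDL : ∀ b, D (L b) = L (D b)) (hLl : ∀ a b, L (l a * b) = l a * L b)
    (hev : ∀ b, ev (L b) = 0) (hinj : ∀ b, d b = 0 → ev b = 0 → b = 0) {H : B⟦X⟧}
    (h0 : PowerSeries.constantCoeff H = 0) (hH : coeffMap d H = coeffMap l H * coeffMap D H)
    (hevH : PowerSeries.map ev H = PowerSeries.map ev (PowerSeries.X * PowerSeries.C (φ 0))) :
    H = PowerSeries.X * compo φ (coeffMap L H) := by
  set u := coeffMap L H with hu_def
  have hu : PowerSeries.constantCoeff u = 0 := by
    rw [hu_def, ← PowerSeries.coeff_zero_eq_constantCoeff_apply, coeff_coeffMap,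
      PowerSeries.coeff_zero_eq_constantCoeff_apply, h0, map_zero]
  set A := coeffMap l H with hA
  have hA0 : PowerSeries.coeff 0 A = 0 := by
    rw [hA, coeff_coeffMap, PowerSeries.coeff_zero_eq_constantCoeff_apply, h0, map_zero]
  have hDu : coeffMap D u = coeffMap L (coeffMap D H) := by
    ext n
    simp [hu_def, hDL]
  have hdu : coeffMap d u = A * coeffMap D u + A := by
    rw [hDu]
    have h1 : coeffMap d u = coeffMap L (coeffMap d H) + A := by
      ext n
      simp [hu_def, hdL, hA]
    rw [h1, hH]
    congr 1
    ext n
    simp only [coeff_coeffMap, PowerSeries.coeff_mul, map_sum]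
    refine Finset.sum_congr rfl fun x _ => ?_
    rw [hA, coeff_coeffMap, hLl]
  -- `E` vanishes degree by degree, as `A` has no constant term
  set E := H - PowerSeries.X * compo φ u with hE
  have hdE : coeffMap d E = A * coeffMap D E := by
    have z : compo (fun k => d (φ k)) u = 0 := by
      ext n
      simp [compo, hdφ]
    have z' : (fun k => D (φ k)) = fun k : ℕ => ((k : B) + 1) * φ (k + 1) := funext hDφ
    rw [hE, map_sub, map_sub, coeffMap_X_mul, coeffMap_X_mul, coeffMap_compo hd hu,
      coeffMap_compo hD hu, hH, hdu, z, z']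
    ring
  have hevE : PowerSeries.map ev E = 0 := by
    have hu0 : PowerSeries.map ev u = 0 := by
      ext n
      simp [hu_def, hev]
    rw [hE, map_sub, hevH, map_mul, map_mul, map_compo_of_map_eq_zero ev φ hu0, sub_self]
  have hE0 : ∀ n, PowerSeries.coeff n E = 0 := by
    intro n
    induction n using Nat.strong_induction_on with
    | _ n ih =>
      refine hinj _ ?_ ?_
      · rw [← coeff_coeffMap, hdE, PowerSeries.coeff_mul]
        refine Finset.sum_eq_zero fun x hx => ?_
        rw [Finset.HasAntidiagonal.mem_antidiagonal] at hx
        rcases Nat.eq_zero_or_pos x.1 with h | h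
        · rw [h, hA0, zero_mul]
        · rw [coeff_coeffMap D, ih x.2 (by omega), map_zero, mul_zero]
      · rw [← PowerSeries.coeff_map, hevE, map_zero]
  exact sub_eq_zero.1 (PowerSeries.ext hE0)

/-- A family `X_m` with `δ X_m = ∑_{i + j = m} X_{i + 1} ℓ(X_j)`, where `δ` is a divided
difference, satisfies `X₀ = x φ(L X₀)`.  More precisely, with `Ψ_a = ∑_k φ_{k + a} (L X₀)^k` one
has `X_m = x φ_m + x ∑_{i + j = m} Ψ_{i + 1} L X_j`, because the differences `E_m` of both sides
satisfy `δ E_m = ∑_{i + j = m} E_{i + 1} ℓ(X_j)` with initial value zero. -/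
lemma eq_X_mul_compo_of_dividedDifference {B' : Type*} [CommRing B'] {δ L l : B →+ B}
    {ev : B →+* B'} {φ : ℕ → B} (hδφ : ∀ k, δ (φ k) = 0) (hδL : ∀ b, δ (L b) = L (δ b) + l b)
    (hδ : ∀ a b, δ (a * L b) = a * δ (L b)) (hδl : ∀ a b, L (a * l b) = L a * l b)
    (hev : ∀ b, ev (L b) = 0) (hinj : ∀ b, δ b = 0 → ev b = 0 → b = 0) {X : ℕ → B⟦X⟧}
    (h0 : ∀ m, PowerSeries.constantCoeff (X m) = 0)
    (hX : ∀ m, coeffMap δ (X m) = ∑ x ∈ Finset.HasAntidiagonal.antidiagonal m,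
      X (x.1 + 1) * coeffMap l (X x.2))
    (hevX : ∀ m, PowerSeries.map ev (X m) =
      PowerSeries.map ev (PowerSeries.X * PowerSeries.C (φ m))) :
    X 0 = PowerSeries.X * compo φ (coeffMap L (X 0)) := by
  set u := coeffMap L (X 0) with hu_def
  have hu : PowerSeries.constantCoeff u = 0 := by
    rw [hu_def, ← PowerSeries.coeff_zero_eq_constantCoeff_apply, coeff_coeffMap,
      PowerSeries.coeff_zero_eq_constantCoeff_apply, h0, map_zero]
  set Ψ : ℕ → B⟦X⟧ := fun a => compo (fun k => φ (k + a)) u with hΨ_def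
  have hΨ : ∀ a, Ψ a = PowerSeries.C (φ a) + u * Ψ (a + 1) := by
    intro a
    have := compo_eq_add hu fun k => φ (k + a)
    rw [hΨ_def]
    dsimp only
    rw [this, zero_add]
    congr 4
    funext k
    congr 1
    omega
  have hl0 : ∀ m, PowerSeries.coeff 0 (coeffMap l (X m)) = 0 := by
    intro m
    rw [coeff_coeffMap, PowerSeries.coeff_zero_eq_constantCoeff_apply, h0, map_zero]
  set S : ℕ → B⟦X⟧ := fun m => ∑ x ∈ Finset.HasAntidiagonal.antidiagonal m,
    Ψ (x.1 + 1) * coeffMap L (X x.2) with hS_def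
  set E : ℕ → B⟦X⟧ := fun m => X m - PowerSeries.X * PowerSeries.C (φ m) - PowerSeries.X * S m
    with hE_def
  have hLX : ∀ m, coeffMap δ (coeffMap L (X m)) = ∑ x ∈ Finset.HasAntidiagonal.antidiagonal m,
      coeffMap L (X (x.1 + 1)) * coeffMap l (X x.2) + coeffMap l (X m) := by
    intro m
    have h1 : coeffMap δ (coeffMap L (X m)) = coeffMap L (coeffMap δ (X m)) + coeffMap l (X m) := by
      ext n
      simp [hδL]
    rw [h1, hX, map_sum]
    congr 1
    refine Finset.sum_congr rfl fun x _ => ?_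
    ext n
    simp only [coeff_coeffMap, PowerSeries.coeff_mul, map_sum, hδl]
  have hmulL : ∀ F G : B⟦X⟧, coeffMap δ (F * coeffMap L G) = F * coeffMap δ (coeffMap L G) := by
    intro F G
    ext n
    simp only [coeff_coeffMap, PowerSeries.coeff_mul, map_sum, hδ]
  -- the last summand of the sum defining `S (m + 1)` is split off
  have hS : ∀ m, S (m + 1) = Ψ (m + 2) * u + ∑ x ∈ Finset.HasAntidiagonal.antidiagonal m,
      Ψ (x.1 + 1) * coeffMap L (X (x.2 + 1)) := by
    intro m
    rw [hS_def]
    dsimp only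
    rw [Finset.Nat.antidiagonal_succ', Finset.sum_cons, Finset.sum_map]
    rfl
  -- the convolution of sequences is associative
  have hassoc : ∀ (m : ℕ) (P Q R : ℕ → B⟦X⟧),
      ∑ x ∈ Finset.HasAntidiagonal.antidiagonal m, P x.1 *
        ∑ y ∈ Finset.HasAntidiagonal.antidiagonal x.2, Q y.1 * R y.2 =
      ∑ x ∈ Finset.HasAntidiagonal.antidiagonal m,
        (∑ y ∈ Finset.HasAntidiagonal.antidiagonal x.1, P y.1 * Q y.2) * R x.2 := by
    intro m P Q R
    have := congrArg (PowerSeries.coeff m)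
      (mul_assoc (PowerSeries.mk P) (PowerSeries.mk Q) (PowerSeries.mk R))
    simp only [PowerSeries.coeff_mul, PowerSeries.coeff_mk] at this
    exact this.symm
  have hδE : ∀ m, coeffMap δ (E m) = ∑ x ∈ Finset.HasAntidiagonal.antidiagonal m,
      E (x.1 + 1) * coeffMap l (X x.2) := by
    intro m
    have e1 : coeffMap δ (S m) = ∑ x ∈ Finset.HasAntidiagonal.antidiagonal m,
        (∑ y ∈ Finset.HasAntidiagonal.antidiagonal x.1,
          Ψ (y.1 + 1) * coeffMap L (X (y.2 + 1)) + Ψ (x.1 + 1)) * coeffMap l (X x.2) := by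
      simp only [add_mul, Finset.sum_add_distrib]
      rw [← hassoc m (fun a => Ψ (a + 1)) (fun a => coeffMap L (X (a + 1)))
        fun a => coeffMap l (X a), ← Finset.sum_add_distrib, hS_def]
      dsimp only
      rw [map_sum]
      refine Finset.sum_congr rfl fun x _ => ?_
      rw [hmulL, hLX, mul_add]
    rw [hE_def]
    dsimp only
    rw [map_sub, map_sub, coeffMap_X_mul, coeffMap_X_mul, coeffMap_C, hδφ, map_zero, mul_zero,
      sub_zero, hX, e1, Finset.mul_sum, ← Finset.sum_sub_distrib]
    refine Finset.sum_congr rfl fun x _ => ?_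
    rw [hS, hΨ (x.1 + 1)]
    ring
  have hLev : ∀ G, PowerSeries.map ev (coeffMap L G) = 0 := by
    intro G
    ext n
    simp [hev]
  have hevE : ∀ m, PowerSeries.map ev (E m) = 0 := by
    intro m
    rw [hE_def]
    dsimp only
    rw [map_sub, map_sub, hevX, sub_self, zero_sub, map_mul, hS_def, map_sum, neg_eq_zero]
    refine mul_eq_zero_of_right _ (Finset.sum_eq_zero fun x _ => ?_)
    rw [map_mul, hLev, mul_zero]
  -- the `ℓ(X_j)` have no constant term, so coefficients of lower degree determine `δ E_m`
  have hE0 : ∀ n m, PowerSeries.coeff n (E m) = 0 := by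
    intro n
    induction n using Nat.strong_induction_on with
    | _ n ih =>
      intro m
      refine hinj _ ?_ ?_
      · rw [← coeff_coeffMap, hδE, map_sum]
        refine Finset.sum_eq_zero fun y _ => ?_
        rw [PowerSeries.coeff_mul]
        refine Finset.sum_eq_zero fun x hx => ?_
        rw [Finset.HasAntidiagonal.mem_antidiagonal] at hx
        rcases Nat.eq_zero_or_pos x.2 with h | h
        · rw [h, hl0, mul_zero]
        · rw [ih x.1 (by omega), zero_mul]
      · rw [← PowerSeries.coeff_map, hevE, map_zero]
  have h2 : E 0 = 0 := PowerSeries.ext fun n => hE0 n 0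
  have h3 : S 0 = Ψ 1 * u := by
    rw [hS_def]
    dsimp only
    rw [Finset.Nat.antidiagonal_zero, Finset.sum_singleton]
  have h4 : compo φ u = Ψ 0 := rfl
  rw [h4, hΨ 0, zero_add, mul_comm u, ← h3, mul_add, ← sub_eq_zero, ← h2, hE_def]
  ring

end Algebra

/-! ### The divided power case -/

/-- The sum of `W s` over all multisets `s` of size `m` of elements of `V`, computed by splitting
off the smallest element. -/
def chainSum {R : Type*} [CommRing R] : ℕ → Finset ℕ → (Multiset ℕ → R) → R
  | 0, _, W => W 0
  | m + 1, V, W => ∑ p ∈ V, chainSum m (V.filter (p ≤ ·)) fun s => W (p ::ₘ s)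

section ChainSum

variable {R : Type*} [CommRing R]

lemma chainSum_image {f : ℕ → ℕ} (hf : StrictMono f) (m : ℕ) (V : Finset ℕ)
    {W W' : Multiset ℕ → R} {a : R} (h : ∀ s, (∀ x ∈ s, x ∈ V) → W (s.map f) = a * W' s) :
    chainSum m (V.image f) W = a * chainSum m V W' := by
  induction m generalizing V W W' with
  | zero => exact h 0 (by simp)
  | succ m ih =>
    rw [chainSum, chainSum, Finset.sum_image hf.injective.injOn, Finset.mul_sum]
    refine Finset.sum_congr rfl fun p hp => ?_
    have e : (V.image f).filter (f p ≤ ·) = (V.filter (p ≤ ·)).image f := by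
      rw [Finset.filter_image]
      simp only [hf.le_iff_le]
    rw [e]
    refine ih _ fun s hs => ?_
    rw [← Multiset.map_cons]
    refine h _ fun x hx => ?_
    rcases Multiset.mem_cons.1 hx with rfl | hx
    exacts [hp, (Finset.mem_filter.1 (hs x hx)).1]

/-- Choosing a multiset of size `m` from a disjoint union means choosing one from each part. -/
lemma chainSum_union {f g : ℕ → ℕ} (hf : StrictMono f) (hg : StrictMono g) (m : ℕ)
    {U V : Finset ℕ} (hUV : ∀ x ∈ U, ∀ y ∈ V, f x < g y) {W W₁ W₂ : Multiset ℕ → R}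
    (h : ∀ s₁ s₂, (∀ x ∈ s₁, x ∈ U) → (∀ y ∈ s₂, y ∈ V) →
      W (s₁.map f + s₂.map g) = W₁ s₁ * W₂ s₂) :
    chainSum m (U.image f ∪ V.image g) W =
      ∑ x ∈ Finset.HasAntidiagonal.antidiagonal m, chainSum x.1 V W₂ * chainSum x.2 U W₁ := by
  induction m generalizing U W W₁ with
  | zero =>
    have := h 0 0 (by simp) (by simp)
    simpa [chainSum, mul_comm] using this
  | succ m ih =>
    have hdisj : Disjoint (U.image f) (V.image g) := by
      rw [Finset.disjoint_left]
      intro z hz hz'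
      obtain ⟨x, hx, rfl⟩ := Finset.mem_image.1 hz
      obtain ⟨y, hy, hxy⟩ := Finset.mem_image.1 hz'
      exact (hUV x hx y hy).ne' hxy
    rw [chainSum, Finset.sum_union hdisj, Finset.sum_image hf.injective.injOn,
      Finset.sum_image hg.injective.injOn, Finset.Nat.antidiagonal_succ', Finset.sum_cons,
      Finset.sum_map, add_comm]
    congr 1
    · dsimp only
      rw [chainSum, chainSum, Finset.sum_mul]
      refine Finset.sum_congr rfl fun p hp => ?_
      have e : (U.image f ∪ V.image g).filter (g p ≤ ·) = (V.filter (p ≤ ·)).image g := by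
        rw [Finset.filter_union, Finset.filter_image (s := V)]
        simp only [hg.le_iff_le]
        rw [Finset.filter_eq_empty_iff.2, Finset.empty_union]
        intro z hz
        obtain ⟨x, hx, rfl⟩ := Finset.mem_image.1 hz
        exact not_le.2 (hUV x hx p hp)
      rw [e, mul_comm]
      refine chainSum_image hg m _ fun s hs => ?_
      rw [← Multiset.map_cons]
      have := h 0 (p ::ₘ s) (by simp) fun x hx => ?_
      · simpa using this
      · rcases Multiset.mem_cons.1 hx with rfl | hx
        exacts [hp, (Finset.mem_filter.1 (hs x hx)).1]
    · have key : ∀ p ∈ U, chainSum m ((U.image f ∪ V.image g).filter (f p ≤ ·))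
          (fun s => W (f p ::ₘ s)) = ∑ x ∈ Finset.HasAntidiagonal.antidiagonal m,
            chainSum x.1 V W₂ * chainSum x.2 (U.filter (p ≤ ·)) fun s => W₁ (p ::ₘ s) := by
        intro p hp
        have e : (U.image f ∪ V.image g).filter (f p ≤ ·) =
            (U.filter (p ≤ ·)).image f ∪ V.image g := by
          rw [Finset.filter_union, Finset.filter_image (s := U)]
          simp only [hf.le_iff_le]
          rw [Finset.filter_true_of_mem (s := V.image g)]
          intro z hz
          obtain ⟨y, hy, rfl⟩ := Finset.mem_image.1 hz
          exact (hUV p hp y hy).le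
        rw [e]
        refine ih (fun x hx => hUV x (Finset.mem_filter.1 hx).1) fun s₁ s₂ h₁ h₂ => ?_
        rw [← Multiset.cons_add, ← Multiset.map_cons]
        refine h _ _ (fun x hx => ?_) h₂
        rcases Multiset.mem_cons.1 hx with rfl | hx
        exacts [hp, (Finset.mem_filter.1 (h₁ x hx)).1]
      rw [Finset.sum_congr rfl key, Finset.sum_comm]
      refine Finset.sum_congr rfl fun x _ => ?_
      rw [← Finset.mul_sum]
      rfl

lemma chainSum_singleton (m a : ℕ) (W : Multiset ℕ → R) :
    chainSum m {a} W = W (Multiset.replicate m a) := by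
  induction m generalizing W with
  | zero => rfl
  | succ m ih =>
    rw [chainSum, Finset.sum_singleton, Finset.filter_true_of_mem (by simp), ih,
      Multiset.replicate_succ]

/-- The sum of the weights of `C` over all ways to bump it `m` times at open positions. -/
noncomputable def openWeight (φ : ℕ → R) (m n : ℕ) (C : Finset Chord) : R :=
  chainSum m (openPositions n C) (bumpWeight φ C)

lemma openWeight_zero (φ : ℕ → R) (n : ℕ) (C : Finset Chord) :
    openWeight φ 0 n C = bumpWeight φ C 0 := rfl

lemma openWeight_single (φ : ℕ → R) (m : ℕ) : openWeight φ m 1 {(1, 2)} = φ m := by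
  rw [openWeight, openPositions_single, chainSum_singleton, bumpWeight_single, Multiset.card_replicate]
  exact fun x hx => Multiset.eq_of_mem_replicate hx

/-- Summed over all open insertion positions, the bumped weights are multiplicative. -/
lemma sum_openWeight_insertDiagram (φ : ℕ → R) (m : ℕ) {k n : ℕ} {K C : Finset Chord}
    (hK : K ∈ connectedDiagrams k) (hC : C ∈ connectedDiagrams n) :
    ∑ p ∈ openPositions k K, openWeight φ m (k + n) (insertDiagram K p C) =
      ∑ x ∈ Finset.HasAntidiagonal.antidiagonal m,
        openWeight φ (x.1 + 1) k K * openWeight φ x.2 n C := by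
  rw [mem_connectedDiagrams] at hK hC
  have key : ∀ p ∈ openPositions k K, openWeight φ m (k + n) (insertDiagram K p C) =
      ∑ x ∈ Finset.HasAntidiagonal.antidiagonal m,
        chainSum x.1 ((openPositions k K).filter (p ≤ ·)) (fun s => bumpWeight φ K (p ::ₘ s)) *
          openWeight φ x.2 n C := by
    intro p hp
    rw [mem_openPositions] at hp
    have h : IsInsertion k n K p C := ⟨hK.1, hK.2, hC.1, hC.2, hp.1.1, hp.1.2⟩
    rw [openWeight, h.openPositions_eq hp.2]
    refine chainSum_union innerMap_strictMono (fun x y hxy => Nat.add_lt_add_right hxy _) m ?_ ?_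
    · intro y hy x hx
      rw [mem_openPositions] at hy
      rw [Finset.mem_filter] at hx
      simp only [innerMap]
      split_ifs <;> omega
    · intro s₁ s₂ h₁ h₂
      rw [h.bumpWeight φ (fun y hy => (mem_openPositions.1 (h₁ y hy)).1)
        (fun x hx => (Finset.mem_filter.1 (h₂ x hx)).2), mul_comm]
  rw [Finset.sum_congr rfl key, Finset.sum_comm]
  refine Finset.sum_congr rfl fun x _ => ?_
  rw [← Finset.sum_mul]
  rfl

end ChainSum

variable {K : Type*} [Field K]

/-- The functional `p ↦ (coefficient of y in L p)`, with values in the constant polynomials. -/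
noncomputable def linearPart {R : Type*} [CommRing R] (L : R[X] →+ R[X]) : R[X] →+ R[X] :=
  (Polynomial.C : R →+* R[X]).toAddMonoidHom.comp
    ((Polynomial.lcoeff R 1).toAddMonoidHom.comp L)

lemma linearPart_apply {R : Type*} [CommRing R] (L : R[X] →+ R[X]) (p : R[X]) :
    linearPart L p = Polynomial.C ((L p).coeff 1) := rfl

lemma iterate_divX_X_pow {i n : ℕ} (h : i ≤ n) :
    Polynomial.divX^[i] (Polynomial.X ^ n : K[X]) = Polynomial.X ^ (n - i) := by
  induction i with
  | zero => rfl
  | succ i ih =>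
    rw [Function.iterate_succ_apply', ih (by omega), Polynomial.divX_X_pow, if_neg (by omega)]
    congr 1

namespace DividedPowerSpecifies

variable {F : K⟦X⟧} {L : K[X] →ₗ[K] K[X]} (h : DividedPowerSpecifies F L)
include h

lemma apply_X_pow (n : ℕ) : L (Polynomial.X ^ n) = Polynomial.X * ∑ i ∈ Finset.range (n + 1),
    PowerSeries.coeff i F • (Polynomial.X ^ (n - i) : K[X]) := by
  rw [h n]
  congr 1
  refine Finset.sum_congr rfl fun i hi => ?_
  rw [iterate_divX_X_pow (by simpa [Nat.lt_succ_iff] using hi)]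

lemma coeff_zero (p : K[X]) : (L p).coeff 0 = 0 := by
  induction p using Polynomial.induction_on' with
  | add p q hp hq => rw [map_add, Polynomial.coeff_add, hp, hq, add_zero]
  | monomial n a =>
    rw [← Polynomial.C_mul_X_pow_eq_monomial, ← Polynomial.smul_eq_C_mul, map_smul, h.apply_X_pow]
    simp

lemma coeff_one (n : ℕ) : (L (Polynomial.X ^ n)).coeff 1 = PowerSeries.coeff n F := by
  rw [h.apply_X_pow, Polynomial.coeff_X_mul, Polynomial.finsetSum_coeff,
    Finset.sum_eq_single_of_mem n (by simp)]
  · simp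
  · intro i hi hin
    rw [Finset.mem_range] at hi
    rw [Polynomial.coeff_smul, Polynomial.coeff_X_pow, if_neg (by omega), smul_zero]

/-- The cocycle condition for a divided power operator, as a commutation rule with `δ/δy`. -/
lemma divX_apply (p : K[X]) :
    (L p).divX = L p.divX + Polynomial.C ((L p).coeff 1) := by
  induction p using Polynomial.induction_on' with
  | add p q hp hq =>
    rw [map_add, Polynomial.divX_add, hp, hq, Polynomial.divX_add, map_add, Polynomial.coeff_add,
      Polynomial.C_add]
    ring
  | monomial n a =>
    have hn : (L (Polynomial.X ^ n)).divX = L (Polynomial.X ^ n : K[X]).divX +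
        Polynomial.C ((L (Polynomial.X ^ n)).coeff 1) := by
      rw [h.coeff_one, h.apply_X_pow, mul_comm, Polynomial.divX_X_pow]
      have e : ∀ q : K[X], (q * Polynomial.X).divX = q := by
        intro q
        ext j
        rw [Polynomial.coeff_divX, Polynomial.coeff_mul_X]
      rw [e, Finset.sum_range_succ, Nat.sub_self, pow_zero, Polynomial.smul_eq_C_mul, mul_one]
      congr 1
      cases n with
      | zero => simp
      | succ n =>
        rw [if_neg (Nat.succ_ne_zero n), Nat.succ_sub_one, h.apply_X_pow, Finset.mul_sum]
        refine Finset.sum_congr rfl fun i hi => ?_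
        rw [Finset.mem_range] at hi
        rw [mul_smul_comm, ← pow_succ', Nat.succ_sub (by omega)]
    rw [← Polynomial.C_mul_X_pow_eq_monomial, Polynomial.divX_C_mul, ← Polynomial.smul_eq_C_mul,
      ← Polynomial.smul_eq_C_mul, map_smul, map_smul, Polynomial.smul_eq_C_mul,
      Polynomial.divX_C_mul, hn, Polynomial.coeff_C_mul, Polynomial.C_mul,
      Polynomial.smul_eq_C_mul, mul_add]

end DividedPowerSpecifies

/-- The generating function of the connected top-cycle-free diagrams with `m` bumps at open
positions. -/
noncomputable def openSeries (φ F : K⟦X⟧) (m : ℕ) : K[X]⟦X⟧ :=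
  PowerSeries.mk fun n => ∑ C ∈ connectedTopCycleFreeDiagrams n,
    Polynomial.C (fWeight F C * openWeight (fun i => PowerSeries.coeff i φ) m n C) *
      Polynomial.X ^ (t C 1 - 1)

lemma connectedTopCycleFreeDiagrams_zero : connectedTopCycleFreeDiagrams 0 = ∅ := by
  refine Finset.eq_empty_of_forall_notMem fun C hC => ?_
  rw [mem_connectedTopCycleFreeDiagrams, connectedDiagrams_zero] at hC
  exact absurd hC.1 (Finset.notMem_empty C)

lemma connectedTopCycleFreeDiagrams_one : connectedTopCycleFreeDiagrams 1 = {{(1, 2)}} := by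
  refine Finset.ext fun C => ?_
  rw [mem_connectedTopCycleFreeDiagrams, connectedDiagrams_one, Finset.mem_singleton,
    and_iff_left_iff_imp]
  rintro rfl
  exact isTopCycleFree_single

lemma coeff_openSeries (φ F : K⟦X⟧) (m n : ℕ) : PowerSeries.coeff n (openSeries φ F m) =
    ∑ C ∈ connectedTopCycleFreeDiagrams n,
      Polynomial.C (fWeight F C * openWeight (fun i => PowerSeries.coeff i φ) m n C) *
        Polynomial.X ^ (t C 1 - 1) := PowerSeries.coeff_mk _ _

lemma coeff_zero_openSeries (φ F : K⟦X⟧) (m : ℕ) :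
    PowerSeries.coeff 0 (openSeries φ F m) = 0 := by
  rw [coeff_openSeries, connectedTopCycleFreeDiagrams_zero, Finset.sum_empty]

lemma coeff_one_openSeries (φ F : K⟦X⟧) (m : ℕ) :
    PowerSeries.coeff 1 (openSeries φ F m) = Polynomial.C (PowerSeries.coeff m φ) := by
  rw [coeff_openSeries, connectedTopCycleFreeDiagrams_one, Finset.sum_singleton, fWeight_single,
    openWeight_single, t_single, one_mul, pow_zero, mul_one]

lemma coeff_openSeries_of_two_le (φ F : K⟦X⟧) (m : ℕ) {n : ℕ} (hn : 2 ≤ n) :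
    PowerSeries.coeff n (openSeries φ F m) = ∑ km ∈ Finset.HasAntidiagonal.antidiagonal n,
      ∑ D ∈ connectedTopCycleFreeDiagrams km.1, ∑ C ∈ connectedTopCycleFreeDiagrams km.2,
        Polynomial.C (fWeight F D * (fWeight F C * PowerSeries.coeff (t C 1 - 1) F) *
          ∑ x ∈ Finset.HasAntidiagonal.antidiagonal m,
            openWeight (fun i => PowerSeries.coeff i φ) (x.1 + 1) km.1 D *
              openWeight (fun i => PowerSeries.coeff i φ) x.2 km.2 C) *
        Polynomial.X ^ (t D 1) := by
  rw [coeff_openSeries, sum_connectedTopCycleFreeDiagrams hn]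
  refine Finset.sum_congr rfl fun km hkm => Finset.sum_congr rfl fun D hD =>
    Finset.sum_congr rfl fun C hC => ?_
  rw [Finset.HasAntidiagonal.mem_antidiagonal] at hkm
  rw [mem_connectedTopCycleFreeDiagrams] at hD hC
  rw [← sum_openWeight_insertDiagram _ _ hD.1 hC.1, Finset.mul_sum, map_sum, Finset.sum_mul]
  rw [mem_connectedDiagrams] at hD hC
  refine Finset.sum_congr rfl fun p hp => ?_
  rw [mem_openPositions] at hp
  have h : IsInsertion km.1 km.2 D p C := ⟨hD.1.1, hD.1.2, hC.1.1, hC.1.2, hp.1.1, hp.1.2⟩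
  rw [h.fWeight_insert, h.t_one, Nat.add_sub_cancel, hkm]

/-- The root-share decomposition as an equation for generating functions. -/
lemma divX_openSeries {φ F : K⟦X⟧} {L : K[X] →ₗ[K] K[X]} (hL : DividedPowerSpecifies F L) (m : ℕ) :
    coeffMap Polynomial.divX_hom (openSeries φ F m) =
      ∑ x ∈ Finset.HasAntidiagonal.antidiagonal m, openSeries φ F (x.1 + 1) *
        coeffMap (linearPart L.toAddMonoidHom) (openSeries φ F x.2) := by
  have hlin : ∀ (j n : ℕ), linearPart L.toAddMonoidHom (PowerSeries.coeff n (openSeries φ F j)) =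
      ∑ C ∈ connectedTopCycleFreeDiagrams n, Polynomial.C (fWeight F C *
        openWeight (fun i => PowerSeries.coeff i φ) j n C * PowerSeries.coeff (t C 1 - 1) F) := by
    intro j n
    rw [coeff_openSeries, map_sum]
    refine Finset.sum_congr rfl fun C _ => ?_
    rw [linearPart_apply, LinearMap.toAddMonoidHom_coe, ← Polynomial.smul_eq_C_mul, map_smul,
      Polynomial.coeff_smul, hL.coeff_one, smul_eq_mul]
  ext1 n
  rw [coeff_coeffMap, map_sum, Polynomial.divX_hom_toFun]
  simp only [PowerSeries.coeff_mul, coeff_coeffMap]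
  rcases (by omega : n = 0 ∨ n = 1 ∨ 2 ≤ n) with rfl | rfl | hn
  · rw [coeff_zero_openSeries, Polynomial.divX_zero]
    refine (Finset.sum_eq_zero fun x _ => ?_).symm
    simp [coeff_zero_openSeries]
  · rw [coeff_one_openSeries, Polynomial.divX_C]
    refine (Finset.sum_eq_zero fun x _ => ?_).symm
    simp [Finset.Nat.antidiagonal_succ, coeff_zero_openSeries]
  · rw [coeff_openSeries_of_two_le φ F m hn, Finset.sum_comm]
    have hsum : ∀ {ι : Type} (s : Finset ι) (g : ι → K[X]),
        (∑ i ∈ s, g i).divX = ∑ i ∈ s, (g i).divX := fun s g => map_sum Polynomial.divX_hom g s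
    rw [hsum]
    refine Finset.sum_congr rfl fun km _ => ?_
    simp only [hlin, coeff_openSeries φ F _ km.1, Finset.sum_mul_sum]
    rw [hsum, Finset.sum_comm]
    refine Finset.sum_congr rfl fun D hD => ?_
    rw [hsum, Finset.sum_comm]
    refine Finset.sum_congr rfl fun C _ => ?_
    rw [mem_connectedTopCycleFreeDiagrams, mem_connectedDiagrams] at hD
    have ht := one_le_t hD.1.1 hD.1.2
    rw [Polynomial.divX_C_mul_X_pow, if_neg (by omega), Finset.mul_sum, map_sum, Finset.sum_mul]
    refine Finset.sum_congr rfl fun x _ => ?_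
    simp only [Polynomial.C_mul]
    ring

/-- The generating function of top-cycle-free diagrams satisfies the tree-like equation, before `L` is
applied to it. -/
lemma openSeries_eq {φ F : K⟦X⟧} {L : K[X] →ₗ[K] K[X]} (hL : DividedPowerSpecifies F L) :
    openSeries φ F 0 = PowerSeries.X * compo (fun i => Polynomial.C (PowerSeries.coeff i φ))
      (coeffMap L.toAddMonoidHom (openSeries φ F 0)) := by
  have hdiv : ∀ p : K[X], p.coeff 0 = 0 → ∀ a : K[X], (a * p).divX = a * p.divX := by
    intro p hp a
    have h1 : p = p.divX * Polynomial.X := by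
      conv_lhs => rw [← Polynomial.divX_mul_X_add p, hp, Polynomial.C_0, add_zero]
    have e : ∀ q : K[X], (q * Polynomial.X).divX = q := by
      intro q
      ext j
      rw [Polynomial.coeff_divX, Polynomial.coeff_mul_X]
    conv_lhs => rw [h1, ← mul_assoc, e]
  refine eq_X_mul_compo_of_dividedDifference (δ := Polynomial.divX_hom)
    (l := linearPart L.toAddMonoidHom) (ev := Polynomial.constantCoeff) (X := openSeries φ F)
    (fun k => Polynomial.divX_C _) hL.divX_apply (fun a b => hdiv _ (hL.coeff_zero b) a) ?_ ?_ ?_ ?_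
    (divX_openSeries hL) ?_
  · intro a b
    rw [linearPart_apply, mul_comm, mul_comm (L.toAddMonoidHom a), ← Polynomial.smul_eq_C_mul,
      ← Polynomial.smul_eq_C_mul]
    exact L.map_smul _ _
  · exact hL.coeff_zero
  · intro b h1 h2
    rw [← Polynomial.divX_mul_X_add b]
    rw [Polynomial.divX_hom_toFun] at h1
    rw [Polynomial.constantCoeff_apply] at h2
    rw [h1, h2, zero_mul, Polynomial.C_0, add_zero]
  · intro m
    rw [← PowerSeries.coeff_zero_eq_constantCoeff_apply, coeff_zero_openSeries]
  · intro m
    ext1 n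
    rw [PowerSeries.coeff_map, PowerSeries.coeff_map]
    rcases (by omega : n = 0 ∨ n = 1 ∨ 2 ≤ n) with rfl | rfl | hn
    · simp [coeff_zero_openSeries]
    · rw [coeff_one_openSeries, show 1 = 0 + 1 from rfl, PowerSeries.coeff_succ_X_mul]
      simp
    · obtain ⟨n, rfl⟩ : ∃ j, n = j + 1 := ⟨n - 1, by omega⟩
      rw [PowerSeries.coeff_succ_X_mul, PowerSeries.coeff_C, if_neg (by omega), map_zero,
        coeff_openSeries_of_two_le φ F m hn]
      simp only [map_sum]
      refine Finset.sum_eq_zero fun km _ => Finset.sum_eq_zero fun D hD =>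
        Finset.sum_eq_zero fun C _ => ?_
      rw [mem_connectedTopCycleFreeDiagrams, mem_connectedDiagrams] at hD
      have ht := one_le_t hD.1.1 hD.1.2
      rw [map_mul, map_pow, Polynomial.constantCoeff_apply Polynomial.X, Polynomial.coeff_X_zero,
        zero_pow (by omega), mul_zero]

/-! ### The binomial case -/

section Binomial

variable {K : Type*} [Field K]

lemma constr_basisMonomials_X_pow {R M : Type*} [CommRing R] [AddCommGroup M] [Module R M]
    (f : ℕ → M) (n : ℕ) :
    (Polynomial.basisMonomials R).constr R f (Polynomial.X ^ n) = f n := by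
  rw [← (Polynomial.basisMonomials R).constr_basis R f n, Polynomial.coe_basisMonomials]
  simp only [Polynomial.monomial_one_right_eq_X_pow]

lemma integral_X_pow (n : ℕ) : integral K (Polynomial.X ^ n) =
    ((n : K) + 1)⁻¹ • (Polynomial.X ^ (n + 1) : K[X]) :=
  constr_basisMonomials_X_pow _ n

lemma coeff_zero_integral (p : K[X]) : (integral K p).coeff 0 = 0 := by
  induction p using Polynomial.induction_on' with
  | add p q hp hq => rw [map_add, Polynomial.coeff_add, hp, hq, add_zero]
  | monomial n a =>
    rw [← Polynomial.C_mul_X_pow_eq_monomial, ← Polynomial.smul_eq_C_mul, map_smul, integral_X_pow]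
    simp

lemma derivative_integral [CharZero K] (p : K[X]) : (integral K p).derivative = p := by
  induction p using Polynomial.induction_on' with
  | add p q hp hq => rw [map_add, map_add, hp, hq]
  | monomial n a =>
    have hn : (n : K) + 1 ≠ 0 := by exact_mod_cast Nat.succ_ne_zero n
    rw [← Polynomial.C_mul_X_pow_eq_monomial, ← Polynomial.smul_eq_C_mul, map_smul, map_smul,
      integral_X_pow, map_smul, Polynomial.derivative_X_pow, Nat.add_sub_cancel,
      ← Polynomial.smul_eq_C_mul, smul_smul]
    push_cast
    rw [smul_smul, mul_assoc, inv_mul_cancel₀ hn, mul_one]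

lemma coeff_one_eq (p : K[X]) : p.coeff 1 = p.derivative.coeff 0 := by
  rw [Polynomial.coeff_derivative]
  simp

lemma eq_of_derivative_eq {R : Type*} [CommRing R] [IsDomain R] [CharZero R] {p q : R[X]}
    (h : p.derivative = q.derivative) (h0 : p.coeff 0 = q.coeff 0) : p = q := by
  have h1 : (p - q).derivative = 0 := by rw [map_sub, h, sub_self]
  have h2 := Polynomial.eq_C_of_derivative_eq_zero h1
  rw [Polynomial.coeff_sub, h0, sub_self, Polynomial.C_0] at h2
  exact sub_eq_zero.1 h2

lemma integral_derivative [CharZero K] (p : K[X]) :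
    integral K p.derivative = p - Polynomial.C (p.coeff 0) := by
  refine eq_of_derivative_eq ?_ ?_
  · rw [derivative_integral, map_sub, Polynomial.derivative_C, sub_zero]
  · rw [coeff_zero_integral]
    simp

namespace BinomialSpecifies

variable {F : K⟦X⟧} {L : K[X] →ₗ[K] K[X]} (h : BinomialSpecifies F L)
include h

lemma coeff_zero (p : K[X]) : (L p).coeff 0 = 0 := by
  induction p using Polynomial.induction_on' with
  | add p q hp hq => rw [map_add, Polynomial.coeff_add, hp, hq, add_zero]
  | monomial n a =>
    rw [← Polynomial.C_mul_X_pow_eq_monomial, ← Polynomial.smul_eq_C_mul, map_smul, h n,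
      Polynomial.coeff_smul, coeff_zero_integral, smul_zero]

variable [CharZero K]

lemma coeff_one (n : ℕ) :
    (L (Polynomial.X ^ n)).coeff 1 = n.factorial * PowerSeries.coeff n F := by
  rw [coeff_one_eq, h n, derivative_integral, Polynomial.finsetSum_coeff,
    Finset.sum_eq_single_of_mem n (by simp)]
  · rw [Polynomial.coeff_smul, Polynomial.coeff_iterate_derivative, zero_add,
      Polynomial.coeff_X_pow_self, Nat.descFactorial_self, nsmul_one, smul_eq_mul, mul_comm]
  · intro i _ hin
    rw [Polynomial.coeff_smul, Polynomial.coeff_iterate_derivative, zero_add,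
      Polynomial.coeff_X_pow, if_neg hin, smul_zero, smul_zero]

/-- The cocycle condition for a binomial operator, as a commutation rule with `d/dy`. -/
lemma derivative_apply_X_pow (n : ℕ) : (L (Polynomial.X ^ n)).derivative =
    L (Polynomial.X ^ n : K[X]).derivative + Polynomial.C ((L (Polynomial.X ^ n)).coeff 1) := by
  have key : L (Polynomial.X ^ n : K[X]).derivative =
      integral K (L (Polynomial.X ^ n)).derivative.derivative := by
    rw [h n, derivative_integral]
    cases n with
    | zero => simp
    | succ n =>
      have e : ∀ i, (PowerSeries.coeff i F •
          Polynomial.derivative^[i] (Polynomial.X ^ (n + 1) : K[X])).derivative =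
          ((n + 1 : ℕ) : K) •
            (PowerSeries.coeff i F • Polynomial.derivative^[i] (Polynomial.X ^ n : K[X])) := by
        intro i
        rw [map_smul, ← Function.iterate_succ_apply' (⇑Polynomial.derivative),
          Function.iterate_succ_apply, Polynomial.derivative_X_pow, Nat.add_sub_cancel,
          Polynomial.iterate_derivative_C_mul, ← Polynomial.smul_eq_C_mul, smul_comm]
      rw [Polynomial.derivative_X_pow, ← Polynomial.smul_eq_C_mul, map_smul, Nat.add_sub_cancel,
        h n, ← map_smul, map_sum, Finset.sum_congr rfl fun i _ => e i, ← Finset.smul_sum,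
        Finset.sum_range_succ _ (n + 1), Polynomial.iterate_derivative_eq_zero (x := n + 1)
          (by simp), smul_zero, add_zero]
  rw [key, integral_derivative, coeff_one_eq, sub_add_cancel]

end BinomialSpecifies

variable {R : Type*} [CommRing R] [Algebra K R]

/-- The `R`-linear extension of `L` to polynomials over `R`. -/
noncomputable def extendScalars (R : Type*) [CommRing R] [Algebra K R] (L : K[X] →ₗ[K] K[X]) :
    R[X] →ₗ[R] R[X] :=
  (Polynomial.basisMonomials R).constr R fun n => (L (Polynomial.X ^ n)).map (algebraMap K R)

lemma extendScalars_X_pow (L : K[X] →ₗ[K] K[X]) (n : ℕ) :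
    extendScalars R L (Polynomial.X ^ n) = (L (Polynomial.X ^ n)).map (algebraMap K R) :=
  constr_basisMonomials_X_pow _ n

lemma extendScalars_C_mul (L : K[X] →ₗ[K] K[X]) (a : R) (p : R[X]) :
    extendScalars R L (Polynomial.C a * p) = Polynomial.C a * extendScalars R L p := by
  rw [← Polynomial.smul_eq_C_mul, map_smul, Polynomial.smul_eq_C_mul]

lemma extendScalars_self (L : K[X] →ₗ[K] K[X]) : extendScalars K L = L := by
  refine Polynomial.lhom_ext' fun n => LinearMap.ext_ring ?_
  simp only [LinearMap.comp_apply, Polynomial.monomial_one_right_eq_X_pow]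
  rw [extendScalars_X_pow, Algebra.algebraMap_self, Polynomial.map_id]

lemma map_extendScalars {S : Type*} [CommRing S] [Algebra K S] (f : R →ₐ[K] S)
    (L : K[X] →ₗ[K] K[X]) (p : R[X]) :
    (extendScalars R L p).map (f : R →+* S) = extendScalars S L (p.map (f : R →+* S)) := by
  induction p using Polynomial.induction_on' with
  | add p q hp hq => rw [map_add, Polynomial.map_add, hp, hq, Polynomial.map_add, map_add]
  | monomial n a =>
    rw [← Polynomial.C_mul_X_pow_eq_monomial, extendScalars_C_mul, Polynomial.map_mul,
      Polynomial.map_mul, Polynomial.map_C, Polynomial.map_pow, Polynomial.map_X,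
      extendScalars_C_mul, extendScalars_X_pow, extendScalars_X_pow, Polynomial.map_map,
      f.comp_algebraMap]

/-- The coefficientwise action of a derivation of `R` on `R[X]`. -/
noncomputable def coeffDerivation {A : Type*} [CommRing A] [Algebra A R] (D : Derivation A R R) :
    Derivation A R[X] R[X] :=
  PolynomialModule.equivPolynomialSelf.compDer D.mapCoeffs

lemma coeffDerivation_C_mul_map {A : Type*} [CommRing A] [Algebra A R] (D : Derivation A R R)
    (a : R) (p : A[X]) : coeffDerivation D (Polynomial.C a * p.map (algebraMap A R)) =
      Polynomial.C (D a) * p.map (algebraMap A R) := by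
  ext n
  have : ∀ q : R[X], (coeffDerivation D q).coeff n = D (q.coeff n) := fun q => rfl
  rw [this, Polynomial.coeff_C_mul, Polynomial.coeff_C_mul, Polynomial.coeff_map, D.leibniz,
    D.map_algebraMap, smul_zero, zero_add, smul_eq_mul, mul_comm]

lemma coeffDerivation_C_mul_X_pow {A : Type*} [CommRing A] [Algebra A R] (D : Derivation A R R)
    (a : R) (n : ℕ) : coeffDerivation D (Polynomial.C a * Polynomial.X ^ n) =
      Polynomial.C (D a) * Polynomial.X ^ n := by
  have := coeffDerivation_C_mul_map D a (Polynomial.X ^ n)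
  rwa [Polynomial.map_pow, Polynomial.map_X] at this

/-- The generating function of the connected diagrams, with `y ^ i / i !` marking `t₁ = i + 1`. -/
noncomputable def connectedSeries (φ : ℕ → R) (F : K⟦X⟧) : R[X]⟦X⟧ :=
  PowerSeries.mk fun n => ∑ C ∈ connectedDiagrams n,
    Polynomial.C (algebraMap K R (fWeight F C * ((t C 1 - 1).factorial : K)⁻¹) *
      bumpWeight φ C 0) * Polynomial.X ^ (t C 1 - 1)

lemma coeff_connectedSeries (φ : ℕ → R) (F : K⟦X⟧) (n : ℕ) :
    PowerSeries.coeff n (connectedSeries φ F) = ∑ C ∈ connectedDiagrams n,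
      Polynomial.C (algebraMap K R (fWeight F C * ((t C 1 - 1).factorial : K)⁻¹) *
        bumpWeight φ C 0) * Polynomial.X ^ (t C 1 - 1) := PowerSeries.coeff_mk _ _

lemma coeff_zero_connectedSeries (φ : ℕ → R) (F : K⟦X⟧) :
    PowerSeries.coeff 0 (connectedSeries φ F) = 0 := by
  rw [coeff_connectedSeries, connectedDiagrams_zero, Finset.sum_empty]

lemma coeff_one_connectedSeries (φ : ℕ → R) (F : K⟦X⟧) :
    PowerSeries.coeff 1 (connectedSeries φ F) = Polynomial.C (φ 0) := by
  rw [coeff_connectedSeries, connectedDiagrams_one, Finset.sum_singleton, fWeight_single, t_single,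
    bumpWeight_single φ (by simp)]
  simp

lemma coeff_connectedSeries_of_two_le (φ : ℕ → R) (F : K⟦X⟧) {n : ℕ} (hn : 2 ≤ n) :
    PowerSeries.coeff n (connectedSeries φ F) = ∑ km ∈ Finset.HasAntidiagonal.antidiagonal n,
      ∑ D ∈ connectedDiagrams km.1, ∑ C ∈ connectedDiagrams km.2,
        Polynomial.C (algebraMap K R (fWeight F D * (fWeight F C * PowerSeries.coeff (t C 1 - 1) F) *
            ((t D 1).factorial : K)⁻¹) *
          ((∑ p ∈ Finset.Ico 1 (2 * km.1), bumpWeight φ D {p}) * bumpWeight φ C 0)) *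
        Polynomial.X ^ (t D 1) := by
  rw [coeff_connectedSeries, sum_connectedDiagrams hn]
  refine Finset.sum_congr rfl fun km hkm => Finset.sum_congr rfl fun D hD =>
    Finset.sum_congr rfl fun C hC => ?_
  rw [mem_connectedDiagrams] at hD hC
  rw [Finset.sum_mul, Finset.mul_sum, map_sum, Finset.sum_mul]
  refine Finset.sum_congr rfl fun p hp => ?_
  rw [Finset.mem_Ico] at hp
  have h : IsInsertion km.1 km.2 D p C := ⟨hD.1, hD.2, hC.1, hC.2, hp.1, hp.2⟩
  have hb := h.bumpWeight φ (s₁ := 0) (s₂ := 0) (by simp) (by simp)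
  rw [Multiset.map_zero, Multiset.map_zero, add_zero, Multiset.cons_zero] at hb
  rw [h.fWeight_insert, h.t_one, Nat.add_sub_cancel, hb]

/-- The root-share decomposition as a transport equation for the generating function. -/
lemma derivative_connectedSeries [CharZero K] {φ : ℕ → R} (D : Derivation K R R)
    (hφ : ∀ i, D (φ i) = (i + 1) * φ (i + 1)) {F : K⟦X⟧} {L : K[X] →ₗ[K] K[X]}
    (hL : BinomialSpecifies F L) :
    coeffMap Polynomial.derivative.toAddMonoidHom (connectedSeries φ F) =
      coeffMap (linearPart (extendScalars R L).toAddMonoidHom) (connectedSeries φ F) *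
        coeffMap (coeffDerivation D : R[X] →ₗ[K] R[X]).toAddMonoidHom (connectedSeries φ F) := by
  have hlin : ∀ n : ℕ, linearPart (extendScalars R L).toAddMonoidHom
      (PowerSeries.coeff n (connectedSeries φ F)) = ∑ C ∈ connectedDiagrams n,
        Polynomial.C (algebraMap K R (fWeight F C * PowerSeries.coeff (t C 1 - 1) F) *
          bumpWeight φ C 0) := by
    intro n
    rw [coeff_connectedSeries, map_sum]
    refine Finset.sum_congr rfl fun C _ => ?_
    have hf : ((t C 1 - 1).factorial : K) ≠ 0 := Nat.cast_ne_zero.2 (Nat.factorial_ne_zero _)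
    rw [linearPart_apply, LinearMap.toAddMonoidHom_coe, extendScalars_C_mul,
      Polynomial.coeff_C_mul, extendScalars_X_pow, Polynomial.coeff_map, hL.coeff_one,
      mul_right_comm, ← map_mul]
    have e : fWeight F C * ((t C 1 - 1).factorial : K)⁻¹ *
        ((t C 1 - 1).factorial * PowerSeries.coeff (t C 1 - 1) F) =
        fWeight F C * PowerSeries.coeff (t C 1 - 1) F := by
      field_simp
    rw [e]
  have hder : ∀ n : ℕ, (coeffDerivation D : R[X] →ₗ[K] R[X]).toAddMonoidHom
      (PowerSeries.coeff n (connectedSeries φ F)) = ∑ C ∈ connectedDiagrams n,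
        Polynomial.C (algebraMap K R (fWeight F C * ((t C 1 - 1).factorial : K)⁻¹) *
          ∑ p ∈ Finset.Ico 1 (2 * n), bumpWeight φ C {p}) * Polynomial.X ^ (t C 1 - 1) := by
    intro n
    rw [coeff_connectedSeries, map_sum]
    refine Finset.sum_congr rfl fun C hC => ?_
    rw [mem_connectedDiagrams] at hC
    rw [LinearMap.toAddMonoidHom_coe, Derivation.coeFn_coe, coeffDerivation_C_mul_X_pow, D.leibniz,
      D.map_algebraMap, smul_zero, add_zero, derivation_bumpWeight D hφ hC.1 hC.2, smul_eq_mul]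
  ext1 n
  rw [coeff_coeffMap, LinearMap.toAddMonoidHom_coe, mul_comm]
  simp only [PowerSeries.coeff_mul, coeff_coeffMap]
  rcases (by omega : n = 0 ∨ n = 1 ∨ 2 ≤ n) with rfl | rfl | hn
  · rw [coeff_zero_connectedSeries, map_zero]
    refine (Finset.sum_eq_zero fun x hx => ?_).symm
    rw [Finset.HasAntidiagonal.mem_antidiagonal] at hx
    rw [(by omega : x.1 = 0), coeff_zero_connectedSeries, map_zero, zero_mul]
  · rw [coeff_one_connectedSeries, Polynomial.derivative_C]
    refine (Finset.sum_eq_zero fun x hx => ?_).symm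
    rw [Finset.HasAntidiagonal.mem_antidiagonal] at hx
    rcases (by omega : x.1 = 0 ∨ x.2 = 0) with h | h <;>
      simp only [h, coeff_zero_connectedSeries, map_zero, mul_zero, zero_mul]
  · rw [coeff_connectedSeries_of_two_le φ F hn, map_sum]
    refine Finset.sum_congr rfl fun km _ => ?_
    rw [hlin, hder, Finset.sum_mul_sum, map_sum]
    refine Finset.sum_congr rfl fun C hC => ?_
    rw [map_sum]
    refine Finset.sum_congr rfl fun C' _ => ?_
    rw [mem_connectedDiagrams] at hC
    have ht := one_le_t hC.1 hC.2
    obtain ⟨j, hj⟩ : ∃ j, t C 1 = j + 1 := ⟨t C 1 - 1, by omega⟩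
    have hf : (j.factorial : K) ≠ 0 := Nat.cast_ne_zero.2 (Nat.factorial_ne_zero _)
    have hj1 : (j : K) + 1 ≠ 0 := by exact_mod_cast Nat.succ_ne_zero j
    rw [Polynomial.derivative_C_mul, Polynomial.derivative_X_pow, hj, Nat.add_sub_cancel,
      mul_left_comm, mul_comm, mul_right_comm _ (Polynomial.X ^ j), ← Polynomial.C_mul,
      mul_right_comm _ (Polynomial.X ^ j), ← Polynomial.C_mul, Nat.factorial_succ]
    congr 2
    have hcast : ((j + 1 : ℕ) : R) = algebraMap K R ((j : K) + 1) := by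
      push_cast
      rfl
    rw [hcast]
    have e : fWeight F C * (fWeight F C' * PowerSeries.coeff (t C' 1 - 1) F) *
        (((j + 1) * j.factorial : ℕ) : K)⁻¹ * ((j : K) + 1) =
        (fWeight F C * (j.factorial : K)⁻¹) *
          (fWeight F C' * PowerSeries.coeff (t C' 1 - 1) F) := by
      push_cast
      field_simp
    have e' := congrArg (algebraMap K R) e
    simp only [map_mul] at e' ⊢
    linear_combination ((∑ p ∈ Finset.Ico 1 (2 * km.1), bumpWeight φ C {p}) *
      bumpWeight φ C' 0) * e'

lemma map_connectedSeries {S : Type*} [CommRing S] [Algebra K S] (f : R →ₐ[K] S) (φ : ℕ → R)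
    (F : K⟦X⟧) : PowerSeries.map (Polynomial.mapRingHom (f : R →+* S)) (connectedSeries φ F) =
      connectedSeries (fun i => f (φ i)) F := by
  ext1 n
  rw [PowerSeries.coeff_map, coeff_connectedSeries, coeff_connectedSeries, map_sum]
  refine Finset.sum_congr rfl fun C _ => ?_
  rw [Polynomial.coe_mapRingHom, Polynomial.map_mul, Polynomial.map_C, Polynomial.map_pow,
    Polynomial.map_X, map_mul, map_bumpWeight]
  simp

/-- The tree-like equation, when `D` is a derivation shifting the argument of `φ`. -/
lemma connectedSeries_eq_of_derivation [CharZero K] [IsDomain R] {φ : ℕ → R} (D : Derivation K R R)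
    (hφ : ∀ i, D (φ i) = (i + 1) * φ (i + 1)) {F : K⟦X⟧} {L : K[X] →ₗ[K] K[X]}
    (hL : BinomialSpecifies F L) :
    connectedSeries φ F = PowerSeries.X * compo (fun i => Polynomial.C (φ i))
      (coeffMap (extendScalars R L).toAddMonoidHom (connectedSeries φ F)) := by
  have : CharZero R := charZero_of_injective_algebraMap (algebraMap K R).injective
  have hL0 : ∀ p : R[X], (extendScalars R L p).coeff 0 = 0 := by
    intro p
    induction p using Polynomial.induction_on' with
    | add p q hp hq => rw [map_add, Polynomial.coeff_add, hp, hq, add_zero]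
    | monomial n a =>
      rw [← Polynomial.C_mul_X_pow_eq_monomial, extendScalars_C_mul, extendScalars_X_pow,
        Polynomial.coeff_C_mul, Polynomial.coeff_map, hL.coeff_zero, map_zero, mul_zero]
  refine eq_X_mul_compo_of_transport (d := Polynomial.derivative.toAddMonoidHom)
    (D := (coeffDerivation D : R[X] →ₗ[K] R[X]).toAddMonoidHom)
    (L := (extendScalars R L).toAddMonoidHom)
    (l := linearPart (extendScalars R L).toAddMonoidHom) (ev := Polynomial.constantCoeff)
    (fun a b => Polynomial.derivative_mul) ?_ (fun k => Polynomial.derivative_C) ?_ ?_ ?_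
    (fun a b => extendScalars_C_mul L _ b) hL0
    (fun b h1 h2 => eq_of_derivative_eq (h1.trans (map_zero _).symm)
      (h2.trans (Polynomial.coeff_zero 0).symm)) ?_ (derivative_connectedSeries D hφ hL) ?_
  · intro a b
    rw [LinearMap.toAddMonoidHom_coe, Derivation.coeFn_coe, Derivation.leibniz, smul_eq_mul,
      smul_eq_mul, mul_comm b, add_comm]
  · intro k
    have := coeffDerivation_C_mul_X_pow D (φ k) 0
    rw [pow_zero, mul_one, mul_one, hφ] at this
    rw [LinearMap.toAddMonoidHom_coe, Derivation.coeFn_coe, this]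
    simp
  · intro b
    simp only [LinearMap.toAddMonoidHom_coe, linearPart_apply]
    induction b using Polynomial.induction_on' with
    | add p q hp hq =>
      simp only [map_add, hp, hq, Polynomial.coeff_add]
      ring
    | monomial n a =>
      have h1 : (Polynomial.X ^ n : R[X]).derivative =
          (Polynomial.X ^ n : K[X]).derivative.map (algebraMap K R) := by
        rw [← Polynomial.derivative_map, Polynomial.map_pow, Polynomial.map_X]
      have h2 : ∀ p : K[X], extendScalars R L (p.map (algebraMap K R)) =
          (L p).map (algebraMap K R) := by
        intro p
        have := map_extendScalars (Algebra.ofId K R) L p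
        rw [extendScalars_self] at this
        exact this.symm
      rw [← Polynomial.C_mul_X_pow_eq_monomial, extendScalars_C_mul, Polynomial.derivative_C_mul,
        Polynomial.derivative_C_mul, extendScalars_C_mul, extendScalars_X_pow,
        Polynomial.derivative_map, h1, h2, hL.derivative_apply_X_pow, Polynomial.coeff_C_mul,
        Polynomial.coeff_map, Polynomial.map_add, Polynomial.map_C, Polynomial.C_mul, mul_add]
  · intro b
    simp only [LinearMap.toAddMonoidHom_coe, Derivation.coeFn_coe]
    induction b using Polynomial.induction_on' with
    | add p q hp hq => simp only [map_add, hp, hq]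
    | monomial n a =>
      rw [← Polynomial.C_mul_X_pow_eq_monomial, extendScalars_C_mul, extendScalars_X_pow,
        coeffDerivation_C_mul_map, coeffDerivation_C_mul_X_pow, extendScalars_C_mul,
        extendScalars_X_pow]
  · rw [← PowerSeries.coeff_zero_eq_constantCoeff_apply, coeff_zero_connectedSeries]
  · ext1 n
    rw [PowerSeries.coeff_map, PowerSeries.coeff_map]
    rcases (by omega : n = 0 ∨ n = 1 ∨ 2 ≤ n) with rfl | rfl | hn
    · simp [coeff_zero_connectedSeries]
    · rw [coeff_one_connectedSeries, show 1 = 0 + 1 from rfl, PowerSeries.coeff_succ_X_mul]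
      simp
    · obtain ⟨n, rfl⟩ : ∃ j, n = j + 1 := ⟨n - 1, by omega⟩
      rw [PowerSeries.coeff_succ_X_mul, PowerSeries.coeff_C, if_neg (by omega), map_zero,
        coeff_connectedSeries_of_two_le φ F hn]
      simp only [map_sum]
      refine Finset.sum_eq_zero fun km _ => Finset.sum_eq_zero fun D hD =>
        Finset.sum_eq_zero fun C _ => ?_
      rw [mem_connectedDiagrams] at hD
      have ht := one_le_t hD.1 hD.2
      rw [map_mul, map_pow, Polynomial.constantCoeff_apply Polynomial.X, Polynomial.coeff_X_zero,
        zero_pow (by omega), mul_zero]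

/-- The tree-like equation in general.  It is the specialization of the case of indeterminate
coefficients `φ_i`, for which a derivation shifting the argument of `φ` exists. -/
lemma connectedSeries_eq [CharZero K] (φ : ℕ → K) {F : K⟦X⟧} {L : K[X] →ₗ[K] K[X]}
    (hL : BinomialSpecifies F L) :
    connectedSeries φ F = PowerSeries.X * compo (fun i => Polynomial.C (φ i))
      (coeffMap L.toAddMonoidHom (connectedSeries φ F)) := by
  have h := connectedSeries_eq_of_derivation (R := MvPolynomial ℕ K) (φ := MvPolynomial.X)
    (MvPolynomial.mkDerivation K fun i : ℕ => ((i : MvPolynomial ℕ K) + 1) * MvPolynomial.X (i + 1))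
    (fun i => MvPolynomial.mkDerivation_X K _ i) hL
  set f : MvPolynomial ℕ K →ₐ[K] K := MvPolynomial.aeval φ with hf
  have h' := congrArg (PowerSeries.map (Polynomial.mapRingHom (f : MvPolynomial ℕ K →+* K))) h
  rw [map_connectedSeries, map_mul, PowerSeries.map_X, map_compo] at h'
  have e1 : (fun i : ℕ => f (MvPolynomial.X i)) = φ := by
    funext i
    rw [hf, MvPolynomial.aeval_X]
  have e2 : PowerSeries.map (Polynomial.mapRingHom (f : MvPolynomial ℕ K →+* K))
      (coeffMap (extendScalars (MvPolynomial ℕ K) L).toAddMonoidHom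
        (connectedSeries MvPolynomial.X F)) =
      coeffMap L.toAddMonoidHom (connectedSeries φ F) := by
    have e3 := map_connectedSeries f MvPolynomial.X F
    rw [e1] at e3
    rw [← e3]
    ext1 n
    rw [PowerSeries.coeff_map, coeff_coeffMap, coeff_coeffMap, PowerSeries.coeff_map,
      LinearMap.toAddMonoidHom_coe, LinearMap.toAddMonoidHom_coe, Polynomial.coe_mapRingHom,
      map_extendScalars, extendScalars_self]
  rw [e1, e2] at h'
  rw [h']
  congr 2
  · funext i
    rw [Polynomial.coe_mapRingHom, Polynomial.map_C, ← congrFun e1 i]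
    rfl
  · rw [← h']

end Binomial

/-! ### Hochschild 1-cocycles -/

section Cocycle

variable {K : Type*} [Field K]

/-- The coefficient of `y ^ a ⊗ y ^ b`. -/
noncomputable def tensorCoeff (K : Type*) [Field K] (a b : ℕ) : K[X] ⊗[K] K[X] →ₗ[K] K :=
  LinearMap.mul' K K ∘ₗ TensorProduct.map (Polynomial.lcoeff K a) (Polynomial.lcoeff K b)

lemma tensorCoeff_tmul (a b : ℕ) (p q : K[X]) :
    tensorCoeff K a b (p ⊗ₜ q) = p.coeff a * q.coeff b := rfl

/-- The cocycle condition on `y ^ n`, read off at `y ^ a ⊗ y ^ b`, for a coproduct with structure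
constants `c`. -/
lemma IsOneCocycle.coeff_apply_X_pow {Δ : K[X] →ₗ[K] K[X] ⊗[K] K[X]} {L : K[X] →ₗ[K] K[X]}
    (h : IsOneCocycle Δ L) {c : ℕ → ℕ → K} (hΔ : ∀ n, Δ (Polynomial.X ^ n) =
      ∑ k ∈ Finset.range (n + 1),
        c n k • ((Polynomial.X ^ k : K[X]) ⊗ₜ[K] (Polynomial.X ^ (n - k) : K[X]))) (n a b : ℕ) :
    c (a + b) a * (L (Polynomial.X ^ n)).coeff (a + b) =
      (if a ≤ n then c n a * (L (Polynomial.X ^ (n - a))).coeff b else 0) +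
        (L (Polynomial.X ^ n)).coeff a * if b = 0 then 1 else 0 := by
  have hcomul : ∀ p : K[X], tensorCoeff K a b (Δ p) = c (a + b) a * p.coeff (a + b) := by
    intro p
    induction p using Polynomial.induction_on' with
    | add p q hp hq => rw [map_add, map_add, hp, hq, Polynomial.coeff_add, mul_add]
    | monomial m r =>
      rw [← Polynomial.C_mul_X_pow_eq_monomial, ← Polynomial.smul_eq_C_mul, map_smul, map_smul, hΔ,
        map_sum, Polynomial.coeff_smul, Polynomial.coeff_X_pow, smul_eq_mul, smul_eq_mul]
      simp only [map_smul, tensorCoeff_tmul, Polynomial.coeff_X_pow, smul_eq_mul]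
      by_cases hm : a + b = m
      · subst hm
        rw [Finset.sum_eq_single_of_mem a (by simp), if_pos rfl, if_pos (by omega), if_pos rfl]
        · ring
        · intro k _ hk
          rw [if_neg (Ne.symm hk), zero_mul, mul_zero]
      · rw [if_neg hm, mul_zero, mul_zero, Finset.sum_eq_zero, mul_zero]
        intro k hk
        rw [Finset.mem_range] at hk
        by_cases hka : a = k
        · rw [if_neg (by omega : ¬ b = m - k), mul_zero, mul_zero]
        · rw [if_neg hka, zero_mul, mul_zero]
  have h1 := congrArg (tensorCoeff K a b) (h (Polynomial.X ^ n))
  rw [hcomul, map_add, tensorCoeff_tmul, hΔ, map_sum, map_sum, Polynomial.coeff_one] at h1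
  rw [h1]
  congr 1
  simp only [map_smul, LinearMap.lTensor_tmul, tensorCoeff_tmul, Polynomial.coeff_X_pow,
    smul_eq_mul]
  split_ifs with ha
  · rw [Finset.sum_eq_single_of_mem a (by simpa [Nat.lt_succ_iff] using ha), if_pos rfl, one_mul]
    intro k _ hk
    rw [if_neg (Ne.symm hk), zero_mul, mul_zero]
  · refine Finset.sum_eq_zero fun k hk => ?_
    rw [Finset.mem_range] at hk
    rw [if_neg (by omega), zero_mul, mul_zero]

lemma binomialComul_X_pow (n : ℕ) : binomialComul K (Polynomial.X ^ n) =
    ∑ k ∈ Finset.range (n + 1), (n.choose k : K) •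
      ((Polynomial.X ^ k : K[X]) ⊗ₜ[K] (Polynomial.X ^ (n - k) : K[X])) :=
  constr_basisMonomials_X_pow _ n

lemma dividedPowerComul_X_pow (n : ℕ) : dividedPowerComul K (Polynomial.X ^ n) =
    ∑ k ∈ Finset.range (n + 1), (1 : K) •
      ((Polynomial.X ^ k : K[X]) ⊗ₜ[K] (Polynomial.X ^ (n - k) : K[X])) := by
  simp only [one_smul]
  exact constr_basisMonomials_X_pow _ n

/-- A binomial 1-cocycle is determined by the coefficients `i! f_i` of `y` in `L (y ^ i)`. -/
lemma existsUnique_binomialSpecifies [CharZero K] {L : K[X] →ₗ[K] K[X]}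
    (h : IsOneCocycle (binomialComul K) L) : ∃! F : K⟦X⟧, BinomialSpecifies F L := by
  have hc := h.coeff_apply_X_pow binomialComul_X_pow
  refine ⟨PowerSeries.mk fun i => (L (Polynomial.X ^ i)).coeff 1 * (i.factorial : K)⁻¹, ?_, ?_⟩
  · intro n
    refine eq_of_derivative_eq ?_ ?_
    · ext a
      have h1 := hc n a 1
      rw [if_neg one_ne_zero, mul_zero, add_zero, Nat.choose_succ_self_right] at h1
      rw [derivative_integral, Polynomial.coeff_derivative, mul_comm, Polynomial.finsetSum_coeff]
      push_cast at h1
      rw [h1]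
      simp only [Polynomial.coeff_smul, Polynomial.coeff_iterate_derivative, Polynomial.coeff_X_pow,
        PowerSeries.coeff_mk]
      split_ifs with ha
      · rw [Finset.sum_eq_single_of_mem (n - a) (by simp), if_pos (by omega),
          (by omega : a + (n - a) = n), Nat.descFactorial_eq_factorial_mul_choose,
          Nat.choose_symm ha]
        · have hf : ((n - a).factorial : K) ≠ 0 := Nat.cast_ne_zero.2 (Nat.factorial_ne_zero _)
          rw [nsmul_one, smul_eq_mul]
          push_cast
          field_simp
        · intro i _ hi
          rw [if_neg (by omega), smul_zero, smul_zero]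
      · refine (Finset.sum_eq_zero fun i _ => ?_).symm
        rw [if_neg (by omega), smul_zero, smul_zero]
    · have h0 := hc n 0 0
      rw [coeff_zero_integral]
      simpa using h0
  · intro F hF
    ext n
    have hf : (n.factorial : K) ≠ 0 := Nat.cast_ne_zero.2 (Nat.factorial_ne_zero _)
    rw [PowerSeries.coeff_mk, hF.coeff_one]
    field_simp

/-- A divided power 1-cocycle is determined by the coefficients `f_i` of `y` in `L (y ^ i)`. -/
lemma existsUnique_dividedPowerSpecifies {L : K[X] →ₗ[K] K[X]}
    (h : IsOneCocycle (dividedPowerComul K) L) : ∃! F : K⟦X⟧, DividedPowerSpecifies F L := by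
  have hc := h.coeff_apply_X_pow (c := fun _ _ => 1) dividedPowerComul_X_pow
  refine ⟨PowerSeries.mk fun i => (L (Polynomial.X ^ i)).coeff 1, ?_, ?_⟩
  · intro n
    ext a
    cases a with
    | zero =>
      have h0 := hc n 0 0
      rw [Polynomial.coeff_X_mul_zero]
      simpa using h0
    | succ a =>
      have h1 := hc n a 1
      rw [if_neg one_ne_zero, mul_zero, add_zero, one_mul, one_mul] at h1
      rw [h1, Polynomial.coeff_X_mul, Polynomial.finsetSum_coeff]
      have e : ∀ i ∈ Finset.range (n + 1), (PowerSeries.coeff i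
          (PowerSeries.mk fun i => (L (Polynomial.X ^ i)).coeff 1) •
            Polynomial.divX^[i] (Polynomial.X ^ n : K[X])).coeff a =
          if a = n - i then (L (Polynomial.X ^ i)).coeff 1 else 0 := by
        intro i hi
        rw [iterate_divX_X_pow (by simpa [Nat.lt_succ_iff] using hi), PowerSeries.coeff_mk,
          Polynomial.coeff_smul, Polynomial.coeff_X_pow, smul_eq_mul, mul_ite, mul_one, mul_zero]
      rw [Finset.sum_congr rfl e]
      split_ifs with ha
      · rw [Finset.sum_eq_single_of_mem (n - a) (by simp), if_pos (by omega)]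
        intro i hi hia
        rw [Finset.mem_range] at hi
        rw [if_neg (by omega)]
      · refine (Finset.sum_eq_zero fun i _ => ?_).symm
        rw [if_neg (by omega)]
  · intro F hF
    ext n
    rw [PowerSeries.coeff_mk, hF.coeff_one]

end Cocycle

/-! ### Solutions of the tree-like equation -/

section TreeLike

variable {K : Type*} [Field K]

lemma subst_eq_compo (φ : K⟦X⟧) {G : K[X]⟦X⟧} (hG : PowerSeries.constantCoeff G = 0) :
    PowerSeries.subst G φ = compo (fun i => Polynomial.C (PowerSeries.coeff i φ)) G := by
  ext1 n
  rw [PowerSeries.coeff_subst' (PowerSeries.HasSubst.of_constantCoeff_zero' hG), compo,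
    PowerSeries.coeff_mk, finsum_eq_sum_of_support_subset (s := Finset.range (n + 1))]
  · simp only [Polynomial.smul_eq_C_mul]
  · intro k hk
    rw [Function.mem_support] at hk
    rw [Finset.coe_range, Set.mem_Iio]
    by_contra hkn
    exact hk (by rw [coeff_pow_eq_zero hG (by omega), smul_zero])

lemma mapCoeffs_eq_coeffMap (L : K[X] →ₗ[K] K[X]) (G : K[X]⟦X⟧) :
    mapCoeffs L G = coeffMap L.toAddMonoidHom G := rfl

variable {φ : K⟦X⟧} {L : K[X] →ₗ[K] K[X]}

/-- If `H = x φ(L H)`, then `L H` solves the tree-like equation. -/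
lemma isTreeLikeSolution_coeffMap {H : K[X]⟦X⟧} (hH : H = PowerSeries.X *
      compo (fun i => Polynomial.C (PowerSeries.coeff i φ)) (coeffMap L.toAddMonoidHom H)) :
    IsTreeLikeSolution φ L (coeffMap L.toAddMonoidHom H) := by
  have h0 : PowerSeries.constantCoeff (coeffMap L.toAddMonoidHom H) = 0 := by
    rw [← PowerSeries.coeff_zero_eq_constantCoeff_apply, coeff_coeffMap, hH,
      PowerSeries.coeff_zero_X_mul, map_zero]
  rw [IsTreeLikeSolution, subst_eq_compo φ h0, mapCoeffs_eq_coeffMap, ← coeffMap_X_mul, ← hH]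

lemma IsTreeLikeSolution.eq_compo {G : K[X]⟦X⟧} (hG : IsTreeLikeSolution φ L G) :
    G = PowerSeries.X * coeffMap L.toAddMonoidHom
      (compo (fun i => Polynomial.C (PowerSeries.coeff i φ)) G) := by
  have h0 : PowerSeries.constantCoeff G = 0 := by
    rw [← PowerSeries.coeff_zero_eq_constantCoeff_apply, hG, PowerSeries.coeff_zero_X_mul]
  rw [← subst_eq_compo φ h0]
  exact hG

lemma coeff_pow_congr {R : Type*} [CommRing R] {F G : R⟦X⟧} {n : ℕ}
    (h : ∀ i ≤ n, PowerSeries.coeff i F = PowerSeries.coeff i G) (k : ℕ) :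
    ∀ i ≤ n, PowerSeries.coeff i (F ^ k) = PowerSeries.coeff i (G ^ k) := by
  induction k with
  | zero => intro i _; rw [pow_zero, pow_zero]
  | succ k ih =>
    intro i hi
    rw [pow_succ', pow_succ', coeff_mul_congr fun j hj => h j (hj.trans hi), mul_comm,
      coeff_mul_congr fun j hj => ih j (hj.trans hi), mul_comm]

/-- The equation determines the coefficients of its solution one after the other. -/
lemma IsTreeLikeSolution.unique {G G' : K[X]⟦X⟧} (hG : IsTreeLikeSolution φ L G)
    (hG' : IsTreeLikeSolution φ L G') : G = G' := by
  ext1 n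
  induction n using Nat.strong_induction_on with
  | _ n ih =>
    rw [hG.eq_compo, hG'.eq_compo]
    cases n with
    | zero => rw [PowerSeries.coeff_zero_X_mul, PowerSeries.coeff_zero_X_mul]
    | succ n =>
      rw [PowerSeries.coeff_succ_X_mul, PowerSeries.coeff_succ_X_mul, coeff_coeffMap,
        coeff_coeffMap, compo, compo, PowerSeries.coeff_mk, PowerSeries.coeff_mk]
      congr 1
      refine Finset.sum_congr rfl fun k _ => ?_
      rw [coeff_pow_congr (fun i hi => ih i (Nat.lt_succ_of_le hi)) k n le_rfl]

lemma binomialGF_eq (φ F : K⟦X⟧) (L : K[X] →ₗ[K] K[X]) : binomialGF φ F L =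
    coeffMap L.toAddMonoidHom (connectedSeries (fun i => PowerSeries.coeff i φ) F) := by
  ext1 n
  rw [binomialGF, PowerSeries.coeff_mk, coeff_coeffMap, coeff_connectedSeries, map_sum]
  refine Finset.sum_congr rfl fun C _ => ?_
  rw [LinearMap.toAddMonoidHom_coe, ← Polynomial.smul_eq_C_mul, map_smul, ← phiWeight_eq,
    Algebra.algebraMap_self, RingHom.id_apply, mul_right_comm]

lemma dividedPowerGF_eq (φ F : K⟦X⟧) (L : K[X] →ₗ[K] K[X]) :
    dividedPowerGF φ F L = coeffMap L.toAddMonoidHom (openSeries φ F 0) := by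
  ext1 n
  rw [dividedPowerGF, PowerSeries.coeff_mk, coeff_coeffMap, coeff_openSeries, map_sum]
  refine Finset.sum_congr rfl fun C _ => ?_
  rw [LinearMap.toAddMonoidHom_coe, ← Polynomial.smul_eq_C_mul, map_smul, openWeight_zero,
    ← phiWeight_eq]

lemma BinomialSpecifies.isTreeLikeSolution [CharZero K] {F : K⟦X⟧} (hL : BinomialSpecifies F L) :
    IsTreeLikeSolution φ L (binomialGF φ F L) := by
  rw [binomialGF_eq]
  exact isTreeLikeSolution_coeffMap (connectedSeries_eq _ hL)

lemma DividedPowerSpecifies.isTreeLikeSolution {F : K⟦X⟧} (hL : DividedPowerSpecifies F L) :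
    IsTreeLikeSolution φ L (dividedPowerGF φ F L) := by
  rw [dividedPowerGF_eq]
  exact isTreeLikeSolution_coeffMap (openSeries_eq hL)

end TreeLike

end ChordDiagram

theorem theorem5p1 {K : Type*} [Field K] [CharZero K] (φ : K⟦X⟧)
    (hφ : PowerSeries.constantCoeff φ = 1) (L : K[X] →ₗ[K] K[X]) :
    (ChordDiagram.IsOneCocycle (ChordDiagram.binomialComul K) L →
      (∃! F : K⟦X⟧, ChordDiagram.BinomialSpecifies F L) ∧
      ∀ F : K⟦X⟧, ChordDiagram.BinomialSpecifies F L →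
        ChordDiagram.IsTreeLikeSolution φ L (ChordDiagram.binomialGF φ F L) ∧
        ∀ G : K[X]⟦X⟧, ChordDiagram.IsTreeLikeSolution φ L G →
          G = ChordDiagram.binomialGF φ F L) ∧
    (ChordDiagram.IsOneCocycle (ChordDiagram.dividedPowerComul K) L →
      (∃! F : K⟦X⟧, ChordDiagram.DividedPowerSpecifies F L) ∧
      ∀ F : K⟦X⟧, ChordDiagram.DividedPowerSpecifies F L →
        ChordDiagram.IsTreeLikeSolution φ L (ChordDiagram.dividedPowerGF φ F L) ∧
        ∀ G : K[X]⟦X⟧, ChordDiagram.IsTreeLikeSolution φ L G →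
          G = ChordDiagram.dividedPowerGF φ F L) := by
  refine ⟨fun h => ⟨ChordDiagram.existsUnique_binomialSpecifies h, fun F hF => ?_⟩,
    fun h => ⟨ChordDiagram.existsUnique_dividedPowerSpecifies h, fun F hF => ?_⟩⟩
  · exact ⟨hF.isTreeLikeSolution, fun G hG => hG.unique hF.isTreeLikeSolution⟩
  · exact ⟨hF.isTreeLikeSolution, fun G hG => hG.unique hF.isTreeLikeSolution⟩
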